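/- Let $k$ be a field of characteristic different from $2$; all spaces are finite dimensional over $k$. A Hurwitz superalgebra is a nonzero unital superalgebra $C=C_{\bar 0}\oplus C_{\bar 1}$ with a regular quadratic superform $(q_{\bar 0},\mathrm b)$ (a quadratic form $q_{\bar0}$ on $C_{\bar0}$ and an even nondegenerate supersymmetric bilinear form $\mathrm b$ extending its polar form) such that $q_{\bar0}(x_{\bar0}y_{\bar0})=q_{\bar0}(x_{\bar0})q_{\bar0}(y_{\bar0})$, $\mathrm b(x_{\bar 0}y,x_{\bar 0}z)=q_{\bar 0}(x_{\bar 0})\mathrm b(y,z)=\mathrm b(yx_{\bar 0},zx_{\bar 0})$ and $\mathrm b(xy,zt)+(-1)^{xy+xz+yz}\mathrm b(zy,xt)=(-1)^{yz}\mathrm b(x,z)\mathrm b(y,t)$ for even $x_{\bar0},y_{\bar0}$ and homogeneous $x,y,z,t$. Its standard involution is $\bar x=\mathrm b(x,1)1-x$. Let $S$ be the associated para-Hurwitz superalgebra: the superspace $C$ with product $x\bullet y=\bar x\bar y$. Let $Q$ be a quaternion algebra (a four-dimensional Hurwitz algebra, with trivial odd part), let $\bar Q$ be the space $Q$ with product $x\bullet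 y=\overline{xy}$, let $L_a,R_a$ be the left and right multiplications in $Q$, and let $Q^0=\{a\in Q:\mathrm b(a,1)=0\}$. For a symmetric composition superalgebra $A$ with product $\bullet$ and form $\mathrm b$, let $\mathfrak{tri}(A)=\mathfrak{tri}(A)_{\bar0}\oplus\mathfrak{tri}(A)_{\bar1}$, where $\mathfrak{tri}(A)_{\bar\imath}$ consists of the triples $(d_0,d_1,d_2)\in\mathfrak{osp}(A,\mathrm b)_{\bar\imath}^3$ with $d_0(x\bullet y)=d_1(x)\bullet y+(-1)^{ix}x\bullet d_2(y)$. Let $\theta(d_0,d_1,d_2)=(d_2,d_0,d_1)$ and $t_{x,y}=(\sigma_{x,y},\frac12\mathrm b(x,y)1-r_xl_y,\frac12\mathrm b(x,y)1-l_xr_y)$, where $l_x(y)=x\bullet y$, $r_x(y)=(-1)^{xy}y\bullet x$, $\sigma_{x,y}(z)=(-1)^{yz}\mathrm b(x,z)y-(-1)^{x(y+z)}\mathrm b(y,z)x$. For two symmetric composition superalgebras $A,A'$ let $\mathfrak g(A,A')=\mathfrak{tri}(A)\oplus\mathfrak{tri}(A')\oplus\bigoplus_{i=0}^2\iota_i(A\otimes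 A')$, where $\iota_i(A\otimes A')$ is a copy of $A\otimes A'$, with the superanticommutative bracket (indices modulo $3$) that is the componentwise supercommutator on the direct sum $\mathfrak{tri}(A)\oplus\mathfrak{tri}(A')$ and satisfies $[(d_j),\iota_i(x\otimes x')]=\iota_i(d_i(x)\otimes x')$, $[(d'_j),\iota_i(x\otimes x')]=(-1)^{d'_ix}\iota_i(x\otimes d'_i(x'))$, $[\iota_i(x\otimes x'),\iota_{i+1}(y\otimes y')]=(-1)^{x'y}\iota_{i+2}((x\bullet y)\otimes(x'\bullet y'))$, $[\iota_i(x\otimes x'),\iota_i(y\otimes y')]=(-1)^{xx'+xy'+yy'}\mathrm b'(x',y')\theta^i(t_{x,y})+(-1)^{yx'}\mathrm b(x,y)\theta'^i(t'_{x',y'})$. Let $J=H_3(C)$ be the superspace of hermitian $3\times3$ matrices over $C$ with product $X\circ Y=\frac12(XY+(-1)^{XY}YX)$, and let $L_X$ be the multiplication by $X$ in $J$ and $d_{X,Y}=[L_X,L_Y]$ (supercommutator). For $i$ modulo $3$ and with rows and columns numbered $0,1,2$, let $e_i$ be the diagonal matrix unit at $(i,i)$, and for $a\in S$ let $\iota_i(a)$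 be twice the matrix with entry $a$ at $(i+2,i+1)$, $\bar a$ at $(i+1,i+2)$ and zeros elsewhere. Let $\mathrm{der}\,J$ be the Lie superalgebra of derivations of $J$ and let $\mathcal T(Q,J)=(Q^0\otimes J)\oplus\mathrm{der}\,J$ be the Tits construction, with the superanticommutative bracket that is the supercommutator on $\mathrm{der}\,J$ and satisfies $[d,a\otimes X]=a\otimes d(X)$ and $[a\otimes X,b\otimes Y]=[a,b]\otimes(X\circ Y)-2\mathrm b(a,b)d_{X,Y}$. Let $S_1=k1$ with $1\bullet1=1$ and $\mathrm b(1,1)=2$ (so $\mathfrak{tri}(S_1)=0$), and regard $\mathfrak g(S_1,S)=\mathfrak{tri}(S)\oplus\bigoplus_i\iota_i(1\otimes S)$ as a subspace of $\mathfrak g(\bar Q,S)$ through $k1\subseteq\bar Q$. Let $\Phi:\mathfrak g(S_1,S)\to\mathrm{der}\,J$ be the linear map with $\Phi((d_0,d_1,d_2))=D_{(d_0,d_1,d_2)}$, where $D_{(d_0,d_1,d_2)}(e_i)=0$ and $D_{(d_0,d_1,d_2)}(\iota_i(a))=\iota_i(d_i(a))$, and $\Phi(\iota_i(1\otimes a))=D_i(a):=2[L_{\iota_i(a)},L_{e_{i+1}}]$.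 Then $\mathfrak g(\bar Q,S)$ and $\mathcal T(Q,J)$ are Lie superalgebras; the kernels of the projections $\pi_i$ of $\mathfrak{tri}(\bar Q)$ onto the $i$-th component are $\ker\pi_0=\{(0,-R_a,L_a):a\in Q^0\}$, $\ker\pi_1=\{(L_a,0,-R_a):a\in Q^0\}$, $\ker\pi_2=\{(-R_a,L_a,0):a\in Q^0\}$; and there is an isomorphism of Lie superalgebras $\Phi_3:\mathfrak g(\bar Q,S)\to\mathcal T(Q,J)$ such that * the restriction of $\Phi_3$ to $\mathfrak g(S_1,S)$ is $\Phi$; * for $a\in Q^0$, the elements $(0,-R_a,L_a)$, $(L_a,0,-R_a)$ and $(-R_a,L_a,0)$ of $\mathfrak{tri}(\bar Q)$ map to $a\otimes e_0$, $a\otimes e_1$ and $a\otimes e_2$, respectively; * $\Phi_3(\iota_i(a\otimes x))=-\frac12\,a\otimes\iota_i(x)$ for $i=0,1,2$, $a\in Q^0$, $x\in S$. -/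

import Mathlib

open scoped TensorProduct

noncomputable section

/-- The sign `(-1) ^ n` in the ground field, for a parity `n`. -/
def sgn (k : Type*) [Field k] (n : ZMod 2) : k := if n = 0 then 1 else -1

/-- A superspace: a `ℤ/2`-graded vector space, given by the projections onto its even part
(`proj 0`) and its odd part (`proj 1`). -/
class Superspace (k V : Type*) [Field k] [AddCommGroup V] [Module k V] where
  proj : ZMod 2 → Module.End k V
  proj_idem : ∀ p v, proj p (proj p v) = proj p v
  proj_add : ∀ v, proj 0 v + proj 1 v = v

namespace Superspace

variable {k V W U : Type*} [Field k] [AddCommGroup V] [Module k V] [Superspace k V]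
  [AddCommGroup W] [Module k W] [Superspace k W] [AddCommGroup U] [Module k U]

/-- The subspace of homogeneous elements of parity `p`. -/
def part (k V : Type*) [Field k] [AddCommGroup V] [Module k V] [Superspace k V] (p : ZMod 2) :
    Submodule k V := LinearMap.range (proj (k := k) (V := V) p)

theorem sum_two {M : Type*} [AddCommMonoid M] (f : ZMod 2 → M) : ∑ q, f q = f 0 + f 1 :=
  Fin.sum_univ_two f

theorem one_add_one : (1 + 1 : ZMod 2) = 0 := rfl

theorem parity_cases (p : ZMod 2) : p = 0 ∨ p = 1 := by
  revert p; decide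

theorem proj_orth (p : ZMod 2) (v : V) :
    proj (k := k) (p + 1) (proj (k := k) p v) = 0 := by
  have h := proj_add (k := k) (proj (k := k) p v)
  rcases parity_cases p with rfl | rfl
  · rw [proj_idem] at h; simpa using h
  · rw [proj_idem] at h; simpa [one_add_one] using h

theorem proj_zero_one (v : V) : proj (k := k) 0 (proj (k := k) 1 v) = 0 := proj_orth 1 v

theorem proj_one_zero (v : V) : proj (k := k) 1 (proj (k := k) 0 v) = 0 := proj_orth 0 v

/-- The grading of the space of endomorphisms: `f` has parity `p` when it maps the part of
parity `q` into the part of parity `p + q`. -/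
instance instEnd : Superspace k (Module.End k V) where
  proj p := ∑ q, (LinearMap.mulLeft k (proj (k := k) (V := V) (p + q))) ∘ₗ
    (LinearMap.mulRight k (proj (k := k) (V := V) q))
  proj_idem p f := by
    ext v
    rcases parity_cases p with rfl | rfl <;>
      simp [sum_two, one_add_one, proj_idem, proj_zero_one, proj_one_zero]
  proj_add f := by
    ext v
    have h := proj_add (k := k) (f (proj (k := k) 0 v))
    have h' := proj_add (k := k) (f (proj (k := k) 1 v))
    simp only [sum_two, one_add_one, LinearMap.add_apply, LinearMap.comp_apply,
      LinearMap.mulLeft_apply, LinearMap.mulRight_apply, Module.End.mul_apply, add_zero, zero_add]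
    calc _ = (proj (k := k) 0 (f (proj (k := k) 0 v)) + proj (k := k) 1 (f (proj (k := k) 0 v)))
          + (proj (k := k) 0 (f (proj (k := k) 1 v))
            + proj (k := k) 1 (f (proj (k := k) 1 v))) := by abel
      _ = f v := by rw [h, h', ← map_add, proj_add]

/-- The grading of a tensor product: parities add. -/
instance instTensor : Superspace k (V ⊗[k] W) where
  proj p := ∑ q, TensorProduct.map (proj (k := k) (V := V) q) (proj (k := k) (V := W) (p - q))
  proj_idem p z := by
    induction z with
    | zero => simp
    | add x y hx hy => simp only [map_add, hx, hy]
    | tmul x y =>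
      rcases parity_cases p with rfl | rfl <;>
        simp [sum_two, proj_idem, proj_zero_one, proj_one_zero]
  proj_add z := by
    induction z with
    | zero => simp
    | add x y hx hy =>
      simp only [map_add]
      conv_rhs => rw [← hx, ← hy]
      abel
    | tmul x y =>
      have e : (0 - 1 : ZMod 2) = 1 := rfl
      conv_rhs => rw [← proj_add (k := k) x, ← proj_add (k := k) y]
      simp only [sum_two, e, LinearMap.add_apply, TensorProduct.map_tmul, sub_zero, sub_self,
        TensorProduct.add_tmul, TensorProduct.tmul_add]
      abel

instance instProd : Superspace k (V × W) where
  proj p := (proj (k := k) (V := V) p).prodMap (proj (k := k) (V := W) p)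
  proj_idem p z := by ext <;> simp [proj_idem]
  proj_add z := by ext <;> simp [proj_add]

instance instPi {ι : Type*} : Superspace k (ι → V) where
  proj p := LinearMap.compLeft (proj (k := k) (V := V) p) ι
  proj_idem p z := by ext; simp [proj_idem]
  proj_add z := by ext; simp [proj_add]

instance instMatrix {m n : Type*} : Superspace k (Matrix m n V) where
  proj p := (proj (k := k) (V := V) p).mapMatrix
  proj_idem p z := by ext; simp [proj_idem]
  proj_add z := by ext; simp [proj_add]

/-- The ground field is purely even. -/
instance instField : Superspace k k where
  proj p := if p = 0 then LinearMap.id else 0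
  proj_idem p v := by split_ifs <;> simp
  proj_add v := by simp

/-- The super-opposite of a bilinear map: on homogeneous elements,
`superFlip f x y = (-1) ^ (|x| |y|) f y x`. -/
def superFlip (f : V →ₗ[k] W →ₗ[k] U) : W →ₗ[k] V →ₗ[k] U :=
  ∑ p : ZMod 2, ∑ q : ZMod 2, sgn k (p * q) •
    f.flip.compl₁₂ (proj (k := k) (V := W) p) (proj (k := k) (V := V) q)

theorem superFlip_apply (f : V →ₗ[k] W →ₗ[k] U) (x : W) (y : V) :
    superFlip f x y = ∑ p : ZMod 2, ∑ q : ZMod 2,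
      sgn k (p * q) • f (proj (k := k) q y) (proj (k := k) p x) := by
  simp [superFlip, sum_two]

/-- The supercommutator `[f, g] = f g - (-1) ^ (|f| |g|) g f` of endomorphisms. -/
def superComm (k V : Type*) [Field k] [AddCommGroup V] [Module k V] [Superspace k V] :
    Module.End k V →ₗ[k] Module.End k V →ₗ[k] Module.End k V :=
  LinearMap.mul k (Module.End k V) - superFlip (LinearMap.mul k (Module.End k V))

end Superspace

open Superspace

/-! ### Lie superalgebras

A Lie superalgebra is given by a graded subspace `L` of a superspace `A` and an operation `br`
on `A` that restricts to a superbracket on `L`. -/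

/-- `L` is a Lie superalgebra under `br`. The axiom `odd_cube` follows from the Jacobi identity
unless the characteristic is three. -/
structure IsLieSuperalgebra {k A : Type*} [Field k] [AddCommGroup A] [Module k A] [Superspace k A]
    (br : A → A → A) (L : Submodule k A) : Prop where
  graded : ∀ p, ∀ x ∈ L, proj (k := k) p x ∈ L
  closed : ∀ x ∈ L, ∀ y ∈ L, br x y ∈ L
  add_left : ∀ x ∈ L, ∀ y ∈ L, ∀ z ∈ L, br (x + y) z = br x z + br y z
  add_right : ∀ x ∈ L, ∀ y ∈ L, ∀ z ∈ L, br x (y + z) = br x y + br x z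
  smul_left : ∀ c : k, ∀ x ∈ L, ∀ y ∈ L, br (c • x) y = c • br x y
  smul_right : ∀ c : k, ∀ x ∈ L, ∀ y ∈ L, br x (c • y) = c • br x y
  even : ∀ p q, ∀ x ∈ L ⊓ part k A p, ∀ y ∈ L ⊓ part k A q, br x y ∈ part k A (p + q)
  skew : ∀ p q, ∀ x ∈ L ⊓ part k A p, ∀ y ∈ L ⊓ part k A q, br x y = -(sgn k (p * q) • br y x)
  jacobi : ∀ p q, ∀ x ∈ L ⊓ part k A p, ∀ y ∈ L ⊓ part k A q, ∀ z ∈ L,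
    br x (br y z) = br (br x y) z + sgn k (p * q) • br y (br x z)
  odd_cube : ∀ x ∈ L ⊓ part k A 1, br (br x x) x = 0

/-- The linear isomorphism `Φ` preserves parities and brackets. -/
structure IsLieSuperIso {k A A' : Type*} [Field k] [AddCommGroup A] [Module k A] [Superspace k A]
    [AddCommGroup A'] [Module k A'] [Superspace k A'] (br : A → A → A) (L : Submodule k A)
    (br' : A' → A' → A') (L' : Submodule k A') (Φ : L ≃ₗ[k] L') : Prop where
  even : ∀ p, ∀ x : L, (x : A) ∈ part k A p → (Φ x : A') ∈ part k A' p
  map_bracket : ∀ x y z : L, (z : A) = br x y → (Φ z : A') = br' (Φ x) (Φ y)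

/-! ### Hurwitz superalgebras -/

/-- A Hurwitz superalgebra: a unital superalgebra with a regular quadratic superform
`(q, b)` that admits composition. -/
class HurwitzSuperalgebra (k C : Type*) [Field k] [NonAssocRing C] [Module k C]
    [IsScalarTower k C C] [SMulCommClass k C C] extends Superspace k C where
  one_mem : (1 : C) ∈ part k C 0
  mul_mem : ∀ p q, ∀ x ∈ part k C p, ∀ y ∈ part k C q, x * y ∈ part k C (p + q)
  /-- The quadratic form on the even part. -/
  q : QuadraticForm k (part k C 0)
  /-- The bilinear form. -/
  b : C →ₗ[k] C →ₗ[k] k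
  b_even : ∀ x ∈ part k C 0, ∀ y ∈ part k C 1, b x y = 0
  b_supersymm : ∀ p q, ∀ x ∈ part k C p, ∀ y ∈ part k C q, b x y = sgn k (p * q) * b y x
  b_polar : ∀ x y : part k C 0, b x y = QuadraticMap.polar q x y
  b_nondegenerate : b.Nondegenerate
  q_mul : ∀ x y z : part k C 0, (z : C) = x * y → q z = q x * q y
  b_mul_left : ∀ (x : part k C 0) (y z : C), b (x * y) (x * z) = q x * b y z
  b_mul_right : ∀ (x : part k C 0) (y z : C), b (y * x) (z * x) = q x * b y z
  b_mul_mul : ∀ px py pz pt, ∀ x ∈ part k C px, ∀ y ∈ part k C py,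
    ∀ z ∈ part k C pz, ∀ t ∈ part k C pt,
    b (x * y) (z * t) + sgn k (px * py + px * pz + py * pz) * b (z * y) (x * t) =
      sgn k (py * pz) * (b x z * b y t)

/-- A quaternion algebra: a purely even Hurwitz superalgebra of dimension four. -/
structure IsQuaternionAlgebra (k Q : Type*) [Field k] [NonAssocRing Q] [Module k Q]
    [IsScalarTower k Q Q] [SMulCommClass k Q Q] [HurwitzSuperalgebra k Q] : Prop where
  odd_eq_bot : part k Q 1 = ⊥
  finrank_eq : Module.finrank k Q = 4

namespace HurwitzSuperalgebra

section

variable (k C : Type*) [Field k] [NonAssocRing C] [Module k C]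
  [IsScalarTower k C C] [SMulCommClass k C C] [HurwitzSuperalgebra k C]

/-- The standard involution `x ↦ b(x, 1) 1 - x`. -/
def conj : C →ₗ[k] C := ((b : C →ₗ[k] C →ₗ[k] k).flip 1).smulRight 1 - LinearMap.id

/-- The para-Hurwitz product `x • y = x̄ ȳ`. -/
def paraMul : C →ₗ[k] C →ₗ[k] C := (LinearMap.mul k C).compl₁₂ (conj k C) (conj k C)

/-- The product of the para-Hurwitz algebra attached to the opposite algebra,
`x • y = \overline{x y}`. -/
def paraMulOp : C →ₗ[k] C →ₗ[k] C := (LinearMap.mul k C).compr₂ (conj k C)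

/-- The subspace of trace zero elements, orthogonal to the unity. -/
def traceZero : Submodule k C := LinearMap.ker ((b : C →ₗ[k] C →ₗ[k] k).flip 1)

end

variable {k C : Type*} [Field k] [NonAssocRing C] [Module k C]
  [IsScalarTower k C C] [SMulCommClass k C C] [HurwitzSuperalgebra k C]

theorem conj_apply (x : C) : conj k C x = (b x (1 : C) : k) • (1 : C) - x := by
  simp [conj]

theorem two_smul_one : (b (1 : C) (1 : C) : k) • (1 : C) = (2 : k) • (1 : C) := by
  rcases subsingleton_or_nontrivial C with h | h
  · exact Subsingleton.elim _ _
  · set u : part k C 0 := ⟨1, one_mem⟩ with hu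
    have hq : q u = 1 := by
      by_contra hne
      have h1 : (1 : C) = 0 := by
        refine (b_nondegenerate (k := k) (C := C)).1 1 fun y => ?_
        have h := b_mul_left u 1 y
        have h0 : (q u - 1) * (b (1 : C) y : k) = 0 := by
          rw [sub_mul, ← h]; simp [hu]
        exact (mul_eq_zero.mp h0).resolve_left (sub_ne_zero.mpr hne)
      exact one_ne_zero h1
    have hb : (b (1 : C) (1 : C) : k) = 2 := by
      have h := b_polar u u
      rw [QuadraticMap.polar_self, hq] at h
      simpa [hu] using h
    rw [hb]

theorem conj_one : conj k C (1 : C) = 1 := by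
  rw [conj_apply, two_smul_one, two_smul]; abel

theorem conj_conj (x : C) : conj k C (conj k C x) = x := by
  conv_lhs => rw [conj_apply (k := k) x]
  rw [map_sub, map_smul, conj_one, conj_apply]; abel

theorem b_one_odd {x : C} (hx : x ∈ part k C 1) : (b x (1 : C) : k) = 0 := by
  rw [b_supersymm 1 0 x hx 1 one_mem, b_even 1 one_mem x hx, mul_zero]

theorem proj_of_mem {V : Type*} [AddCommGroup V] [Module k V] [Superspace k V] {p : ZMod 2} {x : V}
    (hx : x ∈ part k V p) : proj (k := k) p x = x := by
  obtain ⟨y, rfl⟩ := hx; exact proj_idem p y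

theorem proj_mem {V : Type*} [AddCommGroup V] [Module k V] [Superspace k V] (p : ZMod 2) (x : V) :
    proj (k := k) p x ∈ part k V p := ⟨x, rfl⟩

theorem conj_mem (p : ZMod 2) {x : C} (hx : x ∈ part k C p) : conj k C x ∈ part k C p := by
  rw [conj_apply]
  rcases parity_cases p with rfl | rfl
  · exact sub_mem (Submodule.smul_mem _ _ one_mem) hx
  · rw [b_one_odd hx, zero_smul, zero_sub]; exact neg_mem hx

theorem proj_conj (p : ZMod 2) (x : C) :
    proj (k := k) p (conj k C x) = conj k C (proj (k := k) p x) := by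
  conv_lhs => rw [← proj_add (k := k) x]
  have h0 := conj_mem 0 (proj_mem (k := k) 0 x)
  have h1 := conj_mem 1 (proj_mem (k := k) 1 x)
  rw [map_add, map_add]
  rcases parity_cases p with rfl | rfl
  · rw [proj_of_mem h0, ← proj_of_mem h1, proj_zero_one, add_zero]
  · rw [proj_of_mem h1, ← proj_of_mem h0, proj_one_zero, zero_add]

theorem sgn_mul_b_one (p q : ZMod 2) {x : C} (hx : x ∈ part k C p) :
    sgn k (p * q) * (b x (1 : C) : k) = b x (1 : C) := by
  rcases parity_cases p with rfl | rfl
  · simp [sgn]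
  · simp [b_one_odd hx]

theorem b_one_comm {x : C} (p : ZMod 2) (hx : x ∈ part k C p) :
    (b (1 : C) x : k) = b x (1 : C) := by
  rw [b_supersymm 0 p 1 one_mem x hx]; simp [sgn]

theorem b_mul_one_left (p q r : ZMod 2) {x y t : C} (hx : x ∈ part k C p) (hy : y ∈ part k C q)
    (ht : t ∈ part k C r) :
    (b (x * y) t : k) = b x (1 : C) * b y t - sgn k (p * q) * b y (x * t) := by
  have h := b_mul_mul (k := k) p q 0 r x hx y hy 1 one_mem t ht
  simp only [one_mul, mul_zero, add_zero] at h
  rw [eq_sub_iff_add_eq, h]; simp [sgn]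

theorem b_mul_swap (p q r : ZMod 2) {x y t : C} (hx : x ∈ part k C p) (hy : y ∈ part k C q)
    (ht : t ∈ part k C r) :
    (b x (y * t) : k) = b x y * b (1 : C) t - sgn k (p * q) * b y (x * t) := by
  have h := b_mul_mul (k := k) p 0 q r x hx 1 one_mem y hy t ht
  simp only [mul_one, mul_zero, zero_mul, add_zero, zero_add] at h
  rw [eq_sub_iff_add_eq, h]; simp [sgn]

theorem eq_of_b {x y : C} (h : ∀ r, ∀ t ∈ part k C r, (b x t : k) = b y t) : x = y := by
  rw [← sub_eq_zero]
  refine (b_nondegenerate (k := k) (C := C)).1 _ fun t => ?_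
  rw [← proj_add (k := k) t, map_add, map_sub, LinearMap.sub_apply, LinearMap.sub_apply,
    h 0 _ (proj_mem 0 t), h 1 _ (proj_mem 1 t)]
  simp

theorem mul_add_mul (p q : ZMod 2) {x y : C} (hx : x ∈ part k C p) (hy : y ∈ part k C q) :
    x * y + sgn k (p * q) • (y * x) =
      (b y (1 : C) : k) • x + (b x (1 : C) : k) • y - (b x y : k) • (1 : C) := by
  refine eq_of_b (k := k) fun r t ht => ?_
  have e1 := b_mul_one_left p q r hx hy ht
  have e2 := b_mul_one_left q p r hy hx ht
  have e3 := b_mul_swap q p r hy hx ht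
  have e4 := b_supersymm (k := k) p q x hx y hy
  have e5 := sgn_mul_b_one (k := k) q p hy
  rw [mul_comm q p] at e2 e3 e5
  simp only [map_add, map_sub, map_smul, LinearMap.add_apply, LinearMap.sub_apply,
    LinearMap.smul_apply, smul_eq_mul]
  rw [e1, e2, e3, e4]
  linear_combination (b x t : k) * e5

theorem conj_mul (x y : C) :
    conj k C (x * y) = superFlip (LinearMap.mul k C) (conj k C x) (conj k C y) := by
  have key : ∀ p q : ZMod 2, ∀ x ∈ part k C p, ∀ y ∈ part k C q,
      conj k C (x * y) = sgn k (p * q) • (conj k C y * conj k C x) := by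
    intro p q x hx y hy
    have h := mul_add_mul p q hx hy
    have hb := b_mul_one_left p q 0 hx hy one_mem
    have e4 := b_supersymm (k := k) p q x hx y hy
    have e5 := sgn_mul_b_one (k := k) q p hy
    have e5' := sgn_mul_b_one (k := k) p q hx
    rw [mul_comm q p] at e5
    rw [mul_one, ← e4] at hb
    rw [conj_apply, conj_apply x, conj_apply y, hb, eq_sub_of_add_eq h]
    simp only [sub_mul, mul_sub, smul_mul_assoc, mul_smul_comm, one_mul, mul_one, smul_sub,
      smul_smul]
    rw [e5, e5', ← mul_assoc, e5']
    module
  rw [superFlip_apply]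
  simp only [sum_two, proj_conj, LinearMap.mul_apply']
  rw [← key 0 0 _ (proj_mem 0 x) _ (proj_mem 0 y), ← key 0 1 _ (proj_mem 0 x) _ (proj_mem 1 y),
    ← key 1 0 _ (proj_mem 1 x) _ (proj_mem 0 y), ← key 1 1 _ (proj_mem 1 x) _ (proj_mem 1 y),
    ← map_add, ← map_add, ← map_add, ← mul_add, ← mul_add, ← add_mul, proj_add, proj_add]

theorem conj_superFlip (x y : C) :
    conj k C (superFlip (LinearMap.mul k C) x y) = conj k C x * conj k C y := by
  rw [← conj_conj (k := k) x, ← conj_conj (k := k) y, ← conj_mul, conj_conj, conj_conj, conj_conj]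

end HurwitzSuperalgebra

/-! ### Triality and the Lie superalgebra of two symmetric composition superalgebras

A symmetric composition superalgebra enters through its superspace `A`, its product `m` and its
bilinear form `b`. -/

section Triality

variable {k A : Type*} [Field k] [AddCommGroup A] [Module k A] [Superspace k A]

/-- The part of parity `p` of the orthosymplectic Lie superalgebra. -/
def ospPart (b : A →ₗ[k] A →ₗ[k] k) (p : ZMod 2) : Submodule k (Module.End k A) where
  carrier := {d | d ∈ part k (Module.End k A) p ∧
    ∀ r, ∀ x ∈ part k A r, ∀ y, b (d x) y + sgn k (p * r) * b x (d y) = 0}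
  zero_mem' := ⟨zero_mem _, by simp⟩
  add_mem' := by
    rintro d e ⟨hd, hd'⟩ ⟨he, he'⟩
    refine ⟨add_mem hd he, fun r x hx y => ?_⟩
    simp only [LinearMap.add_apply, map_add]
    linear_combination hd' r x hx y + he' r x hx y
  smul_mem' := by
    rintro c d ⟨hd, hd'⟩
    refine ⟨Submodule.smul_mem _ c hd, fun r x hx y => ?_⟩
    simp only [LinearMap.smul_apply, map_smul, smul_eq_mul]
    linear_combination c * hd' r x hx y

/-- The part of parity `p` of the triality Lie superalgebra. -/
def triPart (m : A →ₗ[k] A →ₗ[k] A) (b : A →ₗ[k] A →ₗ[k] k) (p : ZMod 2) :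
    Submodule k (Fin 3 → Module.End k A) where
  carrier := {d | (∀ i, d i ∈ ospPart b p) ∧
    ∀ r, ∀ x ∈ part k A r, ∀ y, d 0 (m x y) = m (d 1 x) y + sgn k (p * r) • m x (d 2 y)}
  zero_mem' := ⟨fun _ => zero_mem _, by simp⟩
  add_mem' := by
    rintro d e ⟨hd, hd'⟩ ⟨he, he'⟩
    refine ⟨fun i => add_mem (hd i) (he i), fun r x hx y => ?_⟩
    simp only [Pi.add_apply, LinearMap.add_apply, map_add, hd' r x hx y, he' r x hx y]
    module
  smul_mem' := by
    rintro c d ⟨hd, hd'⟩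
    refine ⟨fun i => Submodule.smul_mem _ c (hd i), fun r x hx y => ?_⟩
    simp only [Pi.smul_apply, LinearMap.smul_apply, map_smul, hd' r x hx y]
    module

/-- The triality Lie superalgebra, inside the space of triples of endomorphisms. -/
def tri (m : A →ₗ[k] A →ₗ[k] A) (b : A →ₗ[k] A →ₗ[k] k) : Submodule k (Fin 3 → Module.End k A) :=
  triPart m b 0 ⊔ triPart m b 1

/-- `σ_{x,y}(z) = (-1)^{yz} b(x,z) y - (-1)^{x(y+z)} b(y,z) x` for homogeneous `x, y, z`. -/
def sigma (b : A →ₗ[k] A →ₗ[k] k) : A →ₗ[k] A →ₗ[k] Module.End k A :=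
  LinearMap.mk₂ k
    (fun x y => ∑ p : ZMod 2, ∑ q : ZMod 2, ∑ r : ZMod 2,
      (sgn k (q * r) • (b (proj (k := k) p x)).smulRight (proj (k := k) q y)
        - sgn k (p * (q + r)) • (b (proj (k := k) q y)).smulRight (proj (k := k) p x))
        ∘ₗ proj (k := k) r)
    (fun x x' y => by
      ext z
      simp only [sum_two, LinearMap.add_apply, LinearMap.comp_apply, LinearMap.sub_apply,
        LinearMap.smul_apply, LinearMap.smulRight_apply, map_add]
      module)
    (fun c x y => by
      ext z
      simp only [sum_two, LinearMap.add_apply, LinearMap.comp_apply, LinearMap.sub_apply,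
        LinearMap.smul_apply, LinearMap.smulRight_apply, map_smul, smul_eq_mul]
      module)
    (fun x y y' => by
      ext z
      simp only [sum_two, LinearMap.add_apply, LinearMap.comp_apply, LinearMap.sub_apply,
        LinearMap.smul_apply, LinearMap.smulRight_apply, map_add]
      module)
    (fun c x y => by
      ext z
      simp only [sum_two, LinearMap.add_apply, LinearMap.comp_apply, LinearMap.sub_apply,
        LinearMap.smul_apply, LinearMap.smulRight_apply, map_smul, smul_eq_mul]
      module)

/-- `t_{x,y} = (σ_{x,y}, ½ b(x,y) 1 - r_x l_y, ½ b(x,y) 1 - l_x r_y)`, where `l_x = m x` is the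
left multiplication and `r_x = superFlip m x` the right one, `r_x(y) = (-1)^{xy} m y x`. -/
def tElt (m : A →ₗ[k] A →ₗ[k] A) (b : A →ₗ[k] A →ₗ[k] k) :
    A →ₗ[k] A →ₗ[k] (Fin 3 → Module.End k A) :=
  LinearMap.mk₂ k
    (fun x y => ![sigma b x y,
      ((2 : k)⁻¹ * b x y) • LinearMap.id - superFlip m x ∘ₗ m y,
      ((2 : k)⁻¹ * b x y) • LinearMap.id - m x ∘ₗ superFlip m y])
    (fun x x' y => by
      ext i z
      fin_cases i <;> simp <;> module)
    (fun c x y => by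
      ext i z
      fin_cases i <;> simp <;> module)
    (fun x y y' => by
      ext i z
      fin_cases i <;> simp <;> module)
    (fun c x y => by
      ext i z
      fin_cases i <;> simp <;> module)

/-- The `n`-th power of `θ : (d₀, d₁, d₂) ↦ (d₂, d₀, d₁)`, `n` modulo three. -/
def theta (n : Fin 3) (d : Fin 3 → Module.End k A) : Fin 3 → Module.End k A := fun j => d (j - n)

end Triality

section Magic

variable {k A B : Type*} [Field k] [AddCommGroup A] [Module k A] [Superspace k A]
  [AddCommGroup B] [Module k B] [Superspace k B]

/-- The superspace of all `(d, d', z)`: triples of endomorphisms of `A` and of `B`, and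
`z = ι₀(z₀) + ι₁(z₁) + ι₂(z₂)` with the `zᵢ` in `A ⊗ B`. -/
abbrev MagicSpace (k A B : Type*) [Field k] [AddCommGroup A] [Module k A]
    [AddCommGroup B] [Module k B] : Type _ :=
  (Fin 3 → Module.End k A) × (Fin 3 → Module.End k B) × (Fin 3 → A ⊗[k] B)

/-- `g(A, B) = (tri A ⊕ tri B) ⊕ (⊕ᵢ ιᵢ(A ⊗ B))`. -/
def magic (m : A →ₗ[k] A →ₗ[k] A) (b : A →ₗ[k] A →ₗ[k] k)
    (m' : B →ₗ[k] B →ₗ[k] B) (b' : B →ₗ[k] B →ₗ[k] k) : Submodule k (MagicSpace k A B) :=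
  (tri m b).prod ((tri m' b').prod ⊤)

/-- `d'(x ⊗ x') = (-1)^{d' x} x ⊗ d'(x')`. -/
def rightAct (d : Module.End k B) (z : A ⊗[k] B) : A ⊗[k] B :=
  ∑ p : ZMod 2, ∑ q : ZMod 2, sgn k (p * q) •
    TensorProduct.map (proj (k := k) (V := A) q) (proj (k := k) p d) z

/-- `(x ⊗ x')(y ⊗ y') = (-1)^{x' y} (m x y) ⊗ (m' x' y')`. -/
def tensorMul (m : A →ₗ[k] A →ₗ[k] A) (m' : B →ₗ[k] B →ₗ[k] B) (z w : A ⊗[k] B) : A ⊗[k] B :=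
  ∑ p : ZMod 2, ∑ q : ZMod 2, sgn k (p * q) •
    TensorProduct.map₂ (m.compl₂ (proj (k := k) q)) (m' ∘ₗ proj (k := k) p) z w

/-- The homogeneous component of bidegree `(p, q)` of a tensor. -/
def biproj (p q : ZMod 2) (z : A ⊗[k] B) : A ⊗[k] B :=
  TensorProduct.map (proj (k := k) (V := A) p) (proj (k := k) (V := B) q) z

/-- The `tri A` part of `[ι₀(x ⊗ x'), ι₀(y ⊗ y')]`: `(-1)^{x x' + x y' + y y'} b'(x',y') t_{x,y}`. -/
def tensorTriLeft (m : A →ₗ[k] A →ₗ[k] A) (b : A →ₗ[k] A →ₗ[k] k) (b' : B →ₗ[k] B →ₗ[k] k)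
    (z w : A ⊗[k] B) : Fin 3 → Module.End k A :=
  ∑ x : ZMod 2, ∑ x' : ZMod 2, ∑ y : ZMod 2, ∑ y' : ZMod 2,
    sgn k (x * x' + x * y' + y * y') • TensorProduct.rid k (Fin 3 → Module.End k A)
      (TensorProduct.map₂ (tElt m b) b' (biproj x x' z) (biproj y y' w))

/-- The `tri B` part of `[ι₀(x ⊗ x'), ι₀(y ⊗ y')]`: `(-1)^{y x'} b(x,y) t'_{x',y'}`. -/
def tensorTriRight (b : A →ₗ[k] A →ₗ[k] k) (m' : B →ₗ[k] B →ₗ[k] B) (b' : B →ₗ[k] B →ₗ[k] k)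
    (z w : A ⊗[k] B) : Fin 3 → Module.End k B :=
  ∑ x : ZMod 2, ∑ x' : ZMod 2, ∑ y : ZMod 2, ∑ y' : ZMod 2,
    sgn k (y * x') • TensorProduct.lid k (Fin 3 → Module.End k B)
      (TensorProduct.map₂ b (tElt m' b') (biproj x x' z) (biproj y y' w))

/-- Given `F : V → V → V` defined on a superspace, `(x, y) ↦ F(x, y) - (-1)^{xy} F(y, x)`. -/
def superSkew (k : Type*) {V : Type*} [Field k] [AddCommGroup V] [Module k V] [Superspace k V]
    (F : V → V → V) (x y : V) : V :=
  F x y - ∑ p : ZMod 2, ∑ q : ZMod 2, sgn k (p * q) • F (proj (k := k) q y) (proj (k := k) p x)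

/-- The brackets `[d, ιᵢ(z)]`, `[d', ιᵢ(z)]` and `[ιᵢ(z), ιᵢ₊₁(w)]`, in this order of the
arguments only. -/
def magicOrdered (m : A →ₗ[k] A →ₗ[k] A) (m' : B →ₗ[k] B →ₗ[k] B) (u v : MagicSpace k A B) :
    MagicSpace k A B :=
  (0, 0, fun i => (u.1 i).rTensor B (v.2.2 i) + rightAct (u.2.1 i) (v.2.2 i)
    + tensorMul m m' (u.2.2 (i + 1)) (v.2.2 (i + 2)))

/-- The bracket of `g(A, B)`. -/
def magicBracket (m : A →ₗ[k] A →ₗ[k] A) (b : A →ₗ[k] A →ₗ[k] k)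
    (m' : B →ₗ[k] B →ₗ[k] B) (b' : B →ₗ[k] B →ₗ[k] k) (u v : MagicSpace k A B) :
    MagicSpace k A B :=
  (fun j => superComm k A (u.1 j) (v.1 j), fun j => superComm k B (u.2.1 j) (v.2.1 j), 0)
  + (∑ i, theta i (tensorTriLeft m b b' (u.2.2 i) (v.2.2 i)),
      ∑ i, theta i (tensorTriRight b m' b' (u.2.2 i) (v.2.2 i)), 0)
  + superSkew k (magicOrdered m m') u v

end Magic

/-! ### Hermitian matrices -/

section Jordan

open HurwitzSuperalgebra

variable (k C : Type*) [Field k] [NonAssocRing C] [Module k C]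
  [IsScalarTower k C C] [SMulCommClass k C C] [HurwitzSuperalgebra k C]

/-- The matrices with `a i j = \overline{a j i}`. -/
def hermitian : Submodule k (Matrix (Fin 3) (Fin 3) C) where
  carrier := {X | ∀ i j, X i j = conj k C (X j i)}
  zero_mem' := by intro i j; simp
  add_mem' := by intro X Y hX hY i j; simp [hX i j, hY i j]
  smul_mem' := by intro c X hX i j; simp [hX i j]

/-- The superspace `J = H₃(C)` of hermitian matrices. -/
abbrev H3 : Type _ := hermitian k C

variable {k C}

theorem H3.apply_swap (X : H3 k C) (i j : Fin 3) : X.1 i j = conj k C (X.1 j i) := X.2 i j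

instance H3.instSuperspace : Superspace k (H3 k C) where
  proj p := (proj (k := k) (V := Matrix (Fin 3) (Fin 3) C) p).restrict
    (p := hermitian k C) (q := hermitian k C) (by
      intro X hX i j
      change proj (k := k) p (X i j) = conj k C (proj (k := k) p (X j i))
      rw [← proj_conj, ← hX i j])
  proj_idem p X := Subtype.ext (proj_idem (k := k) p X.1)
  proj_add X := Subtype.ext (by
    conv_rhs => rw [← proj_add (k := k) X.1]
    rfl)

theorem mul_hermitian (X Y : H3 k C) (i j : Fin 3) :
    (X.1 * Y.1) i j = conj k C (superFlip (LinearMap.mul k (Matrix (Fin 3) (Fin 3) C)) X.1 Y.1 j i)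
    := by
  have h : superFlip (LinearMap.mul k (Matrix (Fin 3) (Fin 3) C)) X.1 Y.1 j i
      = ∑ l, superFlip (LinearMap.mul k C) (X.1 l i) (Y.1 j l) := by
    simp only [superFlip_apply, sum_two, LinearMap.mul_apply', Matrix.add_apply,
      Matrix.smul_apply, Matrix.mul_apply, Finset.sum_add_distrib, Finset.smul_sum]
    rfl
  rw [h, map_sum, Matrix.mul_apply]
  refine Finset.sum_congr rfl fun l _ => ?_
  rw [conj_superFlip, ← H3.apply_swap, ← H3.apply_swap]

/-- The product `X ∘ Y = ½ (X Y + (-1)^{XY} Y X)` of `J`. -/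
def jmul : H3 k C →ₗ[k] H3 k C →ₗ[k] H3 k C :=
  LinearMap.mk₂ k
    (fun X Y => ⟨(2 : k)⁻¹ •
      (X.1 * Y.1 + superFlip (LinearMap.mul k (Matrix (Fin 3) (Fin 3) C)) X.1 Y.1), by
        refine Submodule.smul_mem _ _ fun i j => ?_
        rw [Matrix.add_apply, Matrix.add_apply, map_add, ← mul_hermitian, mul_hermitian X Y j i,
          conj_conj, add_comm]⟩)
    (fun X X' Y => by
      ext1
      simp only [Submodule.coe_add, add_mul, map_add, LinearMap.add_apply]; module)
    (fun c X Y => by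
      ext1
      simp only [Submodule.coe_smul, smul_mul_assoc, map_smul, LinearMap.smul_apply]; module)
    (fun X Y Y' => by
      ext1
      simp only [Submodule.coe_add, mul_add, map_add]; module)
    (fun c X Y => by
      ext1
      simp only [Submodule.coe_smul, mul_smul_comm, map_smul]; module)

/-- The diagonal idempotent `eᵢ`. -/
def eJ (k : Type*) {C : Type*} [Field k] [NonAssocRing C] [Module k C]
    [IsScalarTower k C C] [SMulCommClass k C C] [HurwitzSuperalgebra k C] (i : Fin 3) : H3 k C :=
  ⟨Matrix.single i i 1, by
    intro r s
    rcases eq_or_ne r s with rfl | h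
    · rcases eq_or_ne i r with rfl | h'
      · simp [conj_one]
      · simp [h']
    · rcases eq_or_ne i r with rfl | h'
      · simp [h]
      · simp [h']⟩

/-- `ιᵢ(a)`: twice the hermitian matrix with entry `a` at `(i + 2, i + 1)` and `ā` at
`(i + 1, i + 2)`, indices modulo three. -/
def iotaJ (i : Fin 3) : C →ₗ[k] H3 k C :=
  LinearMap.codRestrict (hermitian k C)
    ((2 : k) • (Matrix.singleLinearMap k (i + 2) (i + 1)
      + Matrix.singleLinearMap k (i + 1) (i + 2) ∘ₗ conj k C))
    (by
      intro a
      refine Submodule.smul_mem _ _ fun r s => ?_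
      change Matrix.single _ _ _ r s + Matrix.single _ _ _ r s
        = conj k C (Matrix.single _ _ _ s r + Matrix.single _ _ _ s r)
      simp only [Matrix.single_apply, map_add]
      simp only [apply_ite (conj k C), conj_conj, map_zero]
      simp only [and_comm]
      abel)

/-- The part of parity `p` of the superalgebra of derivations of `J`. -/
def derPart (k C : Type*) [Field k] [NonAssocRing C] [Module k C]
    [IsScalarTower k C C] [SMulCommClass k C C] [HurwitzSuperalgebra k C] (p : ZMod 2) :
    Submodule k (Module.End k (H3 k C)) where
  carrier := {d | d ∈ part k (Module.End k (H3 k C)) p ∧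
    ∀ r, ∀ X ∈ part k (H3 k C) r, ∀ Y, d (jmul X Y) = jmul (d X) Y + sgn k (p * r) • jmul X (d Y)}
  zero_mem' := ⟨zero_mem _, by simp⟩
  add_mem' := by
    rintro d e ⟨hd, hd'⟩ ⟨he, he'⟩
    refine ⟨add_mem hd he, fun r X hX Y => ?_⟩
    simp only [LinearMap.add_apply, map_add, hd' r X hX Y, he' r X hX Y]
    module
  smul_mem' := by
    rintro c d ⟨hd, hd'⟩
    refine ⟨Submodule.smul_mem _ c hd, fun r X hX Y => ?_⟩
    simp only [LinearMap.smul_apply, map_smul, hd' r X hX Y]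
    module

/-- The Lie superalgebra `der J` of derivations of `J`. -/
def derJ (k C : Type*) [Field k] [NonAssocRing C] [Module k C]
    [IsScalarTower k C C] [SMulCommClass k C C] [HurwitzSuperalgebra k C] :
    Submodule k (Module.End k (H3 k C)) := derPart k C 0 ⊔ derPart k C 1

/-- The inner derivation `d_{X,Y} = [L_X, L_Y]`. -/
def innerD : H3 k C →ₗ[k] H3 k C →ₗ[k] Module.End k (H3 k C) :=
  (superComm k (H3 k C)).compl₁₂ jmul jmul

/-- `Dᵢ(a) = 2 [L_{ιᵢ(a)}, L_{eᵢ₊₁}]`. -/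
def DJ (i : Fin 3) (a : C) : Module.End k (H3 k C) :=
  (2 : k) • innerD (iotaJ i a) (eJ k (i + 1))

/-- The entry of a matrix at `(i + 2, i + 1)`, which is `2a` for the matrix `ιᵢ(a)`. -/
def coordJ (i : Fin 3) : H3 k C →ₗ[k] C :=
  Matrix.entryLinearMap k C (i + 2) (i + 1) ∘ₗ (hermitian k C).subtype

/-- `D_{(d₀,d₁,d₂)}`, the linear map with `eᵢ ↦ 0` and `ιᵢ(a) ↦ ιᵢ(dᵢ(a))`. -/
def DtriJ (d : Fin 3 → Module.End k C) : Module.End k (H3 k C) :=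
  ∑ i, (2 : k)⁻¹ • iotaJ i ∘ₗ d i ∘ₗ coordJ i

theorem DtriJ_eJ (d : Fin 3 → Module.End k C) (i : Fin 3) : DtriJ d (eJ k i) = 0 := by
  have h : ∀ j, coordJ (k := k) (C := C) j (eJ k i) = 0 := by
    intro j
    change Matrix.single i i (1 : C) (j + 2) (j + 1) = 0
    rw [Matrix.single_apply, if_neg]
    revert i j; decide
  simp [DtriJ, h]

theorem DtriJ_iotaJ (h2 : (2 : k) ≠ 0) (d : Fin 3 → Module.End k C) (i : Fin 3) (a : C) :
    DtriJ (k := k) d (iotaJ i a) = iotaJ i (d i a) := by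
  have h : ∀ j, coordJ (k := k) (C := C) j (iotaJ i a) = if j = i then (2 : k) • a else 0 := by
    intro j
    change (2 : k) • (Matrix.single (i + 2) (i + 1) a (j + 2) (j + 1)
      + Matrix.single (i + 1) (i + 2) (conj k C a) (j + 2) (j + 1)) = _
    rw [Matrix.single_apply, Matrix.single_apply,
      if_neg (c := i + 1 = j + 2 ∧ i + 2 = j + 1) (by revert i j; decide), add_zero]
    rcases eq_or_ne j i with rfl | hne
    · simp
    · rw [if_neg (by rintro ⟨hh, -⟩; exact hne (add_right_cancel hh).symm), if_neg hne, smul_zero]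
  simp [DtriJ, h, apply_ite, smul_smul, h2]

end Jordan

/-! ### The Tits construction -/

section Tits

open HurwitzSuperalgebra

variable (k Q C : Type*) [Field k]
  [NonAssocRing Q] [Module k Q] [IsScalarTower k Q Q] [SMulCommClass k Q Q]
  [HurwitzSuperalgebra k Q]
  [NonAssocRing C] [Module k C] [IsScalarTower k C C] [SMulCommClass k C C]
  [HurwitzSuperalgebra k C]

/-- The superspace `(Q ⊗ J) ⊕ End J`. -/
abbrev TitsSpace : Type _ := (Q ⊗[k] H3 k C) × Module.End k (H3 k C)

/-- `T(Q, J) = (Q⁰ ⊗ J) ⊕ der J`. -/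
def tits : Submodule k (TitsSpace k Q C) :=
  (LinearMap.range ((traceZero k Q).subtype.rTensor (H3 k C))).prod (derJ k C)

/-- The bracket of `T(Q, J)`, for `Q` purely even:
`[a ⊗ X, b ⊗ Y] = [a, b] ⊗ (X ∘ Y) - 2 b(a, b) d_{X,Y}`, `[d, a ⊗ X] = a ⊗ d(X)`, and the
supercommutator on `der J`. -/
def titsBracket (u v : TitsSpace k Q C) : TitsSpace k Q C :=
  (TensorProduct.map₂ (LinearMap.mul k Q - (LinearMap.mul k Q).flip) jmul u.1 v.1,
    superComm k (H3 k C) u.2 v.2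
      - (2 : k) • TensorProduct.lid k (Module.End k (H3 k C))
          (TensorProduct.map₂ (b : Q →ₗ[k] Q →ₗ[k] k) innerD u.1 v.1))
  + superSkew k (fun u v => (u.2.lTensor Q v.1, 0)) u v

end Tits

/-! ### The map `Φ` on `g(S₁, S)` and the elements of `tri(Q̄)` -/

section Phi

open HurwitzSuperalgebra

variable (k Q C : Type*) [Field k]
  [NonAssocRing Q] [Module k Q] [IsScalarTower k Q Q] [SMulCommClass k Q Q]
  [HurwitzSuperalgebra k Q]
  [NonAssocRing C] [Module k C] [IsScalarTower k C C] [SMulCommClass k C C]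
  [HurwitzSuperalgebra k C]

/-- `g(Q̄, S)`, where `S` is the para-Hurwitz superalgebra attached to `C`. -/
def gQS : Submodule k (MagicSpace k Q C) := magic (paraMulOp k Q) b (paraMul k C) b

/-- The bracket of `g(Q̄, S)`. -/
def gQSBracket : MagicSpace k Q C → MagicSpace k Q C → MagicSpace k Q C :=
  magicBracket (paraMulOp k Q) b (paraMul k C) b

/-- `g(S₁, S)`, where `S₁ = k` with `1 • 1 = 1` and `b(1, 1) = 2`. -/
def gS1S : Submodule k (MagicSpace k k C) :=
  magic (LinearMap.mul k k) ((2 : k) • LinearMap.mul k k) (paraMul k C) b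

variable {k C}

/-- `Φ : g(S₁, S) → der J`, `(d₀, d₁, d₂) ↦ D_{(d₀,d₁,d₂)}` and `ιᵢ(1 ⊗ a) ↦ Dᵢ(a)`.
(The triality Lie algebra of `S₁` is zero.) -/
def PhiJ (u : MagicSpace k k C) : Module.End k (H3 k C) :=
  DtriJ u.2.1 + ∑ i, DJ i (TensorProduct.lid k C (u.2.2 i))

/-- The inclusion of `g(S₁, S)` into `g(Q̄, S)` given by `S₁ = k1 ⊆ Q̄`. -/
def inclS1 (u : MagicSpace k k C) : MagicSpace k Q C :=
  (0, u.2.1, fun i => (LinearMap.toSpanSingleton k Q 1).rTensor C (u.2.2 i))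

variable {Q}

/-- For `i = 0, 1, 2` the triples `(0, -R_a, L_a)`, `(L_a, 0, -R_a)`, `(-R_a, L_a, 0)`, where
`L_a` and `R_a` are the multiplications by `a` in `Q`. -/
def kerElt (k : Type*) {Q : Type*} [Field k] [NonAssocRing Q] [Module k Q] [IsScalarTower k Q Q]
    [SMulCommClass k Q Q] (a : Q) : Fin 3 → Fin 3 → Module.End k Q :=
  ![![0, -LinearMap.mulRight k a, LinearMap.mulLeft k a],
    ![LinearMap.mulLeft k a, 0, -LinearMap.mulRight k a],
    ![-LinearMap.mulRight k a, LinearMap.mulLeft k a, 0]]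

end Phi

end

open scoped TensorProduct
open Superspace HurwitzSuperalgebra

open Superspace

namespace Superspace

section Basic

variable {k V W U : Type*} [Field k] [AddCommGroup V] [Module k V] [Superspace k V]
  [AddCommGroup W] [Module k W] [Superspace k W] [AddCommGroup U] [Module k U]

theorem mem_part_iff {p : ZMod 2} {x : V} : x ∈ part k V p ↔ proj (k := k) p x = x :=
  ⟨fun ⟨y, hy⟩ => by rw [← hy]; exact proj_idem p y, fun h => ⟨x, h⟩⟩

theorem proj_mem_part (p : ZMod 2) (x : V) : proj (k := k) p x ∈ part k V p := ⟨x, rfl⟩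

theorem proj_eq_ite {p : ZMod 2} (q : ZMod 2) {x : V} (hx : x ∈ part k V p) :
    proj (k := k) q x = if q = p then x else 0 := by
  split_ifs with h
  · subst h; exact mem_part_iff.1 hx
  · rw [← mem_part_iff.1 hx]
    rcases parity_cases p with rfl | rfl <;> rcases parity_cases q with rfl | rfl <;>
      simp_all [proj_zero_one, proj_one_zero]

theorem eq_zero_of_mem_part {p q : ZMod 2} (h : p ≠ q) {x : V} (hp : x ∈ part k V p)
    (hq : x ∈ part k V q) : x = 0 := by
  rw [← mem_part_iff.1 hq, proj_eq_ite q hp, if_neg (Ne.symm h)]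

theorem mem_part_of_proj_eq_zero {p : ZMod 2} {x : V} (h : proj (k := k) (p + 1) x = 0) :
    x ∈ part k V p := by
  have h' := proj_add (k := k) x
  rcases parity_cases p with rfl | rfl
  · rw [mem_part_iff]; rw [zero_add] at h; simpa [h] using h'
  · rw [mem_part_iff]; rw [one_add_one] at h; simpa [h] using h'

/-- Two linear maps that agree on homogeneous elements are equal. -/
theorem linearMap_ext {f g : V →ₗ[k] U} (h : ∀ p, ∀ x ∈ part k V p, f x = g x) : f = g := by
  ext x
  rw [← proj_add (k := k) x, map_add, map_add, h 0 _ (proj_mem_part 0 x),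
    h 1 _ (proj_mem_part 1 x)]

/-- Two bilinear maps that agree on homogeneous elements are equal. -/
theorem bilinMap_ext {f g : V →ₗ[k] W →ₗ[k] U}
    (h : ∀ p q, ∀ x ∈ part k V p, ∀ y ∈ part k W q, f x y = g x y) : f = g :=
  linearMap_ext fun p x hx => linearMap_ext fun q y hy => h p q x hx y hy

theorem mem_part_prod {p : ZMod 2} {x : V × W} :
    x ∈ part k (V × W) p ↔ x.1 ∈ part k V p ∧ x.2 ∈ part k W p := by
  simp only [mem_part_iff, Prod.ext_iff]; rfl

theorem mem_part_pi {ι : Type*} {p : ZMod 2} {x : ι → V} :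
    x ∈ part k (ι → V) p ↔ ∀ i, x i ∈ part k V p := by
  simp only [mem_part_iff, funext_iff]; rfl

theorem mem_part_matrix {m n : Type*} {p : ZMod 2} {x : Matrix m n V} :
    x ∈ part k (Matrix m n V) p ↔ ∀ i j, x i j ∈ part k V p := by
  simp only [mem_part_iff, ← Matrix.ext_iff]; rfl

theorem tmul_mem_part {p q : ZMod 2} {x : V} {y : W} (hx : x ∈ part k V p)
    (hy : y ∈ part k W q) : x ⊗ₜ[k] y ∈ part k (V ⊗[k] W) (p + q) := by
  rw [mem_part_iff]
  change (∑ r : ZMod 2, TensorProduct.map (proj r) (proj (p + q - r))) (x ⊗ₜ[k] y) = _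
  rw [sum_two]
  simp only [LinearMap.add_apply, TensorProduct.map_tmul, proj_eq_ite _ hx, proj_eq_ite _ hy]
  rcases parity_cases p with rfl | rfl <;> rcases parity_cases q with rfl | rfl <;>
    simp [one_add_one]

theorem end_proj_apply (p : ZMod 2) (f : Module.End k V) (v : V) :
    proj (k := k) p f v = ∑ q : ZMod 2, proj (k := k) (p + q) (f (proj (k := k) q v)) := by
  change (∑ q : ZMod 2, _ : Module.End k V →ₗ[k] Module.End k V) f v = _
  simp [sum_two]

theorem mem_part_end {p : ZMod 2} {f : Module.End k V} :
    f ∈ part k (Module.End k V) p ↔ ∀ q, ∀ v ∈ part k V q, f v ∈ part k V (p + q) := by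
  constructor
  · intro h q v hv
    rw [← mem_part_iff.1 h, end_proj_apply, sum_two, proj_eq_ite _ hv, proj_eq_ite _ hv]
    rcases parity_cases q with rfl | rfl <;> simp [proj_mem_part]
  · intro h
    rw [mem_part_iff]
    refine linearMap_ext fun q v hv => ?_
    rw [end_proj_apply, sum_two, proj_eq_ite _ hv, proj_eq_ite _ hv]
    rcases parity_cases q with rfl | rfl <;> simpa using mem_part_iff.1 (h _ v hv)

theorem apply_mem_part {p q : ZMod 2} {f : Module.End k V} {v : V}
    (hf : f ∈ part k (Module.End k V) p) (hv : v ∈ part k V q) : f v ∈ part k V (p + q) :=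
  mem_part_end.1 hf q v hv

theorem superFlip_of_mem (f : V →ₗ[k] W →ₗ[k] U) {p q : ZMod 2} {x : W} {y : V}
    (hx : x ∈ part k W p) (hy : y ∈ part k V q) :
    superFlip f x y = sgn k (p * q) • f y x := by
  simp only [superFlip_apply, sum_two, proj_eq_ite _ hx, proj_eq_ite _ hy]
  rcases parity_cases p with rfl | rfl <;> rcases parity_cases q with rfl | rfl <;> simp

theorem superComm_of_mem {p q : ZMod 2} {f g : Module.End k V}
    (hf : f ∈ part k (Module.End k V) p) (hg : g ∈ part k (Module.End k V) q) :
    superComm k V f g = f * g - sgn k (p * q) • (g * f) := by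
  simp [superComm, superFlip_of_mem _ hf hg]

theorem superComm_apply_of_mem {p q : ZMod 2} {f g : Module.End k V}
    (hf : f ∈ part k (Module.End k V) p) (hg : g ∈ part k (Module.End k V) q) (v : V) :
    superComm k V f g v = f (g v) - sgn k (p * q) • g (f v) := by
  rw [superComm_of_mem hf hg]; rfl

theorem mul_mem_part {p q : ZMod 2} {f g : Module.End k V}
    (hf : f ∈ part k (Module.End k V) p) (hg : g ∈ part k (Module.End k V) q) :
    f * g ∈ part k (Module.End k V) (p + q) := by
  refine mem_part_end.2 fun r v hv => ?_
  rw [add_assoc]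
  exact apply_mem_part (f := f) hf (apply_mem_part hg hv)

theorem superComm_mem_part {p q : ZMod 2} {f g : Module.End k V}
    (hf : f ∈ part k (Module.End k V) p) (hg : g ∈ part k (Module.End k V) q) :
    superComm k V f g ∈ part k (Module.End k V) (p + q) := by
  rw [superComm_of_mem hf hg]
  exact sub_mem (mul_mem_part hf hg) (Submodule.smul_mem _ _ (add_comm p q ▸ mul_mem_part hg hf))

end Basic

section Sign

variable {k : Type*} [Field k]

@[simp] theorem sgn_zero : sgn k 0 = 1 := if_pos rfl

@[simp] theorem sgn_one : sgn k 1 = -1 := if_neg one_ne_zero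

theorem sgn_add (p q : ZMod 2) : sgn k (p + q) = sgn k p * sgn k q := by
  rcases parity_cases p with rfl | rfl <;> rcases parity_cases q with rfl | rfl <;>
    simp [one_add_one]

theorem sgn_mul_self (p : ZMod 2) : sgn k p * sgn k p = 1 := by
  rcases parity_cases p with rfl | rfl <;> simp

end Sign

section Comm

variable {k V : Type*} [Field k] [AddCommGroup V] [Module k V] [Superspace k V]

theorem superComm_skew {p q : ZMod 2} {f g : Module.End k V}
    (hf : f ∈ part k (Module.End k V) p) (hg : g ∈ part k (Module.End k V) q) :
    superComm k V f g = -(sgn k (p * q) • superComm k V g f) := by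
  rw [superComm_of_mem hf hg, superComm_of_mem hg hf, smul_sub, smul_smul, mul_comm q p,
    sgn_mul_self, one_smul, neg_sub]

theorem superComm_jacobi {p q r : ZMod 2} {f g h : Module.End k V}
    (hf : f ∈ part k (Module.End k V) p) (hg : g ∈ part k (Module.End k V) q)
    (hh : h ∈ part k (Module.End k V) r) :
    superComm k V f (superComm k V g h) =
      superComm k V (superComm k V f g) h + sgn k (p * q) • superComm k V g (superComm k V f h) := by
  rw [superComm_of_mem hf (superComm_mem_part hg hh), superComm_of_mem (superComm_mem_part hf hg) hh,
    superComm_of_mem hg (superComm_mem_part hf hh), superComm_of_mem hf hg, superComm_of_mem hg hh,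
    superComm_of_mem hf hh]
  simp only [mul_sub, sub_mul, mul_smul_comm, smul_mul_assoc, mul_assoc]
  rcases parity_cases p with rfl | rfl <;> rcases parity_cases q with rfl | rfl <;>
    rcases parity_cases r with rfl | rfl <;> simp [one_add_one] <;> abel

end Comm

end Superspace

namespace IsLieSuperalgebra

variable {k A A' : Type*} [Field k] [AddCommGroup A] [Module k A] [Superspace k A]
  [AddCommGroup A'] [Module k A'] [Superspace k A']

section Span

variable {G : ZMod 2 → Set A} {L : Submodule k A}

theorem span_le_part (hG : ∀ p, G p ⊆ part k A p) (p : ZMod 2) :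
    Submodule.span k (G p) ≤ part k A p := Submodule.span_le.2 (hG p)

theorem exists_add_of_mem (hL : L = Submodule.span k (G 0) ⊔ Submodule.span k (G 1))
    (hG : ∀ p, G p ⊆ part k A p) {x : A} (hx : x ∈ L) (p : ZMod 2) :
    proj (k := k) p x ∈ Submodule.span k (G p) := by
  rw [hL] at hx
  obtain ⟨u, hu, v, hv, rfl⟩ := Submodule.mem_sup.1 hx
  rw [map_add, proj_eq_ite p (span_le_part hG 0 hu), proj_eq_ite p (span_le_part hG 1 hv)]
  rcases parity_cases p with rfl | rfl <;> simpa

theorem inf_part_eq_span (hL : L = Submodule.span k (G 0) ⊔ Submodule.span k (G 1))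
    (hG : ∀ p, G p ⊆ part k A p) (p : ZMod 2) : L ⊓ part k A p = Submodule.span k (G p) := by
  apply le_antisymm
  · rintro x ⟨hx, hx'⟩
    rw [← mem_part_iff.1 hx']
    exact exists_add_of_mem hL hG hx p
  · refine le_inf ?_ (span_le_part hG p)
    rw [hL]
    rcases parity_cases p with rfl | rfl
    · exact le_sup_left
    · exact le_sup_right

/-- The axioms of a Lie superalgebra with a globally bilinear bracket may be checked on
homogeneous generators. -/
theorem of_span (B : A →ₗ[k] A →ₗ[k] A)
    (hL : L = Submodule.span k (G 0) ⊔ Submodule.span k (G 1)) (hG : ∀ p, G p ⊆ part k A p)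
    (closed : ∀ p q, ∀ x ∈ G p, ∀ y ∈ G q, B x y ∈ L)
    (even : ∀ p q, ∀ x ∈ G p, ∀ y ∈ G q, B x y ∈ part k A (p + q))
    (skew : ∀ p q, ∀ x ∈ G p, ∀ y ∈ G q, B x y = -(sgn k (p * q) • B y x))
    (jacobi : ∀ p q r, ∀ x ∈ G p, ∀ y ∈ G q, ∀ z ∈ G r,
      B x (B y z) = B (B x y) z + sgn k (p * q) • B y (B x z))
    (odd_cube : ∀ x ∈ G 1, B (B x x) x = 0) :
    IsLieSuperalgebra (fun x y => B x y) L := by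
  have hs := inf_part_eq_span hL hG
  have hmem : ∀ p, Submodule.span k (G p) ≤ L := fun p => by rw [← hs p]; exact inf_le_left
  have closed' : ∀ p q, ∀ x ∈ Submodule.span k (G p), ∀ y ∈ Submodule.span k (G q),
      B x y ∈ L := by
    intro p q x hx y hy
    induction hx, hy using Submodule.span_induction₂ with
    | mem_mem x y hx hy => exact closed p q x hx y hy
    | zero_left => simp
    | zero_right => simp
    | add_left x y z _ _ _ h h' => simpa using add_mem h h'
    | add_right x y z _ _ _ h h' => simpa using add_mem h h'
    | smul_left c x y _ _ h => simpa using Submodule.smul_mem _ c h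
    | smul_right c x y _ _ h => simpa using Submodule.smul_mem _ c h
  have even' : ∀ p q, ∀ x ∈ Submodule.span k (G p), ∀ y ∈ Submodule.span k (G q),
      B x y ∈ part k A (p + q) := by
    intro p q x hx y hy
    induction hx, hy using Submodule.span_induction₂ with
    | mem_mem x y hx hy => exact even p q x hx y hy
    | zero_left => simp
    | zero_right => simp
    | add_left x y z _ _ _ h h' => simpa using add_mem h h'
    | add_right x y z _ _ _ h h' => simpa using add_mem h h'
    | smul_left c x y _ _ h => simpa using Submodule.smul_mem _ c h
    | smul_right c x y _ _ h => simpa using Submodule.smul_mem _ c h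
  have skew' : ∀ p q, ∀ x ∈ Submodule.span k (G p), ∀ y ∈ Submodule.span k (G q),
      B x y = -(sgn k (p * q) • B y x) := by
    intro p q x hx y hy
    induction hx, hy using Submodule.span_induction₂ with
    | mem_mem x y hx hy => exact skew p q x hx y hy
    | zero_left => simp
    | zero_right => simp
    | add_left x y z _ _ _ h h' => simp only [map_add, LinearMap.add_apply, h, h']; module
    | add_right x y z _ _ _ h h' => simp only [map_add, LinearMap.add_apply, h, h']; module
    | smul_left c x y _ _ h => simp only [map_smul, LinearMap.smul_apply, h]; module
    | smul_right c x y _ _ h => simp only [map_smul, LinearMap.smul_apply, h]; module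
  have jacobi' : ∀ p q r, ∀ x ∈ Submodule.span k (G p), ∀ y ∈ Submodule.span k (G q),
      ∀ z ∈ Submodule.span k (G r),
      B x (B y z) = B (B x y) z + sgn k (p * q) • B y (B x z) := by
    intro p q r x hx y hy z hz
    induction hz using Submodule.span_induction with
    | mem z hz =>
      induction hx, hy using Submodule.span_induction₂ with
      | mem_mem x y hx hy => exact jacobi p q r x hx y hy z hz
      | zero_left => simp
      | zero_right => simp
      | add_left x y z _ _ _ h h' => simp only [map_add, LinearMap.add_apply, h, h']; module
      | add_right x y z _ _ _ h h' => simp only [map_add, LinearMap.add_apply, h, h']; module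
      | smul_left c x y _ _ h => simp only [map_smul, LinearMap.smul_apply, h]; module
      | smul_right c x y _ _ h => simp only [map_smul, LinearMap.smul_apply, h]; module
    | zero => simp
    | add z w _ _ h h' => simp only [map_add, h, h']; module
    | smul c z _ h => simp only [map_smul, h]; module
  refine ⟨fun p x hx => hmem p (exists_add_of_mem hL hG hx p), fun x hx y hy => ?_, ?_, ?_, ?_, ?_,
    fun p q x hx y hy => even' p q x (hs p ▸ hx) y (hs q ▸ hy),
    fun p q x hx y hy => skew' p q x (hs p ▸ hx) y (hs q ▸ hy),
    fun p q x hx y hy z hz => ?_, fun x hx => ?_⟩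
  · have hx0 := exists_add_of_mem hL hG hx 0
    have hx1 := exists_add_of_mem hL hG hx 1
    have hy0 := exists_add_of_mem hL hG hy 0
    have hy1 := exists_add_of_mem hL hG hy 1
    rw [← proj_add (k := k) x, ← proj_add (k := k) y]
    simp only [map_add, LinearMap.add_apply]
    exact add_mem (add_mem (closed' _ _ _ hx0 _ hy0) (closed' _ _ _ hx1 _ hy0))
      (add_mem (closed' _ _ _ hx0 _ hy1) (closed' _ _ _ hx1 _ hy1))
  · intros; simp
  · intros; simp
  · intros; simp
  · intros; simp
  · have hz0 := exists_add_of_mem hL hG hz 0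
    have hz1 := exists_add_of_mem hL hG hz 1
    have h0 := jacobi' p q 0 x (hs p ▸ hx) y (hs q ▸ hy) _ hz0
    have h1 := jacobi' p q 1 x (hs p ▸ hx) y (hs q ▸ hy) _ hz1
    rw [← proj_add (k := k) z]
    simp only [map_add, h0, h1]; module
  · rw [hs 1] at hx
    induction hx using Submodule.span_induction with
    | mem x hx => exact odd_cube x hx
    | zero => simp
    | smul c x _ h => simp [h]
    | add x y hx hy h h' =>
      have s : sgn k (1 * 1) = -1 := by simp
      have j1 := jacobi' 1 1 1 x hx x hx y hy
      have j2 := jacobi' 1 1 1 y hy y hy x hx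
      have s1 := skew' 1 1 x hx y hy
      have hxy := even' 1 1 x hx y hy
      rw [s] at j1 j2 s1
      have hb : ∀ u ∈ Submodule.span k (G 1), ∀ v ∈ Submodule.span k (G 1),
          ∀ w ∈ Submodule.span k (G 1), B (B u v) w = -B w (B u v) := by
        intro u hu v hv w hw
        have hm : B u v ∈ Submodule.span k (G 0) := by
          rw [← hs 0]; exact ⟨closed' 1 1 u hu v hv, even' 1 1 u hu v hv⟩
        have := skew' 0 1 _ hm w hw
        simpa using this
      have s2 : B x y = B y x := by simpa using s1
      simp only [map_add, LinearMap.add_apply, h, h', s2] at j1 j2 ⊢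
      rw [hb y hy x hx x hx, hb y hy x hx y hy]
      linear_combination (norm := module) -j1 - j2

end Span

/-- Lie superalgebra structures are transported along isomorphisms. -/
theorem of_equiv {br : A → A → A} {L : Submodule k A} {br' : A' → A' → A'} {L' : Submodule k A'}
    (h : IsLieSuperalgebra br' L') (Φ : L ≃ₗ[k] L')
    (graded : ∀ p, ∀ x ∈ L, proj (k := k) p x ∈ L)
    (even : ∀ p, ∀ x : L, (x : A) ∈ part k A p → (Φ x : A') ∈ part k A' p)
    (closed : ∀ x ∈ L, ∀ y ∈ L, br x y ∈ L)
    (map_bracket : ∀ x y z : L, (z : A) = br x y → (Φ z : A') = br' (Φ x) (Φ y)) :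
    IsLieSuperalgebra br L := by
  have inj : ∀ {x y : A} (hx : x ∈ L) (hy : y ∈ L), (Φ ⟨x, hx⟩ : A') = Φ ⟨y, hy⟩ → x = y :=
    fun hx hy e => congrArg Subtype.val (Φ.injective (Subtype.ext e))
  have hm : ∀ {x y : A} (hx : x ∈ L) (hy : y ∈ L),
      (Φ ⟨br x y, closed x hx y hy⟩ : A') = br' (Φ ⟨x, hx⟩) (Φ ⟨y, hy⟩) :=
    fun hx hy => map_bracket ⟨_, hx⟩ ⟨_, hy⟩ _ rfl
  have ha : ∀ {x y : A} (hx : x ∈ L) (hy : y ∈ L),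
      (Φ ⟨x + y, add_mem hx hy⟩ : A') = Φ ⟨x, hx⟩ + Φ ⟨y, hy⟩ := fun hx hy => by
    rw [← Submodule.coe_add, ← map_add]; rfl
  have hc : ∀ (c : k) {x : A} (hx : x ∈ L),
      (Φ ⟨c • x, Submodule.smul_mem _ c hx⟩ : A') = c • Φ ⟨x, hx⟩ := fun c x hx => by
    rw [← Submodule.coe_smul, ← map_smul]; rfl
  have hn : ∀ {x : A} (hx : x ∈ L), (Φ ⟨-x, neg_mem hx⟩ : A') = -Φ ⟨x, hx⟩ := fun hx => by
    rw [← Submodule.coe_neg, ← map_neg]; rfl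
  have hp : ∀ {x : A} (hx : x ∈ L) {p}, x ∈ part k A p →
      (Φ ⟨x, hx⟩ : A') ∈ L' ⊓ part k A' p := fun hx p h => ⟨(Φ _).2, even p _ h⟩
  have refl : ∀ {x : A} (hx : x ∈ L) {p}, (Φ ⟨x, hx⟩ : A') ∈ part k A' p → x ∈ part k A p := by
    intro x hx p h
    apply mem_part_of_proj_eq_zero
    have h0 := even 0 ⟨_, graded 0 x hx⟩ (proj_mem_part 0 x)
    have h1 := even 1 ⟨_, graded 1 x hx⟩ (proj_mem_part 1 x)
    have e : (Φ ⟨x, hx⟩ : A') = Φ ⟨_, graded 0 x hx⟩ + Φ ⟨_, graded 1 x hx⟩ := by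
      rw [← ha (graded 0 x hx) (graded 1 x hx)]
      simp only [proj_add]
    have e' := proj_eq_ite (k := k) (p + 1) h
    rw [e, map_add, proj_eq_ite _ h0, proj_eq_ite _ h1] at e'
    have z : (Φ ⟨_, graded (p + 1) x hx⟩ : A') = 0 := by
      rcases parity_cases p with rfl | rfl
      · simpa using e'
      · simpa [one_add_one] using e'
    have := inj (graded (p + 1) x hx) (zero_mem L) (by
      rw [z]; exact (congrArg Subtype.val (map_zero Φ)).symm)
    exact this
  refine ⟨graded, closed, ?_, ?_, ?_, ?_, ?_, ?_, ?_, ?_⟩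
  · intro x hx y hy z hz
    refine inj (closed _ (add_mem hx hy) _ hz) (add_mem (closed _ hx _ hz) (closed _ hy _ hz)) ?_
    rw [hm (add_mem hx hy) hz, ha (closed _ hx _ hz) (closed _ hy _ hz), hm hx hz, hm hy hz,
      ha hx hy, h.add_left _ (Φ _).2 _ (Φ _).2 _ (Φ _).2]
  · intro x hx y hy z hz
    refine inj (closed _ hx _ (add_mem hy hz)) (add_mem (closed _ hx _ hy) (closed _ hx _ hz)) ?_
    rw [hm hx (add_mem hy hz), ha (closed _ hx _ hy) (closed _ hx _ hz), hm hx hy, hm hx hz,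
      ha hy hz, h.add_right _ (Φ _).2 _ (Φ _).2 _ (Φ _).2]
  · intro c x hx y hy
    refine inj (closed _ (Submodule.smul_mem _ c hx) _ hy)
      (Submodule.smul_mem _ c (closed _ hx _ hy)) ?_
    rw [hm (Submodule.smul_mem _ c hx) hy, hc c (closed _ hx _ hy), hm hx hy, hc c hx,
      h.smul_left c _ (Φ _).2 _ (Φ _).2]
  · intro c x hx y hy
    refine inj (closed _ hx _ (Submodule.smul_mem _ c hy))
      (Submodule.smul_mem _ c (closed _ hx _ hy)) ?_
    rw [hm hx (Submodule.smul_mem _ c hy), hc c (closed _ hx _ hy), hm hx hy, hc c hy,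
      h.smul_right c _ (Φ _).2 _ (Φ _).2]
  · rintro p q x ⟨hx, hx'⟩ y ⟨hy, hy'⟩
    refine refl (closed _ hx _ hy) ?_
    rw [hm hx hy]
    exact h.even p q _ (hp hx hx') _ (hp hy hy')
  · rintro p q x ⟨hx, hx'⟩ y ⟨hy, hy'⟩
    refine inj (closed _ hx _ hy) (neg_mem (Submodule.smul_mem _ _ (closed _ hy _ hx))) ?_
    rw [hn (Submodule.smul_mem _ _ (closed _ hy _ hx)), hc _ (closed _ hy _ hx), hm hx hy, hm hy hx]
    exact h.skew p q _ (hp hx hx') _ (hp hy hy')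
  · rintro p q x ⟨hx, hx'⟩ y ⟨hy, hy'⟩ z hz
    have h1 := closed _ hy _ hz
    have h2 := closed _ hx _ hy
    have h3 := closed _ hx _ hz
    refine inj (closed _ hx _ h1) (add_mem (closed _ h2 _ hz)
      (Submodule.smul_mem _ _ (closed _ hy _ h3))) ?_
    rw [ha (closed _ h2 _ hz) (Submodule.smul_mem _ _ (closed _ hy _ h3)), hc _ (closed _ hy _ h3),
      hm hx h1, hm hy hz, hm h2 hz, hm hx hy, hm hy h3, hm hx hz]
    exact h.jacobi p q _ (hp hx hx') _ (hp hy hy') _ (Φ _).2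
  · rintro x ⟨hx, hx'⟩
    refine inj (closed _ (closed _ hx _ hx) _ hx) (zero_mem L) ?_
    rw [hm (closed _ hx _ hx) hx, hm hx hx, h.odd_cube _ (hp hx hx')]
    exact (congrArg Subtype.val (map_zero Φ)).symm

end IsLieSuperalgebra

open Superspace

namespace HurwitzSuperalgebra

section Hurwitz

variable {k C : Type*} [Field k] [NonAssocRing C] [Module k C]
  [IsScalarTower k C C] [SMulCommClass k C C] [HurwitzSuperalgebra k C]

theorem eq_add_one_of_ne {p q : ZMod 2} (h : p ≠ q) : q = p + 1 := by
  revert p q; decide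

theorem b_eq_zero {p q : ZMod 2} (h : p ≠ q) {x y : C} (hx : x ∈ part k C p)
    (hy : y ∈ part k C q) : (b x y : k) = 0 := by
  rcases parity_cases p with rfl | rfl <;> rcases parity_cases q with rfl | rfl
  · exact absurd rfl h
  · exact b_even x hx y hy
  · rw [b_supersymm 1 0 x hx y hy, b_even y hy x hx, mul_zero]
  · exact absurd rfl h

theorem b_one_left (x : C) : (b (1 : C) x : k) = b x (1 : C) := by
  have := linearMap_ext (k := k) (f := b (1 : C)) (g := b.flip (1 : C))
    fun p x hx => b_one_comm p hx
  exact LinearMap.congr_fun this x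

theorem b_conj_left (x y : C) : (b (conj k C x) y : k) = b x (conj k C y) := by
  simp [conj_apply, b_one_left]; ring

theorem b_conj_conj (x y : C) : (b (conj k C x) (conj k C y) : k) = b x y := by
  rw [b_conj_left, conj_conj]

theorem conj_mul_of_mem {p q : ZMod 2} {x y : C} (hx : x ∈ part k C p) (hy : y ∈ part k C q) :
    conj k C (x * y) = sgn k (p * q) • (conj k C y * conj k C x) := by
  rw [conj_mul, superFlip_of_mem _ (conj_mem p hx) (conj_mem q hy)]; rfl

theorem b_mul_left_adjoint {p q r : ZMod 2} {x y t : C} (hx : x ∈ part k C p)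
    (hy : y ∈ part k C q) (ht : t ∈ part k C r) :
    (b (x * y) t : k) = sgn k (p * q) * b y (conj k C x * t) := by
  have h := sgn_mul_b_one (k := k) p q hx
  rw [b_mul_one_left p q r hx hy ht, conj_apply, sub_mul, smul_mul_assoc, one_mul, map_sub, map_smul,
    smul_eq_mul]
  linear_combination -(b y t : k) * h

theorem b_mul_right_adjoint {p q r : ZMod 2} {x y t : C} (hx : x ∈ part k C p)
    (hy : y ∈ part k C q) (ht : t ∈ part k C r) :
    (b (x * y) t : k) = sgn k (q * r) * b x (t * conj k C y) := by
  have h := b_mul_swap (k := k) p r q hx ht hy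
  have h' := b_supersymm (k := k) (p + q) r _ (mul_mem p q x hx y hy) t ht
  rw [conj_apply, mul_sub, mul_smul_comm, mul_one, map_sub, map_smul, smul_eq_mul, h, h',
    b_one_left, add_mul, sgn_add]
  ring

/-- The linearization of `x̄ (x y) = q(x) y`. -/
theorem conj_mul_mul_add {p q r : ZMod 2} {x y z : C} (hx : x ∈ part k C p) (hy : y ∈ part k C q)
    (hz : z ∈ part k C r) :
    conj k C x * (z * y) + sgn k (p * r) • (conj k C z * (x * y)) = (b x z : k) • y := by
  refine eq_of_b (k := k) fun s t ht => ?_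
  have h1 := b_mul_left_adjoint (k := k) (conj_mem p hx) (mul_mem r q z hz y hy) ht
  have h2 := b_mul_left_adjoint (k := k) (conj_mem r hz) (mul_mem p q x hx y hy) ht
  have h3 := b_mul_mul (k := k) r q p s z hz y hy x hx t ht
  have h4 := b_supersymm (k := k) r p z hz x hx
  rw [conj_conj] at h1 h2
  rw [map_add, LinearMap.add_apply, map_smul, LinearMap.smul_apply, map_smul, LinearMap.smul_apply,
    h1, h2]
  simp only [smul_eq_mul]
  rw [h4] at h3
  rcases parity_cases p with rfl | rfl <;> rcases parity_cases q with rfl | rfl <;>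
    rcases parity_cases r with rfl | rfl <;> simp [one_add_one] at h3 ⊢ <;>
    first | linear_combination h3 | linear_combination -h3

theorem paraMul_apply (x y : C) : paraMul k C x y = conj k C x * conj k C y := rfl

theorem paraMulOp_apply (x y : C) : paraMulOp k C x y = conj k C (x * y) := rfl

theorem paraMul_mem {p q : ZMod 2} {x y : C} (hx : x ∈ part k C p) (hy : y ∈ part k C q) :
    paraMul k C x y ∈ part k C (p + q) :=
  mul_mem p q _ (conj_mem p hx) _ (conj_mem q hy)

theorem b_paraMul_of_mem {p q r : ZMod 2} {x y z : C} (hx : x ∈ part k C p) (hy : y ∈ part k C q)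
    (hz : z ∈ part k C r) : (b (paraMul k C x y) z : k) = b x (paraMul k C y z) := by
  rw [paraMul_apply, paraMul_apply, b_mul_right_adjoint (conj_mem p hx) (conj_mem q hy) hz,
    b_conj_left, conj_conj, conj_mul_of_mem hz hy, map_smul, smul_eq_mul, ← mul_assoc, mul_comm r q,
    sgn_mul_self, one_mul]

theorem paraMul_paraMul_of_mem {q r : ZMod 2} (x : C) {y z : C} (hy : y ∈ part k C q)
    (hz : z ∈ part k C r) :
    paraMul k C x (paraMul k C y z) = sgn k (q * r) • (conj k C x * (z * y)) := by
  rw [paraMul_apply, paraMul_apply, conj_mul_of_mem (conj_mem q hy) (conj_mem r hz), conj_conj,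
    conj_conj, mul_smul_comm]

theorem paraMul_left_add {p q r : ZMod 2} {x y z : C} (hx : x ∈ part k C p) (hy : y ∈ part k C q)
    (hz : z ∈ part k C r) :
    paraMul k C x (paraMul k C y z) +
      sgn k (p * q + p * r + q * r) • paraMul k C z (paraMul k C y x) =
      (sgn k (q * r) * b x z) • y := by
  have h := conj_mul_mul_add hx hy hz
  rw [paraMul_paraMul_of_mem x hy hz, paraMul_paraMul_of_mem z hy hx, mul_smul, ← h, smul_add,
    smul_smul, smul_smul, sgn_add, sgn_add, mul_comm q p]
  congr 2
  linear_combination sgn k (p * r) * sgn k (q * r) * sgn_mul_self (k := k) (p * q)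

theorem paraMul_right_add {p q r : ZMod 2} {x y z : C} (hx : x ∈ part k C p) (hy : y ∈ part k C q)
    (hz : z ∈ part k C r) :
    paraMul k C (paraMul k C x y) z +
      sgn k (p * q + p * r + q * r) • paraMul k C (paraMul k C z y) x =
      (sgn k (q * r) * b x z) • y := by
  refine eq_of_b (k := k) fun s t ht => ?_
  have h := paraMul_left_add (k := k) hy hz ht
  have h' := congrArg (fun w => (b x w : k)) h
  simp only [map_add, map_smul, smul_eq_mul] at h'
  have e := b_supersymm (k := k) _ _ _ (paraMul_mem hx ht) _ (paraMul_mem hz hy)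
  rw [map_add, LinearMap.add_apply, map_smul, LinearMap.smul_apply, map_smul, LinearMap.smul_apply,
    b_paraMul_of_mem (paraMul_mem hx hy) hz ht, b_paraMul_of_mem hx hy (paraMul_mem hz ht),
    b_paraMul_of_mem (paraMul_mem hz hy) hx ht]
  rw [← b_paraMul_of_mem hx ht (paraMul_mem hz hy), e] at h'
  simp only [smul_eq_mul]
  rcases eq_or_ne p r with rfl | hpr
  · rcases eq_or_ne q s with rfl | hqs
    · rcases parity_cases p with rfl | rfl <;> rcases parity_cases q with rfl | rfl <;>
        simp [one_add_one] at h' ⊢ <;>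
        linear_combination h'
    · rw [b_eq_zero hqs hy ht] at h' ⊢
      obtain rfl := eq_add_one_of_ne hqs
      rcases parity_cases p with rfl | rfl <;> rcases parity_cases q with rfl | rfl <;>
        simp [one_add_one] at h' ⊢ <;>
        linear_combination h'
  · rw [b_eq_zero hpr hx hz] at h' ⊢
    obtain rfl := eq_add_one_of_ne hpr
    rcases parity_cases p with rfl | rfl <;> rcases parity_cases q with rfl | rfl <;>
      rcases parity_cases s with rfl | rfl <;>
        simp [one_add_one] at h' ⊢ <;>
        linear_combination h'

theorem sgn_mul_b_of_mem {p r s : ZMod 2} {x y : C} (hx : x ∈ part k C r) (hy : y ∈ part k C s) :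
    sgn k (p * r) * (b x y : k) = sgn k (p * s) * b x y := by
  rcases eq_or_ne r s with rfl | h
  · rfl
  · rw [b_eq_zero h hx hy, mul_zero, mul_zero]

theorem smul_paraMul_left_add {p r s : ZMod 2} {a x y : C} (ha : a ∈ part k C p)
    (hx : x ∈ part k C r) (hy : y ∈ part k C s) :
    sgn k (p * r) • paraMul k C x (paraMul k C a y)
      + (sgn k (p * s) * sgn k (r * s)) • paraMul k C y (paraMul k C a x) = (b x y : k) • a := by
  have key := congrArg (fun z => sgn k (p * r) • z) (paraMul_left_add (k := k) hx ha hy)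
  have h := sgn_mul_b_of_mem (k := k) (p := p) hx hy
  simp only [smul_add, smul_smul, sgn_add, mul_comm r p] at key
  rw [← h, ← mul_assoc (sgn k (p * r)) (sgn k (p * r)) (b x y), sgn_mul_self, one_mul] at key
  rw [← key]
  congr 2
  linear_combination -sgn k (p * s) * sgn k (r * s) * sgn_mul_self (k := k) (p * r)

theorem smul_paraMul_right_add {p r s : ZMod 2} {a x y : C} (ha : a ∈ part k C p)
    (hx : x ∈ part k C r) (hy : y ∈ part k C s) :
    sgn k (p * r) • paraMul k C (paraMul k C x a) y
      + (sgn k (p * s) * sgn k (r * s)) • paraMul k C (paraMul k C y a) x = (b x y : k) • a := by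
  have key := congrArg (fun z => sgn k (p * r) • z) (paraMul_right_add (k := k) hx ha hy)
  have h := sgn_mul_b_of_mem (k := k) (p := p) hx hy
  simp only [smul_add, smul_smul, sgn_add, mul_comm r p] at key
  rw [← h, ← mul_assoc (sgn k (p * r)) (sgn k (p * r)) (b x y), sgn_mul_self, one_mul] at key
  rw [← key]
  congr 2
  linear_combination -sgn k (p * s) * sgn k (r * s) * sgn_mul_self (k := k) (p * r)

theorem paraMul_right_add_smul {p r s : ZMod 2} {a x y : C} (ha : a ∈ part k C p)
    (hx : x ∈ part k C r) (hy : y ∈ part k C s) :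
    sgn k (r * s) • paraMul k C (paraMul k C a y) x
      + (sgn k (p * s) * sgn k (p * r)) • paraMul k C (paraMul k C x y) a = (b a x : k) • y := by
  have key := congrArg (fun z => sgn k (r * s) • z) (paraMul_right_add (k := k) ha hy hx)
  have e := sgn_mul_self (k := k) (r * s)
  simp only [smul_add, smul_smul, sgn_add, mul_comm s r] at key
  rw [← mul_assoc (sgn k (r * s)) (sgn k (r * s)) (b a x), e, one_mul] at key
  rw [← key]
  congr 2
  linear_combination -sgn k (p * s) * sgn k (p * r) * e

theorem paraMul_left_add_smul {p r s : ZMod 2} {a x y : C} (ha : a ∈ part k C p)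
    (hx : x ∈ part k C r) (hy : y ∈ part k C s) :
    paraMul k C a (paraMul k C x y)
      + (sgn k (p * r) * sgn k (p * s) * sgn k (r * s)) • paraMul k C y (paraMul k C x a) =
      (sgn k (p * r) * b a y) • x := by
  have key := paraMul_left_add (k := k) ha hx hy
  have h := sgn_mul_b_of_mem (k := k) (p := r) ha hy
  rw [← h, mul_comm r p] at key
  simpa only [sgn_add] using key

theorem mul_conj_add {p q : ZMod 2} {x y : C} (hx : x ∈ part k C p) (hy : y ∈ part k C q) :
    x * conj k C y + sgn k (p * q) • (y * conj k C x) = (b x y : k) • (1 : C) := by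
  have h := mul_add_mul p q hx hy
  have e5 := sgn_mul_b_one (k := k) p q hx
  simp only [conj_apply, mul_sub, mul_smul_comm, mul_one, smul_sub, smul_smul, e5]
  linear_combination (norm := module) -h

theorem conj_mul_add {p q : ZMod 2} {x y : C} (hx : x ∈ part k C p) (hy : y ∈ part k C q) :
    conj k C x * y + sgn k (p * q) • (conj k C y * x) = (b x y : k) • (1 : C) := by
  have h := mul_add_mul p q hx hy
  have e5 := sgn_mul_b_one (k := k) q p hy
  rw [mul_comm q p] at e5
  simp only [conj_apply, sub_mul, smul_mul_assoc, one_mul, smul_sub, smul_smul, e5]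
  linear_combination (norm := module) -h

theorem b_one_one [Nontrivial C] : (b (1 : C) (1 : C) : k) = 2 := by
  have h := two_smul_one (k := k) (C := C)
  exact smul_left_injective k (one_ne_zero (α := C)) h

theorem eq_smul_one_of_conj (h2 : (2 : k) ≠ 0) {x : C} (hx : conj k C x = x) :
    x = ((2 : k)⁻¹ * b x (1 : C)) • (1 : C) := by
  rw [conj_apply] at hx
  have : (b x (1 : C) : k) • (1 : C) = (2 : k) • x := by
    rw [two_smul]; exact sub_eq_iff_eq_add.1 hx
  rw [mul_smul, this, smul_smul, inv_mul_cancel₀ h2, one_smul]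

end Hurwitz

end HurwitzSuperalgebra

section Jordan

variable {k C : Type*} [Field k] [NonAssocRing C] [Module k C]
  [IsScalarTower k C C] [SMulCommClass k C C] [HurwitzSuperalgebra k C]

theorem H3.mem_part {p : ZMod 2} {X : H3 k C} :
    X ∈ part k (H3 k C) p ↔ X.1 ∈ part k (Matrix (Fin 3) (Fin 3) C) p := by
  rw [mem_part_iff, mem_part_iff, Subtype.ext_iff]; rfl

theorem eJ_val (i : Fin 3) : (eJ k i : H3 k C).1 = Matrix.single i i 1 := rfl

theorem iotaJ_val (i : Fin 3) (a : C) : (iotaJ (k := k) i a).1 =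
    (2 : k) • (Matrix.single (i + 2) (i + 1) a + Matrix.single (i + 1) (i + 2) (conj k C a)) := rfl

theorem single_mem_part {p : ZMod 2} {a : C} (ha : a ∈ part k C p) (i j : Fin 3) :
    Matrix.single i j a ∈ part k (Matrix (Fin 3) (Fin 3) C) p := by
  refine mem_part_matrix.2 fun r s => ?_
  rw [Matrix.single_apply]
  split_ifs
  exacts [ha, zero_mem _]

theorem eJ_mem (i : Fin 3) : (eJ k i : H3 k C) ∈ part k (H3 k C) 0 :=
  H3.mem_part.2 (single_mem_part one_mem i i)

theorem iotaJ_mem {p : ZMod 2} {a : C} (ha : a ∈ part k C p) (i : Fin 3) :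
    iotaJ (k := k) i a ∈ part k (H3 k C) p := by
  rw [H3.mem_part, iotaJ_val]
  exact Submodule.smul_mem _ _ (add_mem (single_mem_part ha _ _)
    (single_mem_part (conj_mem p ha) _ _))

theorem matrix_mul_mem {p q : ZMod 2} {X Y : Matrix (Fin 3) (Fin 3) C}
    (hX : X ∈ part k _ p) (hY : Y ∈ part k _ q) : X * Y ∈ part k _ (p + q) := by
  refine mem_part_matrix.2 fun r s => ?_
  rw [Matrix.mul_apply]
  exact Submodule.sum_mem _ fun l _ =>
    mul_mem p q _ (mem_part_matrix.1 hX r l) _ (mem_part_matrix.1 hY l s)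

theorem jmul_val_of_mem {p q : ZMod 2} {X Y : H3 k C} (hX : X ∈ part k (H3 k C) p)
    (hY : Y ∈ part k (H3 k C) q) :
    (jmul X Y).1 = (2 : k)⁻¹ • (X.1 * Y.1 + sgn k (p * q) • (Y.1 * X.1)) := by
  rw [← show (LinearMap.mul k (Matrix (Fin 3) (Fin 3) C)) Y.1 X.1 = Y.1 * X.1 from rfl,
    ← superFlip_of_mem (LinearMap.mul k (Matrix (Fin 3) (Fin 3) C)) (H3.mem_part.1 hX)
      (H3.mem_part.1 hY)]
  rfl

theorem jmul_mem {p q : ZMod 2} {X Y : H3 k C} (hX : X ∈ part k (H3 k C) p)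
    (hY : Y ∈ part k (H3 k C) q) : jmul X Y ∈ part k (H3 k C) (p + q) := by
  rw [H3.mem_part, jmul_val_of_mem hX hY]
  rw [H3.mem_part] at hX hY
  exact Submodule.smul_mem _ _ (add_mem (matrix_mul_mem hX hY)
    (Submodule.smul_mem _ _ (add_comm p q ▸ matrix_mul_mem hY hX)))

theorem jmul_comm {p q : ZMod 2} {X Y : H3 k C} (hX : X ∈ part k (H3 k C) p)
    (hY : Y ∈ part k (H3 k C) q) : jmul X Y = sgn k (p * q) • jmul Y X := by
  refine Subtype.ext ?_
  rw [Submodule.coe_smul, jmul_val_of_mem hX hY, jmul_val_of_mem hY hX, mul_comm q p, smul_comm]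
  congr 1
  rw [smul_add, smul_smul, sgn_mul_self, one_smul, add_comm]

theorem jmul_mem_end {p : ZMod 2} {X : H3 k C} (hX : X ∈ part k (H3 k C) p) :
    jmul X ∈ part k (Module.End k (H3 k C)) p :=
  mem_part_end.2 fun _ _ hY => jmul_mem hX hY

theorem jmul_even_comm {X : H3 k C} (hX : X ∈ part k (H3 k C) 0) (Y : H3 k C) :
    jmul X Y = jmul Y X := by
  have := linearMap_ext (k := k) (f := jmul X) (g := jmul.flip X) fun q Y hY => by
    simpa using jmul_comm hX hY
  exact LinearMap.congr_fun this Y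

theorem jmul_eJ_eJ (h2 : (2 : k) ≠ 0) (i j : Fin 3) :
    jmul (eJ k i) (eJ k j) = if i = j then (eJ k i : H3 k C) else 0 := by
  refine Subtype.ext ?_
  rw [jmul_val_of_mem (eJ_mem i) (eJ_mem j), eJ_val, eJ_val]
  split_ifs with h
  · subst h
    simp [eJ_val, ← two_smul k, smul_smul, h2]
  · simp [h, Ne.symm h]

theorem jmul_eJ_iotaJ_self (i : Fin 3) (a : C) : jmul (eJ k i) (iotaJ (k := k) i a) = 0 := by
  refine LinearMap.congr_fun (linearMap_ext (k := k) (f := jmul (eJ k i) ∘ₗ iotaJ i) (g := 0)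
    fun p a ha => Subtype.ext ?_) a
  rw [LinearMap.comp_apply, jmul_val_of_mem (eJ_mem i) (iotaJ_mem ha i), eJ_val, iotaJ_val]
  simp [mul_add, add_mul, Matrix.single_mul_single_of_ne]

theorem jmul_eJ_iotaJ_of_ne {i j : Fin 3} (h : j ≠ i) (a : C) :
    jmul (eJ k j) (iotaJ (k := k) i a) = (2 : k)⁻¹ • iotaJ i a := by
  refine LinearMap.congr_fun (linearMap_ext (k := k) (f := jmul (eJ k j) ∘ₗ iotaJ i)
    (g := (2 : k)⁻¹ • iotaJ i) fun p a ha => Subtype.ext ?_) a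
  rw [LinearMap.comp_apply, jmul_val_of_mem (eJ_mem j) (iotaJ_mem ha i), LinearMap.smul_apply,
    Submodule.coe_smul, eJ_val, iotaJ_val]
  congr 1
  have hj : j = i + 1 ∨ j = i + 2 := by revert i j; decide
  rcases hj with rfl | rfl
  · simp [mul_add, add_mul, Matrix.single_mul_single_of_ne]
    abel
  · simp [mul_add, add_mul, Matrix.single_mul_single_of_ne]

theorem jmul_iotaJ_self (h2 : (2 : k) ≠ 0) (i : Fin 3) (a c : C) :
    jmul (iotaJ (k := k) i a) (iotaJ i c) = ((2 : k) * b a c) • (eJ k (i + 1) + eJ k (i + 2)) := by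
  have H := bilinMap_ext (k := k) (f := jmul.compl₁₂ (iotaJ (k := k) i) (iotaJ i))
    (g := (b : C →ₗ[k] C →ₗ[k] k).compr₂ (LinearMap.toSpanSingleton k (H3 k C)
      ((2 : k) • (eJ k (i + 1) + eJ k (i + 2))))) fun p q a ha c hc => Subtype.ext ?_
  · have := LinearMap.congr_fun₂ H a c
    simpa [smul_smul, mul_comm] using this
  · have h := mul_conj_add ha hc
    have h' := conj_mul_add ha hc
    simp only [LinearMap.compl₁₂_apply, LinearMap.compr₂_apply]
    rw [jmul_val_of_mem (iotaJ_mem ha i) (iotaJ_mem hc i), iotaJ_val, iotaJ_val]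
    simp only [LinearMap.toSpanSingleton_apply, Submodule.coe_smul, Submodule.coe_add, eJ_val]
    have e : ∀ j : Fin 3, (b a c : k) • Matrix.single j j (1 : C)
        = Matrix.single j j ((b a c : k) • (1 : C)) := fun j => by simp
    rw [smul_comm (b a c : k), smul_add (b a c : k), e, e]
    nth_rewrite 1 [← h']
    rw [← h]
    simp only [mul_add, add_mul, smul_mul_assoc, mul_smul_comm]
    simp only [Matrix.single_mul_single_same, Matrix.single_mul_single_of_ne, ne_eq,
      add_right_inj, not_false_eq_true, add_zero, zero_add, Fin.reduceEq, smul_add,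
      Matrix.single_add, ← Matrix.smul_single, smul_smul]
    match_scalars <;> field_simp

theorem jmul_iotaJ_succ (h2 : (2 : k) ≠ 0) (i : Fin 3) (a c : C) :
    jmul (iotaJ (k := k) i a) (iotaJ (i + 1) c) = iotaJ (i + 2) (paraMul k C a c) := by
  have H := bilinMap_ext (k := k) (f := jmul.compl₁₂ (iotaJ (k := k) i) (iotaJ (i + 1)))
    (g := (paraMul k C).compr₂ (iotaJ (i + 2))) fun p q a ha c hc => Subtype.ext ?_
  · exact LinearMap.congr_fun₂ H a c
  · have h := conj_mul_of_mem (conj_mem p ha) (conj_mem q hc)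
    have e1 : i + 1 + 1 = i + 2 := by revert i; decide
    have e2 : i + 1 + 2 = i := by revert i; decide
    have e3 : i + 2 + 1 = i := by revert i; decide
    have e4 : i + 2 + 2 = i + 1 := by revert i; decide
    rw [conj_conj, conj_conj] at h
    simp only [LinearMap.compl₁₂_apply, LinearMap.compr₂_apply]
    rw [jmul_val_of_mem (iotaJ_mem ha i) (iotaJ_mem hc (i + 1)), iotaJ_val, iotaJ_val, iotaJ_val,
      paraMul_apply, h, e1, e2, e3, e4]
    simp only [mul_add, add_mul, smul_mul_assoc, mul_smul_comm]
    simp only [Matrix.single_mul_single_same, Matrix.single_mul_single_of_ne, ne_eq,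
      add_right_inj, not_false_eq_true, add_zero, zero_add, Fin.reduceEq, smul_add,
      ← Matrix.smul_single, smul_smul, left_eq_add, add_eq_left, one_ne_zero]
    match_scalars <;> field_simp

end Jordan

section Table

variable {k C : Type*} [Field k] [NonAssocRing C] [Module k C]
  [IsScalarTower k C C] [SMulCommClass k C C] [HurwitzSuperalgebra k C]

theorem fin3_one_one (i : Fin 3) : i + 1 + 1 = i + 2 := by revert i; decide

theorem fin3_one_two (i : Fin 3) : i + 1 + 2 = i := by revert i; decide

theorem fin3_two_one (i : Fin 3) : i + 2 + 1 = i := by revert i; decide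

theorem fin3_two_two (i : Fin 3) : i + 2 + 2 = i + 1 := by revert i; decide

theorem fin3_cases (i j : Fin 3) : i = j ∨ j = i + 1 ∨ j = i + 2 := by revert i j; decide

theorem fin3_sum {M : Type*} [AddCommMonoid M] (i : Fin 3) (f : Fin 3 → M) :
    ∑ j, f j = f i + f (i + 1) + f (i + 2) := by
  rw [Fin.sum_univ_three]
  fin_cases i
  · rfl
  · change _ = f 1 + f 2 + f 0; abel
  · change _ = f 2 + f 0 + f 1; abel

theorem jmul_eJ_iotaJ (i j : Fin 3) (a : C) :
    jmul (eJ k j) (iotaJ (k := k) i a) = if j = i then 0 else (2 : k)⁻¹ • iotaJ i a := by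
  split_ifs with h
  · subst h; exact jmul_eJ_iotaJ_self _ _
  · exact jmul_eJ_iotaJ_of_ne h a

theorem jmul_iotaJ_eJ (i j : Fin 3) (a : C) :
    jmul (iotaJ (k := k) i a) (eJ k j) = if j = i then 0 else (2 : k)⁻¹ • iotaJ i a := by
  rw [← jmul_even_comm (eJ_mem j), jmul_eJ_iotaJ]

theorem jmul_iotaJ_one_two (h2 : (2 : k) ≠ 0) (i : Fin 3) (a c : C) :
    jmul (iotaJ (k := k) (i + 1) a) (iotaJ (i + 2) c) = iotaJ i (paraMul k C a c) := by
  have := jmul_iotaJ_succ h2 (i + 1) a c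
  rwa [fin3_one_one, fin3_one_two] at this

theorem jmul_iotaJ_two_zero (h2 : (2 : k) ≠ 0) (i : Fin 3) (a c : C) :
    jmul (iotaJ (k := k) (i + 2) a) (iotaJ i c) = iotaJ (i + 1) (paraMul k C a c) := by
  have := jmul_iotaJ_succ h2 (i + 2) a c
  rwa [fin3_two_one, fin3_two_two] at this

theorem jmul_iotaJ_one_zero (h2 : (2 : k) ≠ 0) (i : Fin 3) {p q : ZMod 2} {a c : C}
    (ha : a ∈ part k C p) (hc : c ∈ part k C q) :
    jmul (iotaJ (k := k) (i + 1) a) (iotaJ i c) =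
      sgn k (p * q) • iotaJ (i + 2) (paraMul k C c a) := by
  rw [jmul_comm (iotaJ_mem ha _) (iotaJ_mem hc _), jmul_iotaJ_succ h2]

theorem jmul_iotaJ_two_one (h2 : (2 : k) ≠ 0) (i : Fin 3) {p q : ZMod 2} {a c : C}
    (ha : a ∈ part k C p) (hc : c ∈ part k C q) :
    jmul (iotaJ (k := k) (i + 2) a) (iotaJ (i + 1) c) =
      sgn k (p * q) • iotaJ i (paraMul k C c a) := by
  rw [jmul_comm (iotaJ_mem ha _) (iotaJ_mem hc _), jmul_iotaJ_one_two h2]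

theorem jmul_iotaJ_zero_two (h2 : (2 : k) ≠ 0) (i : Fin 3) {p q : ZMod 2} {a c : C}
    (ha : a ∈ part k C p) (hc : c ∈ part k C q) :
    jmul (iotaJ (k := k) i a) (iotaJ (i + 2) c) =
      sgn k (p * q) • iotaJ (i + 1) (paraMul k C c a) := by
  rw [jmul_comm (iotaJ_mem ha _) (iotaJ_mem hc _), jmul_iotaJ_two_zero h2]

/-- The coefficient of `eᵢ` in an element of `J`. -/
noncomputable def diagJ (i : Fin 3) : H3 k C →ₗ[k] k :=
  (2 : k)⁻¹ • ((b : C →ₗ[k] C →ₗ[k] k).flip 1 ∘ₗ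
    Matrix.entryLinearMap k C i i ∘ₗ (hermitian k C).subtype)

theorem diagJ_apply (i : Fin 3) (X : H3 k C) :
    diagJ i X = (2 : k)⁻¹ * b (X.1 i i) (1 : C) := rfl

theorem coordJ_apply (i : Fin 3) (X : H3 k C) : coordJ (k := k) i X = X.1 (i + 2) (i + 1) := rfl

theorem coordJ_eJ (i j : Fin 3) : coordJ (k := k) (C := C) j (eJ k i) = 0 := by
  change Matrix.single i i (1 : C) (j + 2) (j + 1) = 0
  rw [Matrix.single_apply, if_neg]
  revert i j; decide

theorem coordJ_iotaJ (i j : Fin 3) (a : C) :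
    coordJ (k := k) j (iotaJ i a) = if j = i then (2 : k) • a else 0 := by
  change (2 : k) • (Matrix.single (i + 2) (i + 1) a (j + 2) (j + 1)
    + Matrix.single (i + 1) (i + 2) (conj k C a) (j + 2) (j + 1)) = _
  rw [Matrix.single_apply, Matrix.single_apply,
    if_neg (c := i + 1 = j + 2 ∧ i + 2 = j + 1) (by revert i j; decide), add_zero]
  rcases eq_or_ne j i with rfl | hne
  · simp
  · rw [if_neg (by rintro ⟨hh, -⟩; exact hne (add_right_cancel hh).symm), if_neg hne, smul_zero]

theorem diagJ_iotaJ (i j : Fin 3) (a : C) : diagJ (k := k) j (iotaJ i a) = 0 := by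
  rw [diagJ_apply, iotaJ_val]
  have h1 : ¬ (i + 2 = j ∧ i + 1 = j) := by revert i j; decide
  have h2 : ¬ (i + 1 = j ∧ i + 2 = j) := by revert i j; decide
  simp [h1, h2]

theorem diagJ_eJ [Nontrivial C] (h2 : (2 : k) ≠ 0) (i j : Fin 3) :
    diagJ (k := k) (C := C) j (eJ k i) = if j = i then 1 else 0 := by
  rw [diagJ_apply, eJ_val, Matrix.single_apply]
  rcases eq_or_ne j i with rfl | h
  · simp [b_one_one, h2]
  · simp [h, Ne.symm h]

theorem coordJ_mem {p : ZMod 2} {X : H3 k C} (hX : X ∈ part k (H3 k C) p) (i : Fin 3) :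
    coordJ (k := k) i X ∈ part k C p :=
  mem_part_matrix.1 (H3.mem_part.1 hX) _ _

theorem H3.eq_sum (h2 : (2 : k) ≠ 0) (X : H3 k C) :
    X = ∑ i, (diagJ i X • eJ k i + (2 : k)⁻¹ • iotaJ i (coordJ i X)) := by
  refine Subtype.ext (Matrix.ext fun r s => ?_)
  have hd : ∀ i, X.1 i i = diagJ i X • (1 : C) := fun i => by
    rw [diagJ_apply]; exact eq_smul_one_of_conj h2 (X.2 i i).symm
  simp only [Submodule.coe_add, Submodule.coe_smul, eJ_val,
    iotaJ_val, coordJ_apply, Matrix.add_apply, Matrix.smul_apply,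
    smul_smul, inv_mul_cancel₀ h2, one_smul, Fin.sum_univ_three]
  fin_cases r <;> fin_cases s <;> simp [hd] <;> exact X.2 _ _

theorem H3.linearMap_ext {U : Type*} [AddCommGroup U] [Module k U] (h2 : (2 : k) ≠ 0)
    {f g : H3 k C →ₗ[k] U} (he : ∀ i, f (eJ k i) = g (eJ k i))
    (hi : ∀ i p, ∀ x ∈ part k C p, f (iotaJ i x) = g (iotaJ i x)) : f = g := by
  have h : ∀ i, f ∘ₗ iotaJ i = g ∘ₗ iotaJ i := fun i => Superspace.linearMap_ext fun p x hx =>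
    hi i p x hx
  ext X
  rw [H3.eq_sum h2 X]
  simp only [map_sum, map_add, map_smul, he]
  refine Finset.sum_congr rfl fun i _ => ?_
  rw [show f (iotaJ i (coordJ i X)) = g (iotaJ i (coordJ i X)) from LinearMap.congr_fun (h i) _]

theorem innerD_apply_of_mem {p q : ZMod 2} {X Y : H3 k C} (hX : X ∈ part k (H3 k C) p)
    (hY : Y ∈ part k (H3 k C) q) (Z : H3 k C) :
    innerD X Y Z = jmul X (jmul Y Z) - sgn k (p * q) • jmul Y (jmul X Z) :=
  superComm_apply_of_mem (jmul_mem_end hX) (jmul_mem_end hY) Z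

theorem innerD_mem_part {p q : ZMod 2} {X Y : H3 k C} (hX : X ∈ part k (H3 k C) p)
    (hY : Y ∈ part k (H3 k C) q) : innerD X Y ∈ part k (Module.End k (H3 k C)) (p + q) :=
  superComm_mem_part (jmul_mem_end hX) (jmul_mem_end hY)

theorem innerD_skew {p q : ZMod 2} {X Y : H3 k C} (hX : X ∈ part k (H3 k C) p)
    (hY : Y ∈ part k (H3 k C) q) : innerD X Y = -(sgn k (p * q) • innerD Y X) :=
  superComm_skew (jmul_mem_end hX) (jmul_mem_end hY)

/-- `Dᵢ(a)` as a linear function of `a`. -/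
noncomputable def DJlin (k : Type*) {C : Type*} [Field k] [NonAssocRing C] [Module k C]
    [IsScalarTower k C C] [SMulCommClass k C C] [HurwitzSuperalgebra k C] (i : Fin 3) :
    C →ₗ[k] Module.End k (H3 k C) :=
  (2 : k) • (innerD.flip (eJ k (i + 1)) ∘ₗ iotaJ i)

theorem DJlin_apply (i : Fin 3) (a : C) : DJlin k i a = DJ i a := rfl

theorem DJ_apply_of_mem {p : ZMod 2} {a : C} (ha : a ∈ part k C p) (i : Fin 3) (Z : H3 k C) :
    DJ (k := k) i a Z = (2 : k) • (jmul (iotaJ i a) (jmul (eJ k (i + 1)) Z)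
      - jmul (eJ k (i + 1)) (jmul (iotaJ i a) Z)) := by
  rw [DJ, LinearMap.smul_apply, innerD_apply_of_mem (iotaJ_mem ha i) (eJ_mem (i + 1))]
  simp

theorem DJ_mem_part {p : ZMod 2} {a : C} (ha : a ∈ part k C p) (i : Fin 3) :
    DJ (k := k) i a ∈ part k (Module.End k (H3 k C)) p := by
  have := innerD_mem_part (iotaJ_mem (k := k) ha i) (eJ_mem (i + 1))
  rw [add_zero] at this
  exact Submodule.smul_mem _ _ this

theorem DJ_eJ_self (h2 : (2 : k) ≠ 0) {p : ZMod 2} {a : C} (ha : a ∈ part k C p) (i : Fin 3) :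
    DJ (k := k) i a (eJ k i) = 0 := by
  rw [DJ_apply_of_mem ha]
  simp [jmul_eJ_eJ h2, jmul_iotaJ_eJ]

theorem DJ_eJ_one (h2 : (2 : k) ≠ 0) {p : ZMod 2} {a : C} (ha : a ∈ part k C p) (i : Fin 3) :
    DJ (k := k) i a (eJ k (i + 1)) = (2 : k)⁻¹ • iotaJ i a := by
  rw [DJ_apply_of_mem ha]
  simp only [jmul_eJ_eJ h2, jmul_iotaJ_eJ, if_true, add_eq_left, one_ne_zero, if_false, map_smul,
    jmul_eJ_iotaJ]
  match_scalars; field_simp; norm_num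

theorem DJ_eJ_two (h2 : (2 : k) ≠ 0) {p : ZMod 2} {a : C} (ha : a ∈ part k C p) (i : Fin 3) :
    DJ (k := k) i a (eJ k (i + 2)) = -((2 : k)⁻¹ • iotaJ i a) := by
  rw [DJ_apply_of_mem ha]
  simp only [jmul_eJ_eJ h2, jmul_iotaJ_eJ, add_right_inj, Fin.reduceEq, if_false, add_eq_left, map_zero, map_smul, jmul_eJ_iotaJ,
    one_ne_zero]
  match_scalars; field_simp

theorem DJ_iotaJ_self (h2 : (2 : k) ≠ 0) {p : ZMod 2} {a : C} (ha : a ∈ part k C p) (i : Fin 3)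
    (x : C) : DJ (k := k) i a (iotaJ i x) = ((2 : k) * b a x) • (eJ k (i + 2) - eJ k (i + 1)) := by
  rw [DJ_apply_of_mem ha, jmul_eJ_iotaJ, jmul_iotaJ_self h2, if_neg (by simp), map_smul, map_smul,
    map_add, jmul_eJ_eJ h2, jmul_eJ_eJ h2, if_pos rfl, if_neg (by simp), jmul_iotaJ_self h2]
  match_scalars <;> field_simp 
  norm_num

theorem DJ_iotaJ_one (h2 : (2 : k) ≠ 0) {p : ZMod 2} {a : C} (ha : a ∈ part k C p) (i : Fin 3)
    (x : C) : DJ (k := k) i a (iotaJ (i + 1) x) = -iotaJ (i + 2) (paraMul k C a x) := by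
  rw [DJ_apply_of_mem ha, jmul_eJ_iotaJ, if_pos rfl, jmul_iotaJ_succ h2, jmul_eJ_iotaJ,
    if_neg (by simp)]
  simp [h2]

theorem DJ_iotaJ_two (h2 : (2 : k) ≠ 0) {p q : ZMod 2} {a x : C} (ha : a ∈ part k C p)
    (hx : x ∈ part k C q) (i : Fin 3) :
    DJ (k := k) i a (iotaJ (i + 2) x) = sgn k (p * q) • iotaJ (i + 1) (paraMul k C x a) := by
  rw [DJ_apply_of_mem ha, jmul_eJ_iotaJ, if_neg (by simp), map_smul,
    jmul_iotaJ_zero_two h2 i ha hx, map_smul, jmul_eJ_iotaJ, if_pos rfl]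
  simp [h2]

end Table

section Der

variable {k C : Type*} [Field k] [NonAssocRing C] [Module k C]
  [IsScalarTower k C C] [SMulCommClass k C C] [HurwitzSuperalgebra k C]

theorem leibniz_swap {p r s : ZMod 2} {d : Module.End k (H3 k C)}
    (hd : d ∈ part k (Module.End k (H3 k C)) p) {X Y : H3 k C} (hX : X ∈ part k (H3 k C) r)
    (hY : Y ∈ part k (H3 k C) s)
    (h : d (jmul X Y) = jmul (d X) Y + sgn k (p * r) • jmul X (d Y)) :
    d (jmul Y X) = jmul (d Y) X + sgn k (p * s) • jmul Y (d X) := by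
  rw [jmul_comm hY hX, map_smul, h, jmul_comm (apply_mem_part hd hX) hY,
    jmul_comm hX (apply_mem_part hd hY)]
  rcases parity_cases p with rfl | rfl <;> rcases parity_cases r with rfl | rfl <;>
    rcases parity_cases s with rfl | rfl <;> simp [one_add_one] <;> module

/-- The derivation property may be checked on the `eᵢ` and the `ιᵢ(x)`. -/
theorem mem_derPart_of_table (h2 : (2 : k) ≠ 0) {p : ZMod 2} {d : Module.End k (H3 k C)}
    (hd : d ∈ part k (Module.End k (H3 k C)) p)
    (hee : ∀ i j, d (jmul (eJ k i) (eJ k j)) = jmul (d (eJ k i)) (eJ k j)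
      + jmul (eJ k i) (d (eJ k j)))
    (hei : ∀ i j r, ∀ x ∈ part k C r, d (jmul (eJ k i) (iotaJ j x)) =
      jmul (d (eJ k i)) (iotaJ j x) + jmul (eJ k i) (d (iotaJ j x)))
    (hii : ∀ i r s, ∀ x ∈ part k C r, ∀ y ∈ part k C s,
      d (jmul (iotaJ i x) (iotaJ i y)) = jmul (d (iotaJ i x)) (iotaJ i y)
        + sgn k (p * r) • jmul (iotaJ i x) (d (iotaJ i y)))
    (his : ∀ i r s, ∀ x ∈ part k C r, ∀ y ∈ part k C s,
      d (jmul (iotaJ i x) (iotaJ (i + 1) y)) = jmul (d (iotaJ i x)) (iotaJ (i + 1) y)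
        + sgn k (p * r) • jmul (iotaJ i x) (d (iotaJ (i + 1) y))) :
    d ∈ derPart k C p := by
  refine ⟨hd, ?_⟩
  set S : Module.End k (H3 k C) := (∑ r : ZMod 2, sgn k (p * r) • (proj r : Module.End k (H3 k C)) :
    Module.End k (H3 k C)) with hS
  have hS' : ∀ r, ∀ X ∈ part k (H3 k C) r, S X = sgn k (p * r) • X := by
    intro r X hX
    simp only [hS, sum_two, LinearMap.add_apply, LinearMap.smul_apply, proj_eq_ite _ hX]
    rcases parity_cases r with rfl | rfl <;> simp
  have key : (jmul : H3 k C →ₗ[k] H3 k C →ₗ[k] H3 k C).compr₂ d = (jmul : H3 k C →ₗ[k] H3 k C →ₗ[k] H3 k C) ∘ₗ d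
      + ((jmul : H3 k C →ₗ[k] H3 k C →ₗ[k] H3 k C).compl₂ d) ∘ₗ S := by
    refine H3.linearMap_ext (U := H3 k C →ₗ[k] H3 k C) h2 (fun i => ?_) (fun i r x hx => ?_)
    · refine H3.linearMap_ext h2 (fun j => ?_) (fun j r x hx => ?_)
      · simpa [hS' 0 _ (eJ_mem i)] using hee i j
      · simpa [hS' 0 _ (eJ_mem i)] using hei i j r x hx
    · refine H3.linearMap_ext h2 (fun j => ?_) (fun j s y hy => ?_)
      · have := leibniz_swap hd (eJ_mem j) (iotaJ_mem (k := k) hx i)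
          (by simpa using hei j i r x hx)
        simpa [hS' r _ (iotaJ_mem hx i)] using this
      · have : d (jmul (iotaJ i x) (iotaJ j y)) = jmul (d (iotaJ i x)) (iotaJ j y)
            + sgn k (p * r) • jmul (iotaJ i x) (d (iotaJ j y)) := by
          rcases fin3_cases i j with rfl | rfl | rfl
          · exact hii _ r s x hx y hy
          · exact his _ r s x hx y hy
          · have h := his (i + 2) s r y hy x hx
            rw [fin3_two_one] at h
            exact leibniz_swap hd (iotaJ_mem hy _) (iotaJ_mem hx _) h
        simpa [hS' r _ (iotaJ_mem hx i)] using this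
  intro r X hX Y
  have := LinearMap.congr_fun₂ key X Y
  simpa [hS' r X hX] using this

theorem tri_rotate {p : ZMod 2} {f g h : Module.End k C}
    (hf : f ∈ ospPart (b : C →ₗ[k] C →ₗ[k] k) p) (hg : g ∈ ospPart (b : C →ₗ[k] C →ₗ[k] k) p)
    (H : ∀ r, ∀ x ∈ part k C r, ∀ y, f (paraMul k C x y) =
      paraMul k C (g x) y + sgn k (p * r) • paraMul k C x (h y)) :
    ∀ r, ∀ x ∈ part k C r, ∀ y, g (paraMul k C x y) =
      paraMul k C (h x) y + sgn k (p * r) • paraMul k C x (f y) := by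
  intro r x hx y
  have hassoc : ∀ u v w : C, (b (paraMul k C u v) w : k) = b u (paraMul k C v w) := by
    intro u v w
    have e1 : ((b : C →ₗ[k] C →ₗ[k] k).compl₂ ((paraMul k C).flip w)) =
        ((paraMul k C).compr₂ ((b : C →ₗ[k] C →ₗ[k] k).flip w)) :=
      bilinMap_ext fun p q u hu v hv => by
        refine LinearMap.congr_fun (linearMap_ext (k := k) (f := b u ∘ₗ paraMul k C v)
          (g := b (paraMul k C u v)) fun s w hw => ?_) w
        exact (b_paraMul_of_mem hu hv hw).symm
    exact (LinearMap.congr_fun₂ e1 u v).symm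
  rw [← sub_eq_zero]
  refine (b_nondegenerate (k := k) (C := C)).2 _ fun z => ?_
  refine LinearMap.congr_fun (linearMap_ext (k := k) (f := b.flip _) (g := 0) fun s z hz => ?_) z
  have e1 := hg.2 s z hz (paraMul k C x y)
  have e2 := congrArg (fun w => (b w y : k)) (H s z hz x)
  have e3 := hf.2 _ _ (paraMul_mem hz hx) y
  simp only [map_add, map_smul, LinearMap.add_apply, LinearMap.smul_apply, smul_eq_mul] at e2
  change b z (_ - _) = (0 : k)
  simp only [map_sub, map_add, map_smul, smul_eq_mul]
  simp only [hassoc] at e1 e2 e3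
  rw [mul_add, sgn_add] at e3
  have q1 := sgn_mul_self (k := k) (p * s)
  linear_combination sgn k (p * s) * e1 + sgn k (p * s) * e2 - sgn k (p * s) * e3
    + (-b z (g (paraMul k C x y)) + b z (paraMul k C (h x) y)
      + sgn k (p * r) * b z (paraMul k C x (f y))) * q1

theorem triPart_succ {p : ZMod 2} {d : Fin 3 → Module.End k C}
    (hd : d ∈ triPart (paraMul k C) (b : C →ₗ[k] C →ₗ[k] k) p) (i : Fin 3) {r : ZMod 2} {x : C}
    (hx : x ∈ part k C r) (y : C) : d (i + 2) (paraMul k C x y) =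
      paraMul k C (d i x) y + sgn k (p * r) • paraMul k C x (d (i + 1) y) := by
  have h1 := tri_rotate (hd.1 0) (hd.1 1) hd.2
  have h2 := tri_rotate (hd.1 1) (hd.1 2) h1
  fin_cases i
  · exact h2 r x hx y
  · exact hd.2 r x hx y
  · exact h1 r x hx y

theorem DtriJ_mem_part {p : ZMod 2} {d : Fin 3 → Module.End k C}
    (hd : ∀ i, d i ∈ part k (Module.End k C) p) :
    DtriJ (k := k) d ∈ part k (Module.End k (H3 k C)) p := by
  refine mem_part_end.2 fun q X hX => ?_
  rw [DtriJ, LinearMap.sum_apply]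
  refine Submodule.sum_mem _ fun i _ => Submodule.smul_mem _ _ ?_
  exact iotaJ_mem (apply_mem_part (hd i) (coordJ_mem hX i)) i

theorem DtriJ_mem_derPart (h2 : (2 : k) ≠ 0) {p : ZMod 2} {d : Fin 3 → Module.End k C}
    (hd : d ∈ triPart (paraMul k C) (b : C →ₗ[k] C →ₗ[k] k) p) : DtriJ d ∈ derPart k C p := by
  refine mem_derPart_of_table h2 (DtriJ_mem_part fun i => (hd.1 i).1) (fun i j => ?_)
    (fun i j r x hx => ?_) (fun i r s x hx y hy => ?_) (fun i r s x hx y hy => ?_)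
  · rw [jmul_eJ_eJ h2]
    split_ifs <;> simp [DtriJ_eJ]
  · rw [jmul_eJ_iotaJ, DtriJ_eJ, DtriJ_iotaJ h2, jmul_eJ_iotaJ]
    split_ifs <;> simp [DtriJ_iotaJ h2]
  · have h := (hd.1 i).2 r x hx y
    rw [jmul_iotaJ_self h2, DtriJ_iotaJ h2, DtriJ_iotaJ h2, jmul_iotaJ_self h2, jmul_iotaJ_self h2,
      map_smul, map_add, DtriJ_eJ, DtriJ_eJ, smul_smul, ← add_smul]
    rw [show (2 : k) * b (d i x) y + sgn k (p * r) * (2 * b x (d i y)) = 0 by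
      linear_combination 2 * h]
    simp
  · rw [jmul_iotaJ_succ h2, DtriJ_iotaJ h2, DtriJ_iotaJ h2, DtriJ_iotaJ h2, jmul_iotaJ_succ h2,
      jmul_iotaJ_succ h2, triPart_succ hd i hx y, map_add, map_smul]

theorem DJ_mem_derPart (h2 : (2 : k) ≠ 0) {p : ZMod 2} {a : C} (ha : a ∈ part k C p) (i : Fin 3) :
    DJ (k := k) i a ∈ derPart k C p := by
  have h22 : ∀ c : k, 2 * c * 2⁻¹ = c := fun c => by field_simp
  refine mem_derPart_of_table h2 (DJ_mem_part ha i) (fun j l => ?_)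
    (fun j l r x hx => ?_) (fun j r s x hx y hy => ?_) (fun j r s x hx y hy => ?_)
  · rw [jmul_eJ_eJ h2]
    rcases fin3_cases i j with rfl | rfl | rfl <;> rcases fin3_cases i l with rfl | rfl | rfl <;>
    simp only [DJ_eJ_self h2 ha, DJ_eJ_one h2 ha, DJ_eJ_two h2 ha, map_smul, map_neg, map_zero,
      LinearMap.smul_apply, LinearMap.neg_apply, LinearMap.zero_apply, jmul_iotaJ_eJ, jmul_eJ_iotaJ,
      add_right_inj, Fin.reduceEq, if_false, if_true, left_eq_add, add_eq_left, one_ne_zero] <;>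
    (try match_scalars) <;> (try field_simp) <;> norm_num
  · rw [jmul_eJ_iotaJ]
    rcases fin3_cases i j with rfl | rfl | rfl <;> rcases fin3_cases i l with rfl | rfl | rfl <;>
    simp only [DJ_eJ_self h2 ha, DJ_eJ_one h2 ha, DJ_eJ_two h2 ha, map_smul, map_neg, map_zero,
      DJ_iotaJ_self h2 ha, DJ_iotaJ_one h2 ha, DJ_iotaJ_two h2 ha hx, map_sub, jmul_eJ_eJ h2,
      jmul_iotaJ_self h2, jmul_iotaJ_succ h2, jmul_iotaJ_zero_two h2 _ ha hx,
      LinearMap.smul_apply, LinearMap.neg_apply, LinearMap.zero_apply, jmul_eJ_iotaJ,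
      add_right_inj, Fin.reduceEq, if_false, if_true, left_eq_add, add_eq_left, one_ne_zero] <;>
    (try match_scalars) <;> (try field_simp) <;> norm_num
  · rcases fin3_cases i j with rfl | rfl | rfl
    · simp only [jmul_iotaJ_self h2, DJ_iotaJ_self h2 ha, map_smul, map_add, map_sub,
        LinearMap.smul_apply, LinearMap.sub_apply, DJ_eJ_one h2 ha, DJ_eJ_two h2 ha, jmul_iotaJ_eJ,
        jmul_eJ_iotaJ, add_eq_left, one_ne_zero, if_false, Fin.reduceEq]
      module
    · have key := congrArg (iotaJ (k := k) i) (smul_paraMul_left_add (k := k) ha hx hy)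
      simp only [jmul_iotaJ_self h2, DJ_iotaJ_one h2 ha, map_smul, map_add, map_neg,
        LinearMap.neg_apply, fin3_one_one, fin3_one_two, DJ_eJ_self h2 ha, DJ_eJ_two h2 ha,
        jmul_iotaJ_two_one h2 i (paraMul_mem ha hx) hy, jmul_iotaJ_one_two h2, add_zero,
        smul_neg, smul_smul, h22, add_mul, sgn_add] at key ⊢
      linear_combination (norm := module) key
    · have key := congrArg (iotaJ (k := k) i) (smul_paraMul_right_add (k := k) ha hx hy)
      simp only [jmul_iotaJ_self h2, DJ_iotaJ_two h2 ha hx, DJ_iotaJ_two h2 ha hy, map_smul, map_add,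
        LinearMap.smul_apply, fin3_two_one, fin3_two_two, DJ_eJ_self h2 ha, DJ_eJ_one h2 ha,
        jmul_iotaJ_two_one h2 i hx (paraMul_mem hy ha), jmul_iotaJ_one_two h2, zero_add,
        smul_smul, h22, mul_add, sgn_add, mul_comm r p] at key ⊢
      rw [← key]
      have e := sgn_mul_self (k := k) (p * r)
      match_scalars
      · ring
      · linear_combination -sgn k (p * s) * sgn k (r * s) * e
  · rcases fin3_cases i j with rfl | rfl | rfl
    · have key := congrArg (iotaJ (k := k) (i + 1)) (paraMul_right_add_smul (k := k) ha hx hy)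
      simp only [jmul_iotaJ_succ h2, DJ_iotaJ_self h2 ha, DJ_iotaJ_one h2 ha,
        DJ_iotaJ_two h2 ha (paraMul_mem hx hy), map_smul, map_sub, map_neg, map_add,
        LinearMap.smul_apply, LinearMap.sub_apply, jmul_eJ_iotaJ, if_true, Fin.reduceEq,
        add_right_inj, if_false, jmul_iotaJ_zero_two h2 i hx (paraMul_mem ha hy), sub_zero,
        smul_smul, h22, smul_neg, mul_add, sgn_add, mul_comm r p] at key ⊢
      rw [← key]
      have e := sgn_mul_self (k := k) (p * r)
      match_scalars
      · ring
      · linear_combination sgn k (r * s) * e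
    · simp only [fin3_one_one]
      simp only [jmul_iotaJ_one_two h2, jmul_iotaJ_self h2, DJ_iotaJ_self h2 ha, DJ_iotaJ_one h2 ha,
        DJ_iotaJ_two h2 ha hy, map_smul, map_neg, LinearMap.neg_apply, fin3_one_one, fin3_one_two,
        fin3_two_one, fin3_two_two]
      have k1 := b_paraMul_of_mem (k := k) ha hx hy
      have k2 := b_paraMul_of_mem (k := k) hx hy ha
      have k3 := b_supersymm (k := k) _ _ _ (paraMul_mem hx hy) _ ha
      rw [← k2, k3, k1]
      have e : sgn k (p * r) * sgn k (p * s) * sgn k ((r + s) * p) = 1 := by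
        rcases parity_cases p with rfl | rfl <;> rcases parity_cases r with rfl | rfl <;>
          rcases parity_cases s with rfl | rfl <;> simp [one_add_one]
      match_scalars
      · linear_combination -2 * (b a (paraMul k C x y) : k) * e
      · ring
      · linear_combination -2 * (b a (paraMul k C x y) : k) * e
    · have key := congrArg (iotaJ (k := k) (i + 2)) (paraMul_left_add_smul (k := k) ha hx hy)
      simp only [fin3_two_one] at key ⊢
      simp only [jmul_iotaJ_two_zero h2, DJ_iotaJ_self h2 ha, DJ_iotaJ_one h2 ha,
        DJ_iotaJ_two h2 ha hx, map_smul, map_sub, map_add,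
        LinearMap.smul_apply, jmul_iotaJ_eJ, if_true, Fin.reduceEq,
        add_right_inj, if_false, jmul_iotaJ_one_zero h2 i (paraMul_mem hx ha) hy, zero_sub,
        smul_smul, smul_neg, h22, add_mul, sgn_add] at key ⊢
      linear_combination (norm := module) -key

end Der

section DerSpan

variable {k C : Type*} [Field k] [NonAssocRing C] [Module k C]
  [IsScalarTower k C C] [SMulCommClass k C C] [HurwitzSuperalgebra k C]

theorem coordJ_jmul_eJ (h2 : (2 : k) ≠ 0) (i j : Fin 3) (X : H3 k C) :
    coordJ (k := k) i (jmul (eJ k j) X) = if i = j then 0 else (2 : k)⁻¹ • coordJ i X := by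
  have := H3.linearMap_ext h2 (f := coordJ (k := k) (C := C) i ∘ₗ jmul (eJ k j))
    (g := if i = j then 0 else (2 : k)⁻¹ • coordJ i) (fun l => ?_) (fun l p x hx => ?_)
  · rw [← LinearMap.comp_apply, this]
    split_ifs <;> rfl
  · rw [LinearMap.comp_apply, jmul_eJ_eJ h2]
    split_ifs <;> simp [coordJ_eJ]
  · rw [LinearMap.comp_apply, jmul_eJ_iotaJ]
    split_ifs with h h' h' <;> simp [coordJ_iotaJ] <;> (intros; simp_all)

theorem diagJ_jmul_eJ [Nontrivial C] (h2 : (2 : k) ≠ 0) (i j : Fin 3) (X : H3 k C) :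
    diagJ (k := k) i (jmul (eJ k j) X) = if i = j then diagJ i X else 0 := by
  have := H3.linearMap_ext h2 (f := diagJ (k := k) (C := C) i ∘ₗ jmul (eJ k j))
    (g := if i = j then diagJ i else 0) (fun l => ?_) (fun l p x hx => ?_)
  · rw [← LinearMap.comp_apply, this]
    split_ifs <;> rfl
  · rw [LinearMap.comp_apply, jmul_eJ_eJ h2]
    split_ifs with h h' h' <;> simp [diagJ_eJ h2] <;> simp_all
  · rw [LinearMap.comp_apply, jmul_eJ_iotaJ]
    split_ifs <;> simp [diagJ_iotaJ]

theorem H3.ext_coord (h2 : (2 : k) ≠ 0) {X Y : H3 k C} (hd : ∀ i, diagJ i X = diagJ i Y)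
    (hc : ∀ i, coordJ (k := k) i X = coordJ i Y) : X = Y := by
  rw [H3.eq_sum h2 X, H3.eq_sum h2 Y]
  simp only [hd, hc]

theorem two_mul_eq_self {x : k} (h : x = 2 * x) : x = 0 := by linear_combination -h

/-- The `i`-th component of the triple attached to an endomorphism of `J`. -/
noncomputable def compJ (k : Type*) {C : Type*} [Field k] [NonAssocRing C] [Module k C]
    [IsScalarTower k C C] [SMulCommClass k C C] [HurwitzSuperalgebra k C] (i : Fin 3) :
    Module.End k (H3 k C) →ₗ[k] Module.End k C :=
  (2 : k)⁻¹ • (LinearMap.llcomp k C (H3 k C) C (coordJ i) ∘ₗ LinearMap.lcomp k (H3 k C) (iotaJ i))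

theorem compJ_apply (i : Fin 3) (d : Module.End k (H3 k C)) (x : C) :
    compJ k i d x = (2 : k)⁻¹ • coordJ i (d (iotaJ i x)) := rfl

theorem compJ_DtriJ (h2 : (2 : k) ≠ 0) (d : Fin 3 → Module.End k C) (i : Fin 3) :
    compJ k i (DtriJ d) = d i := by
  ext x
  rw [compJ_apply, DtriJ_iotaJ h2, coordJ_iotaJ, if_pos rfl, smul_smul, inv_mul_cancel₀ h2, one_smul]

theorem derPart_eJ {p : ZMod 2} {d : Module.End k (H3 k C)} (hd : d ∈ derPart k C p) (X : H3 k C) (i : Fin 3) :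
    d (jmul (eJ k i) X) = jmul (d (eJ k i)) X + jmul (eJ k i) (d X) := by
  simpa using hd.2 0 _ (eJ_mem i) X

theorem coordJ_DJ_eJ (h2 : (2 : k) ≠ 0) {p : ZMod 2} {a : C} (ha : a ∈ part k C p) (i j : Fin 3) :
    coordJ (k := k) i (DJ j a (eJ k (i + 1))) = if i = j then a else 0 := by
  rcases fin3_cases i j with rfl | rfl | rfl
  · rw [DJ_eJ_one h2 ha, map_smul, coordJ_iotaJ, if_pos rfl, if_pos rfl, smul_smul,
      inv_mul_cancel₀ h2, one_smul]
  · rw [DJ_eJ_self h2 ha, map_zero, if_neg (by simp)]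
  · have := DJ_eJ_two h2 ha (i + 2)
    rw [fin3_two_two] at this
    rw [this, map_neg, map_smul, coordJ_iotaJ, if_neg (by simp), if_neg (by simp)]
    simp

section Nontriv

variable [Nontrivial C] {p : ZMod 2} {d : Module.End k (H3 k C)}

theorem derPart_iotaJ (h2 : (2 : k) ≠ 0) (hd : d ∈ derPart k C p) (he : ∀ i, d (eJ k i) = 0)
    (i : Fin 3) (x : C) : d (iotaJ i x) = iotaJ i (compJ k i d x) := by
  have h0 := derPart_eJ hd (iotaJ i x) i
  have h1 := derPart_eJ hd (iotaJ i x) (i + 1)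
  have h3 := derPart_eJ hd (iotaJ i x) (i + 2)
  rw [jmul_eJ_iotaJ, if_pos rfl, he, map_zero, map_zero, LinearMap.zero_apply, zero_add] at h0
  rw [jmul_eJ_iotaJ, if_neg (by simp), he, map_zero, LinearMap.zero_apply, zero_add, map_smul] at h1 h3
  have c : ∀ j : Fin 3, jmul (eJ k j) (d (iotaJ i x)) = (2 : k)⁻¹ • d (iotaJ i x) →
      diagJ j (d (iotaJ i x)) = 0 ∧ coordJ (k := k) j (d (iotaJ i x)) = 0 := by
    intro j h
    have hd := congrArg (diagJ j) h
    have hc := congrArg (coordJ (k := k) j) h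
    rw [diagJ_jmul_eJ h2, if_pos rfl, map_smul, smul_eq_mul] at hd
    rw [coordJ_jmul_eJ h2, if_pos rfl, map_smul, eq_comm, smul_eq_zero] at hc
    refine ⟨?_, hc.resolve_left (inv_ne_zero h2)⟩
    have h' : (2 : k) * diagJ j (d (iotaJ i x)) = diagJ j (d (iotaJ i x)) := by
      conv_lhs => rw [hd]
      rw [mul_inv_cancel_left₀ h2]
    exact two_mul_eq_self h'.symm
  have d0 := congrArg (diagJ i) h0
  rw [map_zero, diagJ_jmul_eJ h2, if_pos rfl] at d0
  refine H3.ext_coord h2 (fun j => ?_) (fun j => ?_)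
  · rw [diagJ_iotaJ]
    rcases fin3_cases i j with rfl | rfl | rfl
    · exact d0.symm
    · exact (c _ h1.symm).1
    · exact (c _ h3.symm).1
  · rw [coordJ_iotaJ, compJ_apply, smul_smul, mul_inv_cancel₀ h2, one_smul]
    rcases fin3_cases i j with rfl | rfl | rfl
    · rw [if_pos rfl]
    · rw [if_neg (by simp)]; exact (c _ h1.symm).2
    · rw [if_neg (by simp)]; exact (c _ h3.symm).2

theorem derPart_eq_DtriJ (h2 : (2 : k) ≠ 0) (hd : d ∈ derPart k C p) (he : ∀ i, d (eJ k i) = 0) :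
    d = DtriJ fun i => compJ k i d :=
  H3.linearMap_ext h2 (fun i => by rw [he, DtriJ_eJ])
    (fun i _ x _ => by rw [DtriJ_iotaJ h2]; exact derPart_iotaJ h2 hd he i x)

theorem iotaJ_injective (h2 : (2 : k) ≠ 0) (i : Fin 3) :
    Function.Injective (iotaJ (k := k) (C := C) i) := by
  intro x y h
  have := congrArg (coordJ (k := k) i) h
  rw [coordJ_iotaJ, coordJ_iotaJ, if_pos rfl, if_pos rfl] at this
  exact smul_right_injective C h2 this

theorem compJ_mem_triPart (h2 : (2 : k) ≠ 0) (hd : d ∈ derPart k C p)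
    (he : ∀ i, d (eJ k i) = 0) :
    (fun i => compJ k i d) ∈ triPart (paraMul k C) (b : C →ₗ[k] C →ₗ[k] k) p := by
  refine ⟨fun i => ⟨mem_part_end.2 fun q x hx => ?_, fun r x hx y => ?_⟩, fun r x hx y => ?_⟩
  · exact Submodule.smul_mem _ _ (coordJ_mem (apply_mem_part hd.1 (iotaJ_mem hx i)) i)
  · have h := hd.2 r _ (iotaJ_mem hx i) (iotaJ i y)
    rw [derPart_iotaJ h2 hd he, derPart_iotaJ h2 hd he, jmul_iotaJ_self h2, jmul_iotaJ_self h2,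
      jmul_iotaJ_self h2, map_smul, map_add, he, he, smul_smul, ← add_smul] at h
    have h' := congrArg (diagJ (i + 1)) h
    rw [map_smul, map_smul, map_add, map_add, diagJ_eJ h2, diagJ_eJ h2, if_pos rfl,
      if_neg (by simp)] at h'
    simp only [map_zero, smul_eq_mul, add_zero, mul_zero, mul_one] at h'
    have : (2 : k) * (b (compJ k i d x) y + sgn k (p * r) * b x (compJ k i d y)) = 0 := by
      linear_combination -h'
    exact (mul_eq_zero.1 this).resolve_left h2
  · have h := hd.2 r _ (iotaJ_mem hx 1) (iotaJ (1 + 1) y)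
    rw [jmul_iotaJ_succ h2, derPart_iotaJ h2 hd he, derPart_iotaJ h2 hd he, derPart_iotaJ h2 hd he,
      jmul_iotaJ_succ h2, jmul_iotaJ_succ h2, ← map_smul, ← map_add] at h
    exact iotaJ_injective h2 _ h

theorem coordJ_derPart_eJ (h2 : (2 : k) ≠ 0) (hd : d ∈ derPart k C p) (i : Fin 3) :
    (∀ j, diagJ j (d (eJ k i)) = 0) ∧ coordJ (k := k) i (d (eJ k i)) = 0 := by
  have h := derPart_eJ hd (eJ k i) i
  rw [jmul_eJ_eJ h2, if_pos rfl, ← jmul_even_comm (eJ_mem i)] at h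
  constructor
  · intro j
    have h' := congrArg (diagJ j) h
    rw [map_add, diagJ_jmul_eJ h2] at h'
    split_ifs at h'
    · exact two_mul_eq_self (by linear_combination h')
    · simpa using h'
  · have h' := congrArg (coordJ (k := k) i) h
    rw [map_add, coordJ_jmul_eJ h2] at h'
    simpa using h'

theorem coordJ_derPart_eJ_two (h2 : (2 : k) ≠ 0) (hd : d ∈ derPart k C p) (i : Fin 3) :
    coordJ (k := k) i (d (eJ k (i + 2))) = -coordJ (k := k) i (d (eJ k (i + 1))) := by
  have h := derPart_eJ hd (eJ k (i + 2)) (i + 1)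
  rw [jmul_eJ_eJ h2, if_neg (by simp), ← jmul_even_comm (eJ_mem (i + 2)), map_zero] at h
  have h' := congrArg (coordJ (k := k) i) h
  rw [map_add, coordJ_jmul_eJ h2, coordJ_jmul_eJ h2, if_neg (by simp), if_neg (by simp), map_zero,
    ← smul_add, eq_comm, smul_eq_zero] at h'
  rw [eq_neg_iff_add_eq_zero, add_comm]
  exact h'.resolve_left (inv_ne_zero h2)

/-- Every derivation is the sum of a `D_{(d₀,d₁,d₂)}` and of the `Dᵢ(aᵢ)`. -/
theorem derPart_decomp (h2 : (2 : k) ≠ 0) (hd : d ∈ derPart k C p) :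
    ∃ t ∈ triPart (paraMul k C) (b : C →ₗ[k] C →ₗ[k] k) p,
      d = DtriJ t + ∑ i, DJ i (coordJ (k := k) i (d (eJ k (i + 1)))) := by
  have ha : ∀ i, coordJ (k := k) i (d (eJ k (i + 1))) ∈ part k C p := fun i => by
    have := coordJ_mem (apply_mem_part hd.1 (eJ_mem (i + 1))) i
    rwa [add_zero] at this
  set d' := d + (-1 : k) • ∑ i, DJ i (coordJ (k := k) i (d (eJ k (i + 1)))) with hd'
  have hm : d' ∈ derPart k C p :=
    add_mem hd (Submodule.smul_mem _ _ (Submodule.sum_mem _ fun i _ =>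
      DJ_mem_derPart h2 (ha i) i))
  have c1 : ∀ i, coordJ (k := k) i (d' (eJ k (i + 1))) = 0 := fun i => by
    rw [hd', LinearMap.add_apply, map_add, LinearMap.smul_apply, map_smul, LinearMap.sum_apply,
      map_sum,
      Finset.sum_congr rfl fun j _ => coordJ_DJ_eJ h2 (ha j) i j]
    simp
  have he : ∀ i, d' (eJ k i) = 0 := fun i => H3.ext_coord h2
    (fun j => by rw [(coordJ_derPart_eJ h2 hm i).1 j, map_zero]) (fun j => by
      rw [map_zero]
      rcases fin3_cases j i with rfl | rfl | rfl
      · exact (coordJ_derPart_eJ h2 hm _).2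
      · exact c1 j
      · rw [coordJ_derPart_eJ_two h2 hm, c1, neg_zero])
  refine ⟨_, compJ_mem_triPart h2 hm he, ?_⟩
  rw [← derPart_eq_DtriJ h2 hm he, hd']
  module

end Nontriv

theorem superComm_mem_derPart {p q : ZMod 2} {d e : Module.End k (H3 k C)}
    (hd : d ∈ derPart k C p) (he : e ∈ derPart k C q) :
    superComm k (H3 k C) d e ∈ derPart k C (p + q) := by
  refine ⟨superComm_mem_part hd.1 he.1, fun r X hX Y => ?_⟩
  simp only [superComm_apply_of_mem hd.1 he.1, hd.2 r X hX, he.2 r X hX, map_add, map_smul,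
    hd.2 _ _ (apply_mem_part he.1 hX), he.2 _ _ (apply_mem_part hd.1 hX), map_sub,
    LinearMap.sub_apply, LinearMap.smul_apply]
  rcases parity_cases p with rfl | rfl <;> rcases parity_cases q with rfl | rfl <;>
    rcases parity_cases r with rfl | rfl <;> simp [one_add_one] <;> module

theorem innerD_eq_superComm (X Y : H3 k C) :
    innerD X Y = superComm k (H3 k C) (jmul X) (jmul Y) := rfl

/-- `[d, d_{X,Y}] = d_{dX,Y} + (-1)^{dX} d_{X,dY}`. -/
theorem superComm_innerD {p q r : ZMod 2} {d : Module.End k (H3 k C)} {X Y : H3 k C}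
    (hd : d ∈ derPart k C p) (hX : X ∈ part k (H3 k C) q) (hY : Y ∈ part k (H3 k C) r) :
    superComm k (H3 k C) d (innerD X Y) =
      innerD (d X) Y + sgn k (p * q) • innerD X (d Y) := by
  have hL : ∀ s, ∀ Z ∈ part k (H3 k C) s, superComm k (H3 k C) d (jmul Z) = jmul (d Z) := by
    intro s Z hZ
    ext1 W
    rw [superComm_apply_of_mem hd.1 (jmul_mem_end hZ), hd.2 s Z hZ]
    abel
  have h := superComm_jacobi hd.1 (jmul_mem_end hX) (jmul_mem_end hY)
  rw [hL q X hX, hL r Y hY] at h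
  simp only [innerD_eq_superComm]
  exact h

end DerSpan

section Triality

variable {k A : Type*} [Field k] [AddCommGroup A] [Module k A] [Superspace k A]

theorem sigma_of_mem (β : A →ₗ[k] A →ₗ[k] k) {p q r : ZMod 2} {x y z : A} (hx : x ∈ part k A p)
    (hy : y ∈ part k A q) (hz : z ∈ part k A r) :
    sigma β x y z = sgn k (q * r) • β x z • y - sgn k (p * (q + r)) • β y z • x := by
  simp only [sigma, LinearMap.mk₂_apply, sum_two, proj_eq_ite _ hx, proj_eq_ite _ hy,
    LinearMap.add_apply, LinearMap.comp_apply, proj_eq_ite _ hz, LinearMap.sub_apply,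
    LinearMap.smul_apply, LinearMap.smulRight_apply]
  rcases parity_cases p with rfl | rfl <;> rcases parity_cases q with rfl | rfl <;>
    rcases parity_cases r with rfl | rfl <;> simp

theorem tElt_zero (m : A →ₗ[k] A →ₗ[k] A) (β : A →ₗ[k] A →ₗ[k] k) (x y : A) :
    tElt m β x y 0 = sigma β x y := rfl

theorem tElt_one (m : A →ₗ[k] A →ₗ[k] A) (β : A →ₗ[k] A →ₗ[k] k) (x y z : A) :
    tElt m β x y 1 z = ((2 : k)⁻¹ * β x y) • z - superFlip m x (m y z) := rfl

theorem tElt_two (m : A →ₗ[k] A →ₗ[k] A) (β : A →ₗ[k] A →ₗ[k] k) (x y z : A) :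
    tElt m β x y 2 z = ((2 : k)⁻¹ * β x y) • z - m x (superFlip m y z) := rfl

end Triality

section Theta

variable {k A : Type*} [Field k] [AddCommGroup A] [Module k A]

theorem theta_self (d : Fin 3 → Module.End k A) (i : Fin 3) : theta i d i = d 0 := by
  rw [theta, sub_self]

theorem theta_one (d : Fin 3 → Module.End k A) (i : Fin 3) : theta i d (i + 1) = d 1 := by
  rw [theta, add_sub_cancel_left]

theorem theta_two (d : Fin 3 → Module.End k A) (i : Fin 3) : theta i d (i + 2) = d 2 := by
  rw [theta, add_sub_cancel_left]

end Theta

section Inner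

set_option maxSynthPendingDepth 5

variable {k C : Type*} [Field k] [NonAssocRing C] [Module k C]
  [IsScalarTower k C C] [SMulCommClass k C C] [HurwitzSuperalgebra k C]

theorem innerD_eJ_eJ (h2 : (2 : k) ≠ 0) (i j : Fin 3) :
    innerD (eJ k i) (eJ k j : H3 k C) = 0 := by
  refine H3.linearMap_ext h2 (fun l => ?_) (fun l p x hx => ?_)
  · rw [innerD_apply_of_mem (eJ_mem i) (eJ_mem j), jmul_eJ_eJ h2, jmul_eJ_eJ h2]
    split_ifs with h h' h' <;> simp [jmul_eJ_eJ h2] <;> simp_all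
  · rw [innerD_apply_of_mem (eJ_mem i) (eJ_mem j), jmul_eJ_iotaJ, jmul_eJ_iotaJ]
    split_ifs with h h' h' <;> simp [jmul_eJ_iotaJ, h, h']

theorem innerD_iotaJ_eJ_self (h2 : (2 : k) ≠ 0) (i : Fin 3) {p : ZMod 2} {x : C}
    (hx : x ∈ part k C p) : innerD (iotaJ i x) (eJ k i : H3 k C) = 0 := by
  refine H3.linearMap_ext h2 (fun l => ?_) (fun l q z hz => ?_)
  · rw [innerD_apply_of_mem (iotaJ_mem hx i) (eJ_mem i), jmul_eJ_eJ h2, jmul_iotaJ_eJ]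
    split_ifs <;> simp_all [jmul_eJ_iotaJ, jmul_iotaJ_eJ]
  · rw [innerD_apply_of_mem (iotaJ_mem hx i) (eJ_mem i)]
    rcases fin3_cases i l with rfl | rfl | rfl
    · simp [jmul_eJ_iotaJ, jmul_iotaJ_self h2, jmul_eJ_eJ h2]
    · simp [jmul_eJ_iotaJ, jmul_iotaJ_succ h2]
    · simp only [jmul_eJ_iotaJ, map_smul, jmul_iotaJ_zero_two h2 i hx hz, mul_zero, sgn_zero,
        LinearMap.zero_apply, left_eq_add, one_ne_zero, if_false, Fin.reduceEq]
      module

theorem innerD_iotaJ_eJ_one (h2 : (2 : k) ≠ 0) (i : Fin 3) (x : C) :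
    innerD (iotaJ i x) (eJ k (i + 1) : H3 k C) = (2 : k)⁻¹ • DJ i x := by
  rw [DJ, smul_smul, inv_mul_cancel₀ h2, one_smul]

theorem jmul_sum_eJ (h2 : (2 : k) ≠ 0) : jmul (∑ i, eJ k i : H3 k C) = 1 := by
  refine H3.linearMap_ext h2 (fun l => ?_) (fun l q z hz => ?_)
  · simp [jmul_eJ_eJ h2]
  · rw [fin3_sum l, map_add, map_add, LinearMap.add_apply, LinearMap.add_apply]
    simp only [jmul_eJ_iotaJ, if_true, add_eq_left, one_ne_zero, if_false, Fin.reduceEq, zero_add,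
      ← add_smul]
    rw [show (2 : k)⁻¹ + 2⁻¹ = 1 by field_simp; norm_num, one_smul]
    rfl

theorem innerD_iotaJ_eJ_two (h2 : (2 : k) ≠ 0) (i : Fin 3) {p : ZMod 2} {x : C}
    (hx : x ∈ part k C p) :
    innerD (iotaJ i x) (eJ k (i + 2) : H3 k C) = -((2 : k)⁻¹ • DJ i x) := by
  have h : innerD (iotaJ i x) (∑ j, eJ k j : H3 k C) = 0 := by
    ext1 Z
    rw [innerD_apply_of_mem (q := 0) (iotaJ_mem hx i) (Submodule.sum_mem _ fun j _ => eJ_mem j),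
      jmul_sum_eJ h2]
    simp
  rw [fin3_sum i, map_add, map_add, innerD_iotaJ_eJ_self h2 i hx, innerD_iotaJ_eJ_one h2, zero_add]
    at h
  linear_combination (norm := module) h

theorem innerD_iotaJ_succ (h2 : (2 : k) ≠ 0) (i : Fin 3) {p q : ZMod 2} {x y : C}
    (hx : x ∈ part k C p) (hy : y ∈ part k C q) :
    innerD (iotaJ i x) (iotaJ (k := k) (i + 1) y) = DJ (i + 2) (paraMul k C x y) := by
  have hxy := paraMul_mem hx hy
  have D0 := DJ_eJ_self h2 hxy (i + 2)
  have D1 := DJ_eJ_one h2 hxy (i + 2)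
  have D2 := DJ_eJ_two h2 hxy (i + 2)
  have I0 := DJ_iotaJ_self h2 hxy (i + 2)
  have I1 := DJ_iotaJ_one h2 hxy (i + 2)
  have I2 : ∀ r, ∀ z ∈ part k C r, _ := fun r z hz => DJ_iotaJ_two h2 hxy (x := z) hz (i + 2)
  simp only [fin3_two_one, fin3_two_two] at D0 D1 D2 I0 I1 I2
  refine H3.linearMap_ext h2 (fun l => ?_) (fun l r z hz => ?_)
  · rw [innerD_apply_of_mem (iotaJ_mem hx i) (iotaJ_mem hy (i + 1))]
    rcases fin3_cases i l with rfl | rfl | rfl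
    · rw [D1]
      simp only [jmul_iotaJ_eJ, if_true, left_eq_add, one_ne_zero, if_false, map_smul, map_zero,
        jmul_iotaJ_succ h2, smul_zero, sub_zero]
    · rw [D2]
      simp only [jmul_iotaJ_eJ, if_true, add_eq_left, one_ne_zero, if_false, map_smul, map_zero,
        jmul_iotaJ_one_zero h2 i hy hx, zero_sub, smul_smul]
      rw [mul_left_comm, mul_comm q p, sgn_mul_self, mul_one]
    · rw [D0]
      simp only [jmul_iotaJ_eJ, add_right_inj, add_eq_left, Fin.reduceEq, if_false, map_smul,
        jmul_iotaJ_one_zero h2 i hy hx, jmul_iotaJ_succ h2]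
      rw [smul_comm (2 : k)⁻¹ (sgn k (q * p)), smul_smul, mul_comm q p, sgn_mul_self, one_smul,
        sub_self]
  · rw [innerD_apply_of_mem (iotaJ_mem hx i) (iotaJ_mem hy (i + 1))]
    have e : (2 : k) * (2 : k)⁻¹ = 1 := mul_inv_cancel₀ h2
    rcases fin3_cases i l with rfl | rfl | rfl
    · have key := congrArg (iotaJ (k := k) (i + 1)) (smul_paraMul_right_add (k := k) hy hx hz)
      rw [I1]
      simp only [jmul_iotaJ_one_zero h2 i hy hz, map_smul, jmul_iotaJ_self h2, map_add,
        jmul_iotaJ_zero_two h2 i hx (paraMul_mem hz hy), jmul_iotaJ_eJ, if_true, if_false,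
        add_right_inj, Fin.reduceEq, zero_add, smul_smul, mul_add, sgn_add] at key ⊢
      have h := sgn_mul_self (k := k) (q * p)
      rw [mul_comm p q, mul_right_comm 2, e, one_mul]
      linear_combination (norm := skip) sgn k (q * p) • key
      match_scalars
      · ring
      · ring
      · linear_combination -h
    · have key := congrArg (iotaJ (k := k) i) (smul_paraMul_left_add (k := k) hx hy hz)
      rw [I2 r z hz]
      simp only [jmul_iotaJ_self h2, jmul_iotaJ_succ h2, map_smul, map_add,
        jmul_iotaJ_one_two h2, jmul_iotaJ_eJ, if_true, fin3_one_one, fin3_one_two, add_mul,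
        sgn_add] at key ⊢
      rw [if_neg (by simp), add_zero, smul_smul, mul_right_comm 2, e, one_mul]
      linear_combination (norm := module) -key
    · rw [I0]
      simp only [jmul_iotaJ_one_two h2, jmul_iotaJ_zero_two h2 i hx hz, jmul_iotaJ_self h2, map_smul,
        fin3_one_one, fin3_one_two, b_paraMul_of_mem hx hy hz]
      have k1 := b_paraMul_of_mem (k := k) hy hz hx
      have k2 := b_supersymm (k := k) _ _ _ (paraMul_mem hy hz) _ hx
      have h : sgn k (p * q) * sgn k (p * r) * sgn k ((q + r) * p) = 1 := by
        rcases parity_cases p with rfl | rfl <;> rcases parity_cases q with rfl | rfl <;>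
          rcases parity_cases r with rfl | rfl <;> simp [one_add_one]
      rw [← k1, k2]
      match_scalars
      · ring
      · linear_combination -2 * (b x (paraMul k C y z) : k) * h
      · linear_combination -2 * (b x (paraMul k C y z) : k) * h

end Inner

section Brackets

set_option maxSynthPendingDepth 5

variable {k C : Type*} [Field k] [NonAssocRing C] [Module k C]
  [IsScalarTower k C C] [SMulCommClass k C C] [HurwitzSuperalgebra k C]

theorem superComm_DJ_eJ (h2 : (2 : k) ≠ 0) (i l : Fin 3) {p q : ZMod 2} {x y : C}
    (hx : x ∈ part k C p) (hy : y ∈ part k C q) :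
    superComm k (H3 k C) (DJ i x) (DJ i y) (eJ k l) = 0 := by
  have h := b_supersymm (k := k) _ _ _ hx _ hy
  have hs := sgn_mul_self (k := k) (p * q)
  rw [mul_comm p q] at h hs
  rw [superComm_apply_of_mem (DJ_mem_part hx i) (DJ_mem_part hy i)]
  rcases fin3_cases i l with rfl | rfl | rfl
  · rw [DJ_eJ_self h2 hx, DJ_eJ_self h2 hy]; simp
  · rw [DJ_eJ_one h2 hx, DJ_eJ_one h2 hy, map_smul, map_smul, DJ_iotaJ_self h2 hx,
      DJ_iotaJ_self h2 hy, h, mul_comm p q]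
    module
  · rw [DJ_eJ_two h2 hx, DJ_eJ_two h2 hy, map_neg, map_neg, map_smul, map_smul, DJ_iotaJ_self h2 hx,
      DJ_iotaJ_self h2 hy, h, mul_comm p q]
    module

theorem superComm_DJ_iotaJ_self (h2 : (2 : k) ≠ 0) (i : Fin 3) {p q : ZMod 2} {x y : C}
    (hx : x ∈ part k C p) (hy : y ∈ part k C q) (z : C) :
    superComm k (H3 k C) (DJ i x) (DJ i y) (iotaJ i z) =
      iotaJ i ((-(2 * b y z) : k) • x + (sgn k (p * q) * (2 * b x z)) • y) := by
  rw [superComm_apply_of_mem (DJ_mem_part hx i) (DJ_mem_part hy i), DJ_iotaJ_self h2 hx,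
    DJ_iotaJ_self h2 hy, map_smul, map_smul, map_sub, map_sub, DJ_eJ_one h2 hx, DJ_eJ_one h2 hy,
    DJ_eJ_two h2 hx, DJ_eJ_two h2 hy, map_add, map_smul, map_smul]
  match_scalars <;> field_simp <;> ring

theorem superComm_DJ_iotaJ_one (h2 : (2 : k) ≠ 0) (i : Fin 3) {p q r : ZMod 2} {x y z : C}
    (hx : x ∈ part k C p) (hy : y ∈ part k C q) (hz : z ∈ part k C r) :
    superComm k (H3 k C) (DJ i x) (DJ i y) (iotaJ (i + 1) z) =
      iotaJ (i + 1) (-(sgn k (p * q) * sgn k (p * r)) • paraMul k C (paraMul k C y z) x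
        + sgn k (q * r) • paraMul k C (paraMul k C x z) y) := by
  rw [superComm_apply_of_mem (DJ_mem_part hx i) (DJ_mem_part hy i), DJ_iotaJ_one h2 hx,
    DJ_iotaJ_one h2 hy, map_neg, map_neg, DJ_iotaJ_two h2 hx (paraMul_mem hy hz),
    DJ_iotaJ_two h2 hy (paraMul_mem hx hz), map_add, map_smul, map_smul, mul_add, mul_add, sgn_add,
    sgn_add, mul_comm q p]
  match_scalars
  · ring
  · linear_combination sgn k (q * r) * sgn_mul_self (k := k) (p * q)

theorem superComm_DJ_iotaJ_two (h2 : (2 : k) ≠ 0) (i : Fin 3) {p q r : ZMod 2} {x y z : C}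
    (hx : x ∈ part k C p) (hy : y ∈ part k C q) (hz : z ∈ part k C r) :
    superComm k (H3 k C) (DJ i x) (DJ i y) (iotaJ (i + 2) z) =
      iotaJ (i + 2) (-sgn k (q * r) • paraMul k C x (paraMul k C z y)
        + (sgn k (p * q) * sgn k (p * r)) • paraMul k C y (paraMul k C z x)) := by
  rw [superComm_apply_of_mem (DJ_mem_part hx i) (DJ_mem_part hy i), DJ_iotaJ_two h2 hx hz,
    DJ_iotaJ_two h2 hy hz, map_smul, map_smul, DJ_iotaJ_one h2 hx, DJ_iotaJ_one h2 hy,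
    map_add, map_smul, map_smul]
  module

theorem innerD_iotaJ_self (h2 : (2 : k) ≠ 0) (i : Fin 3) {p q : ZMod 2} {x y : C}
    (hx : x ∈ part k C p) (hy : y ∈ part k C q) :
    innerD (iotaJ i x) (iotaJ (k := k) i y) = -superComm k (H3 k C) (DJ i x) (DJ i y) := by
  refine H3.linearMap_ext h2 (fun l => ?_) (fun l r z hz => ?_)
  · rw [innerD_apply_of_mem (iotaJ_mem hx i) (iotaJ_mem hy i), LinearMap.neg_apply,
      superComm_DJ_eJ h2 i l hx hy, jmul_iotaJ_eJ, jmul_iotaJ_eJ]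
    split_ifs
    · simp
    · have h := b_supersymm (k := k) _ _ _ hx _ hy
      rw [map_smul, map_smul, jmul_iotaJ_self h2, jmul_iotaJ_self h2, h]
      module
  · rw [innerD_apply_of_mem (iotaJ_mem hx i) (iotaJ_mem hy i), LinearMap.neg_apply]
    rcases fin3_cases i l with rfl | rfl | rfl
    · rw [superComm_DJ_iotaJ_self h2 i hx hy, jmul_iotaJ_self h2, jmul_iotaJ_self h2, map_smul,
        map_smul, map_add, map_add]
      simp only [jmul_iotaJ_eJ, add_eq_left, one_ne_zero, if_false, Fin.reduceEq, map_add, map_smul]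
      match_scalars <;> field_simp <;> ring
    · rw [superComm_DJ_iotaJ_one h2 i hx hy hz, jmul_iotaJ_succ h2, jmul_iotaJ_succ h2,
        jmul_iotaJ_zero_two h2 i hx (paraMul_mem hy hz),
        jmul_iotaJ_zero_two h2 i hy (paraMul_mem hx hz), map_add, map_smul, map_smul, mul_add,
        mul_add, sgn_add, sgn_add, mul_comm q p]
      match_scalars
      · ring
      · linear_combination -sgn k (q * r) * sgn_mul_self (k := k) (p * q)
    · rw [superComm_DJ_iotaJ_two h2 i hx hy hz, jmul_iotaJ_zero_two h2 i hx hz,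
        jmul_iotaJ_zero_two h2 i hy hz, map_smul, map_smul, jmul_iotaJ_succ h2, jmul_iotaJ_succ h2,
        map_add, map_smul, map_smul]
      module

/-- `[Dᵢ(x), Dᵢ(y)]` is the derivation attached to `2 θⁱ(t_{x,y})`. -/
theorem superComm_DJ_self (h2 : (2 : k) ≠ 0) (i : Fin 3) {p q : ZMod 2} {x y : C}
    (hx : x ∈ part k C p) (hy : y ∈ part k C q) :
    superComm k (H3 k C) (DJ i x) (DJ i y) =
      DtriJ ((2 : k) • theta i (tElt (paraMul k C) (b : C →ₗ[k] C →ₗ[k] k) x y)) := by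
  refine H3.linearMap_ext h2 (fun l => ?_) (fun l r z hz => ?_)
  · rw [superComm_DJ_eJ h2 i l hx hy, DtriJ_eJ]
  · rw [DtriJ_iotaJ h2, Pi.smul_apply, LinearMap.smul_apply]
    rcases fin3_cases i l with rfl | rfl | rfl
    · rw [superComm_DJ_iotaJ_self h2 i hx hy, theta_self, tElt_zero, sigma_of_mem b hx hy hz]
      congr 1
      have e1 := sgn_mul_b_of_mem (k := k) (p := q) hx hz
      have e2 : sgn k (p * (q + r)) * (b y z : k) = b y z := by
        rw [mul_add, sgn_add, mul_assoc, ← sgn_mul_b_of_mem (k := k) (p := p) hy hz, ← mul_assoc,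
          sgn_mul_self, one_mul]
      rw [smul_smul, smul_smul, ← e1, e2, mul_comm q p]
      module
    · rw [superComm_DJ_iotaJ_one h2 i hx hy hz, theta_one, tElt_one,
        superFlip_of_mem _ hx (paraMul_mem hy hz)]
      have key := paraMul_right_add_smul (k := k) hx hy hz
      congr 1
      rw [mul_smul (2 : k)⁻¹, ← key, mul_add, sgn_add]
      match_scalars <;> field_simp
      ring
    · rw [superComm_DJ_iotaJ_two h2 i hx hy hz, theta_two, tElt_two,
        superFlip_of_mem _ hy hz]
      have key := paraMul_left_add (k := k) hx hz hy
      have e2 := sgn_mul_self (k := k) (r * q)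
      have key' := congrArg (fun w => sgn k (r * q) • w) key
      simp only [smul_add, smul_smul, ← mul_assoc, e2, one_mul, sgn_add] at key'
      congr 1
      rw [mul_smul (2 : k)⁻¹, ← key', map_smul, mul_comm q r]
      match_scalars <;> field_simp
      · ring
      · linear_combination -sgn k (p * q) * sgn k (p * r) * sgn_mul_self (k := k) (q * r)

theorem superComm_DtriJ_DJ (h2 : (2 : k) ≠ 0) (i : Fin 3) {p q : ZMod 2}
    {d : Fin 3 → Module.End k C} {x : C}
    (hd : d ∈ triPart (paraMul k C) (b : C →ₗ[k] C →ₗ[k] k) p) (hx : x ∈ part k C q) :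
    superComm k (H3 k C) (DtriJ d) (DJ i x) = DJ i (d i x) := by
  rw [DJ, map_smul, superComm_innerD (DtriJ_mem_derPart h2 hd) (iotaJ_mem hx i) (eJ_mem (i + 1)),
    DtriJ_iotaJ h2, DtriJ_eJ, map_zero, smul_zero, add_zero]
  rfl

theorem superComm_DJ_succ (h2 : (2 : k) ≠ 0) (i : Fin 3) {p q : ZMod 2} {x y : C}
    (hx : x ∈ part k C p) (hy : y ∈ part k C q) :
    superComm k (H3 k C) (DJ i x) (DJ (i + 1) y) = DJ (i + 2) (paraMul k C x y) := by
  rw [← innerD_iotaJ_succ h2 i hx hy, innerD_skew (iotaJ_mem hx _) (iotaJ_mem hy _), DJ, DJ,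
    fin3_one_one, ← DJ, map_smul,
    superComm_innerD (DJ_mem_derPart h2 hx i) (iotaJ_mem hy (i + 1)) (eJ_mem (i + 2)),
    DJ_iotaJ_one h2 hx, DJ_eJ_two h2 hx, map_neg, LinearMap.neg_apply,
    innerD_iotaJ_eJ_self h2 _ (paraMul_mem hx hy), map_neg, map_smul]
  match_scalars
  field_simp

theorem superComm_DtriJ (h2 : (2 : k) ≠ 0) {p q : ZMod 2} {d e : Fin 3 → Module.End k C}
    (hd : ∀ i, d i ∈ part k (Module.End k C) p) (he : ∀ i, e i ∈ part k (Module.End k C) q) :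
    superComm k (H3 k C) (DtriJ d) (DtriJ e) = DtriJ fun i => superComm k C (d i) (e i) := by
  refine H3.linearMap_ext h2 (fun l => ?_) (fun l r z hz => ?_)
  · rw [superComm_apply_of_mem (DtriJ_mem_part hd) (DtriJ_mem_part he)]
    simp [DtriJ_eJ]
  · rw [superComm_apply_of_mem (DtriJ_mem_part hd) (DtriJ_mem_part he)]
    simp only [DtriJ_iotaJ h2, superComm_apply_of_mem (hd l) (he l), map_sub, map_smul]

end Brackets

section InnerDer

set_option maxSynthPendingDepth 5

variable {k C : Type*} [Field k] [NonAssocRing C] [Module k C]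
  [IsScalarTower k C C] [SMulCommClass k C C] [HurwitzSuperalgebra k C]

/-- The homogeneous generators of `J`: the `eᵢ` and the `ιᵢ(x)` with `x` homogeneous. -/
def genJ (k C : Type*) [Field k] [NonAssocRing C] [Module k C]
    [IsScalarTower k C C] [SMulCommClass k C C] [HurwitzSuperalgebra k C] (p : ZMod 2) :
    Set (H3 k C) :=
  {X | (p = 0 ∧ ∃ i, X = eJ k i) ∨ ∃ i, ∃ x ∈ part k C p, X = iotaJ i x}

theorem genJ_subset (p : ZMod 2) : genJ k C p ⊆ part k (H3 k C) p := by
  rintro _ (⟨rfl, i, rfl⟩ | ⟨i, x, hx, rfl⟩)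
  · exact eJ_mem i
  · exact iotaJ_mem hx i

theorem span_genJ (h2 : (2 : k) ≠ 0) (p : ZMod 2) :
    Submodule.span k (genJ k C p) = part k (H3 k C) p := by
  refine le_antisymm (Submodule.span_le.2 (genJ_subset p)) fun X hX => ?_
  rw [H3.eq_sum h2 X]
  refine Submodule.sum_mem _ fun i _ => add_mem ?_ (Submodule.smul_mem _ _
    (Submodule.subset_span (Or.inr ⟨i, _, coordJ_mem hX i, rfl⟩)))
  rcases parity_cases p with rfl | rfl
  · exact Submodule.smul_mem _ _ (Submodule.subset_span (Or.inl ⟨rfl, i, rfl⟩))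
  · rw [diagJ_apply, b_one_odd (mem_part_matrix.1 (H3.mem_part.1 hX) i i)]
    simp

theorem innerD_mem_derPart_of_genJ (h2 : (2 : k) ≠ 0) {p q : ZMod 2} {X Y : H3 k C}
    (hX : X ∈ genJ k C p) (hY : Y ∈ genJ k C q) : innerD X Y ∈ derPart k C (p + q) := by
  have hie : ∀ (p : ZMod 2) (i j : Fin 3), ∀ x ∈ part k C p,
      innerD (iotaJ i x) (eJ k j : H3 k C) ∈ derPart k C p := by
    intro p i j x hx
    rcases fin3_cases i j with rfl | rfl | rfl
    · rw [innerD_iotaJ_eJ_self h2 _ hx]; exact zero_mem _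
    · rw [innerD_iotaJ_eJ_one h2]; exact Submodule.smul_mem _ _ (DJ_mem_derPart h2 hx i)
    · rw [innerD_iotaJ_eJ_two h2 _ hx]
      exact neg_mem (Submodule.smul_mem _ _ (DJ_mem_derPart h2 hx i))
  rcases hX with ⟨rfl, i, rfl⟩ | ⟨i, x, hx, rfl⟩ <;> rcases hY with ⟨rfl, j, rfl⟩ | ⟨j, y, hy, rfl⟩
  · rw [innerD_eJ_eJ h2]; exact zero_mem _
  · rw [innerD_skew (eJ_mem i) (iotaJ_mem hy j), zero_add]
    exact neg_mem (Submodule.smul_mem _ _ (hie q j i y hy))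
  · rw [add_zero]; exact hie p i j x hx
  · rcases fin3_cases i j with rfl | rfl | rfl
    · rw [innerD_iotaJ_self h2 _ hx hy]
      exact neg_mem (superComm_mem_derPart (DJ_mem_derPart h2 hx i) (DJ_mem_derPart h2 hy i))
    · rw [innerD_iotaJ_succ h2 _ hx hy]
      exact DJ_mem_derPart h2 (paraMul_mem hx hy) _
    · rw [innerD_skew (iotaJ_mem hx _) (iotaJ_mem hy _), add_comm p q]
      have h := innerD_iotaJ_succ h2 (i + 2) hy hx
      rw [fin3_two_one] at h
      rw [h]
      exact neg_mem (Submodule.smul_mem _ _ (DJ_mem_derPart h2 (paraMul_mem hy hx) _))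

theorem innerD_mem_derPart (h2 : (2 : k) ≠ 0) {p q : ZMod 2} {X Y : H3 k C}
    (hX : X ∈ part k (H3 k C) p) (hY : Y ∈ part k (H3 k C) q) :
    innerD X Y ∈ derPart k C (p + q) := by
  rw [← span_genJ h2] at hX hY
  induction hX, hY using Submodule.span_induction₂ with
  | mem_mem x y hx hy => exact innerD_mem_derPart_of_genJ h2 hx hy
  | zero_left => simp
  | zero_right => simp
  | add_left x y z _ _ _ h h' => rw [map_add, LinearMap.add_apply]; exact add_mem h h'
  | add_right x y z _ _ _ h h' => rw [map_add]; exact add_mem h h'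
  | smul_left c x y _ _ h =>
    rw [map_smul, LinearMap.smul_apply]; exact Submodule.smul_mem _ c h
  | smul_right c x y _ _ h => rw [map_smul]; exact Submodule.smul_mem _ c h

theorem theta_tElt_mem_triPart [Nontrivial C] (h2 : (2 : k) ≠ 0) (i : Fin 3) {p q : ZMod 2}
    {x y : C} (hx : x ∈ part k C p) (hy : y ∈ part k C q) :
    theta i (tElt (paraMul k C) b x y) ∈
      triPart (paraMul k C) (b : C →ₗ[k] C →ₗ[k] k) (p + q) := by
  have hd := superComm_mem_derPart (DJ_mem_derPart h2 hx i) (DJ_mem_derPart (k := k) h2 hy i)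
  have h := compJ_mem_triPart h2 hd fun l => superComm_DJ_eJ h2 i l hx hy
  rw [superComm_DJ_self h2 i hx hy] at h
  simp only [compJ_DtriJ h2] at h
  have h' := Submodule.smul_mem _ (2 : k)⁻¹ h
  have e : (2 : k)⁻¹ • (fun j => ((2 : k) • theta i (tElt (paraMul k C) b x y)) j) =
      theta i (tElt (paraMul k C) b x y) := by
    ext1 j
    rw [Pi.smul_apply, Pi.smul_apply, smul_smul, inv_mul_cancel₀ h2, one_smul]
  rwa [e] at h'

/-- The identity `d_{X,YZ} = d_{XY,Z} - (-1)^{XY} d_{Y,XZ}`, for `X, Y` of parities `p, q`. -/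
def InnerCyclic (p q : ZMod 2) (X Y Z : H3 k C) : Prop :=
  innerD X (jmul Y Z) = innerD (jmul X Y) Z - sgn k (p * q) • innerD Y (jmul X Z)

section Cyclic

variable {p q r : ZMod 2} {X Y Z : H3 k C}

theorem InnerCyclic.swap_left (hX : X ∈ part k (H3 k C) p) (hY : Y ∈ part k (H3 k C) q)
    (h : InnerCyclic p q X Y Z) : InnerCyclic q p Y X Z := by
  unfold InnerCyclic at h ⊢
  have e := sgn_mul_self (k := k) (p * q)
  rw [jmul_comm hY hX, h, mul_comm q p, map_smul, LinearMap.smul_apply, smul_sub, smul_smul, e]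
  module

theorem InnerCyclic.swap_right (hX : X ∈ part k (H3 k C) p) (hY : Y ∈ part k (H3 k C) q)
    (hZ : Z ∈ part k (H3 k C) r) (h : InnerCyclic p q X Y Z) : InnerCyclic p r X Z Y := by
  unfold InnerCyclic at h ⊢
  rw [jmul_comm hZ hY, map_smul, h, innerD_skew (jmul_mem hX hY) hZ,
    innerD_skew hY (jmul_mem hX hZ)]
  rcases parity_cases p with rfl | rfl <;> rcases parity_cases q with rfl | rfl <;>
    rcases parity_cases r with rfl | rfl <;> simp [one_add_one] <;> abel

end Cyclic

theorem innerCyclic_e_e_iota (h2 : (2 : k) ≠ 0) (i j l : Fin 3) {r : ZMod 2} {x : C}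
    (hx : x ∈ part k C r) : InnerCyclic 0 0 (eJ k i) (eJ k j) (iotaJ (k := k) l x) := by
  have h1 := innerD_iotaJ_eJ_one (k := k) h2 l x
  have h0 := innerD_iotaJ_eJ_self h2 l hx
  have h3 := innerD_iotaJ_eJ_two h2 l hx
  unfold InnerCyclic
  rw [jmul_eJ_eJ h2, jmul_eJ_iotaJ, jmul_eJ_iotaJ]
  rcases fin3_cases l i with rfl | rfl | rfl <;> rcases fin3_cases l j with rfl | rfl | rfl <;>
    simp only [add_right_inj, Fin.reduceEq, if_false, if_true, left_eq_add, add_eq_left,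
      one_ne_zero, map_smul, map_zero, LinearMap.zero_apply, innerD_skew (eJ_mem _) (iotaJ_mem hx l),
      h0, h1, h3, mul_zero, zero_mul, sgn_zero] <;>
    (try module) <;> match_scalars <;> field_simp <;> norm_num

theorem innerCyclic_e_iota_self (h2 : (2 : k) ≠ 0) (i l : Fin 3) (q : ZMod 2) (x y : C) :
    InnerCyclic 0 q (eJ k i) (iotaJ (k := k) l x) (iotaJ l y) := by
  unfold InnerCyclic
  rw [jmul_iotaJ_self h2, jmul_eJ_iotaJ, jmul_eJ_iotaJ, map_smul, map_add, innerD_eJ_eJ h2,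
    innerD_eJ_eJ h2]
  split_ifs <;> simp

theorem innerCyclic_e_iota_succ (h2 : (2 : k) ≠ 0) (i l : Fin 3) {q r : ZMod 2} {x y : C}
    (hx : x ∈ part k C q) (hy : y ∈ part k C r) :
    InnerCyclic 0 q (eJ k i) (iotaJ (k := k) l x) (iotaJ (l + 1) y) := by
  have hxy := paraMul_mem hx hy
  have h0 := innerD_iotaJ_eJ_self h2 (l + 2) hxy
  have h1 := innerD_iotaJ_eJ_one (k := k) h2 (l + 2) (paraMul k C x y)
  have h3 := innerD_iotaJ_eJ_two h2 (l + 2) hxy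
  rw [fin3_two_one] at h1
  rw [fin3_two_two] at h3
  unfold InnerCyclic
  rw [jmul_iotaJ_succ h2, jmul_eJ_iotaJ, jmul_eJ_iotaJ, innerD_skew (eJ_mem _) (iotaJ_mem hxy _)]
  rcases fin3_cases l i with rfl | rfl | rfl <;>
    simp only [add_right_inj, Fin.reduceEq, if_false, if_true, left_eq_add, add_eq_left,
      one_ne_zero, map_smul, map_zero, LinearMap.zero_apply, LinearMap.smul_apply,
      h0, h1, h3, innerD_iotaJ_succ h2 l hx hy, zero_mul, sgn_zero] <;>
    module

theorem innerCyclic_iota_self_self (h2 : (2 : k) ≠ 0) (i : Fin 3) {p q r : ZMod 2} {x y z : C}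
    (hx : x ∈ part k C p) (hy : y ∈ part k C q) (hz : z ∈ part k C r) :
    InnerCyclic p q (iotaJ (k := k) i x) (iotaJ i y) (iotaJ i z) := by
  have h : ∀ s, ∀ w ∈ part k C s,
      innerD (iotaJ (k := k) i w) (eJ k (i + 1) + eJ k (i + 2)) = 0 := by
    intro s w hw
    rw [map_add, innerD_iotaJ_eJ_one h2, innerD_iotaJ_eJ_two h2 i hw]
    module
  have he : (eJ k (i + 1) + eJ k (i + 2) : H3 k C) ∈ part k (H3 k C) 0 :=
    add_mem (eJ_mem _) (eJ_mem _)
  unfold InnerCyclic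
  rw [jmul_iotaJ_self h2, jmul_iotaJ_self h2, jmul_iotaJ_self h2, map_smul, map_smul, map_smul,
    LinearMap.smul_apply, h p x hx, h q y hy, innerD_skew he (iotaJ_mem hz i), h r z hz]
  simp

theorem innerCyclic_iota_self_succ (h2 : (2 : k) ≠ 0) (i : Fin 3) {p q r : ZMod 2} {x y z : C}
    (hx : x ∈ part k C p) (hy : y ∈ part k C q) (hz : z ∈ part k C r) :
    InnerCyclic p q (iotaJ (k := k) i x) (iotaJ i y) (iotaJ (i + 1) z) := by
  have h : ∀ s s', ∀ u ∈ part k C s, ∀ w ∈ part k C s', innerD (iotaJ (k := k) i u) (iotaJ (i + 2) w)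
      = -(sgn k (s * s') • DJlin k (i + 1) (paraMul k C w u)) := by
    intro s s' u hu w hw
    have := innerD_iotaJ_succ h2 (i + 2) hw hu
    rw [fin3_two_one, fin3_two_two] at this
    rw [innerD_skew (iotaJ_mem hu _) (iotaJ_mem hw _), this]
    rfl
  have h0 := innerD_iotaJ_eJ_self h2 (i + 1) hz
  have h1 := innerD_iotaJ_eJ_one (k := k) h2 (i + 1) z
  rw [fin3_one_one, ← DJlin_apply] at h1
  have key := congrArg (DJlin k (i + 1)) (paraMul_right_add_smul (k := k) hx hy hz)
  have e := sgn_mul_self (k := k) (p * q)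
  unfold InnerCyclic
  rw [jmul_iotaJ_self h2, jmul_iotaJ_succ h2, jmul_iotaJ_succ h2, map_smul, LinearMap.smul_apply,
    h _ _ x hx _ (paraMul_mem hy hz), h _ _ y hy _ (paraMul_mem hx hz), map_add,
    LinearMap.add_apply, innerD_skew (eJ_mem _) (iotaJ_mem hz _), h0,
    innerD_skew (eJ_mem _) (iotaJ_mem hz _), h1]
  simp only [map_add, map_smul, mul_add, sgn_add, zero_mul, sgn_zero, mul_comm q p] at key ⊢
  linear_combination (norm := skip) -key
  match_scalars
  · ring
  · linear_combination -sgn k (q * r) * e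
  · field_simp; ring

theorem innerCyclic_iota_self_two (h2 : (2 : k) ≠ 0) (i : Fin 3) {p q r : ZMod 2} {x y z : C}
    (hx : x ∈ part k C p) (hy : y ∈ part k C q) (hz : z ∈ part k C r) :
    InnerCyclic p q (iotaJ (k := k) i x) (iotaJ i y) (iotaJ (i + 2) z) := by
  have h : ∀ s s', ∀ u ∈ part k C s, ∀ w ∈ part k C s', innerD (iotaJ (k := k) i u) (iotaJ (i + 1) w)
      = DJlin k (i + 2) (paraMul k C u w) := fun s s' u hu w hw => innerD_iotaJ_succ h2 i hu hw
  have h0 := innerD_iotaJ_eJ_self h2 (i + 2) hz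
  have h1 := innerD_iotaJ_eJ_two (k := k) h2 (i + 2) hz
  rw [fin3_two_two, ← DJlin_apply] at h1
  have key := congrArg (DJlin k (i + 2)) (paraMul_left_add (k := k) hx hz hy)
  have e := sgn_mul_self (k := k) (r * q)
  unfold InnerCyclic
  rw [jmul_iotaJ_self h2, jmul_iotaJ_zero_two h2 i hx hz, jmul_iotaJ_zero_two h2 i hy hz, map_smul,
    map_smul, map_smul, LinearMap.smul_apply,
    h _ _ x hx _ (paraMul_mem hz hy), h _ _ y hy _ (paraMul_mem hz hx), map_add,
    LinearMap.add_apply, innerD_skew (eJ_mem _) (iotaJ_mem hz _), h1,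
    innerD_skew (eJ_mem _) (iotaJ_mem hz _), h0]
  simp only [map_add, map_smul, zero_mul, sgn_zero, sgn_add, mul_comm q r] at key ⊢
  linear_combination (norm := skip) sgn k (r * q) • key
  match_scalars
  · ring
  · field_simp
    linear_combination (b x y : k) * e
  · linear_combination -(sgn k (p * q) * sgn k (p * r)) * e

theorem innerCyclic_iota_one_two (h2 : (2 : k) ≠ 0) (i : Fin 3) {p q r : ZMod 2} {x y z : C}
    (hx : x ∈ part k C p) (hy : y ∈ part k C q) (hz : z ∈ part k C r) :
    InnerCyclic p q (iotaJ (k := k) i x) (iotaJ (i + 1) y) (iotaJ (i + 2) z) := by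
  have h := innerD_iotaJ_succ h2 (i + 1) hy hz
  rw [fin3_one_one, fin3_one_two] at h
  have h' := superComm_innerD (DJ_mem_derPart h2 hx i) (iotaJ_mem hy (i + 1)) (iotaJ_mem hz (i + 2))
  rw [h, DJ_iotaJ_one h2 hx, DJ_iotaJ_two h2 hx hz, map_neg, LinearMap.neg_apply, map_smul] at h'
  unfold InnerCyclic
  rw [jmul_iotaJ_one_two h2, jmul_iotaJ_succ h2, jmul_iotaJ_zero_two h2 i hx hz,
    innerD_iotaJ_self h2 i hx (paraMul_mem hy hz), h', map_smul]
  module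

theorem innerCyclic_of_genJ (h2 : (2 : k) ≠ 0) {p q r : ZMod 2} {X Y Z : H3 k C}
    (hX : X ∈ genJ k C p) (hY : Y ∈ genJ k C q) (hZ : Z ∈ genJ k C r) : InnerCyclic p q X Y Z := by
  have hX' := genJ_subset p hX
  have hY' := genJ_subset q hY
  have hZ' := genJ_subset r hZ
  have eii : ∀ (q r : ZMod 2) (i l m : Fin 3), ∀ y ∈ part k C q, ∀ z ∈ part k C r,
      InnerCyclic 0 q (eJ k i) (iotaJ (k := k) l y) (iotaJ m z) := by
    intro q r i l m y hy z hz
    rcases fin3_cases l m with rfl | rfl | rfl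
    · exact innerCyclic_e_iota_self h2 _ _ _ _ _
    · exact innerCyclic_e_iota_succ h2 _ _ hy hz
    · have h := innerCyclic_e_iota_succ h2 i (l + 2) hz hy
      rw [fin3_two_one] at h
      exact h.swap_right (eJ_mem _) (iotaJ_mem hz _) (iotaJ_mem hy _)
  rcases hX with ⟨rfl, i, rfl⟩ | ⟨i, x, hx, rfl⟩ <;>
    rcases hY with ⟨rfl, j, rfl⟩ | ⟨j, y, hy, rfl⟩ <;>
    rcases hZ with ⟨rfl, l, rfl⟩ | ⟨l, z, hz, rfl⟩
  · unfold InnerCyclic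
    simp only [jmul_eJ_eJ h2]
    split_ifs <;> simp [innerD_eJ_eJ h2]
  · exact innerCyclic_e_e_iota h2 _ _ _ hz
  · exact (innerCyclic_e_e_iota h2 _ _ _ hy).swap_right hX' hZ' hY'
  · exact eii _ _ _ _ _ _ hy _ hz
  · exact ((innerCyclic_e_e_iota h2 _ _ _ hx).swap_right hY' hZ' hX').swap_left hY' hX'
  · exact (eii _ _ _ _ _ _ hx _ hz).swap_left hY' hX'
  · exact ((eii _ _ _ _ _ _ hx _ hy).swap_left hZ' hX').swap_right hX' hZ' hY'
  · rcases fin3_cases i j with rfl | rfl | rfl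
    · rcases fin3_cases i l with rfl | rfl | rfl
      · exact innerCyclic_iota_self_self h2 _ hx hy hz
      · exact innerCyclic_iota_self_succ h2 _ hx hy hz
      · exact innerCyclic_iota_self_two h2 _ hx hy hz
    · rcases fin3_cases i l with rfl | rfl | rfl
      · exact (innerCyclic_iota_self_succ h2 _ hx hz hy).swap_right hX' hZ' hY'
      · have h := innerCyclic_iota_self_two h2 (i + 1) hy hz hx
        rw [fin3_one_two] at h
        exact (h.swap_right hY' hZ' hX').swap_left hY' hX'
      · exact innerCyclic_iota_one_two h2 _ hx hy hz
    · rcases fin3_cases i l with rfl | rfl | rfl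
      · exact (innerCyclic_iota_self_two h2 _ hx hz hy).swap_right hX' hZ' hY'
      · exact (innerCyclic_iota_one_two h2 _ hx hz hy).swap_right hX' hZ' hY'
      · have h := innerCyclic_iota_self_succ h2 (i + 2) hy hz hx
        rw [fin3_two_one] at h
        exact (h.swap_right hY' hZ' hX').swap_left hY' hX'

theorem innerD_cyclic (h2 : (2 : k) ≠ 0) {p q r : ZMod 2} {X Y Z : H3 k C}
    (hX : X ∈ part k (H3 k C) p) (hY : Y ∈ part k (H3 k C) q) (hZ : Z ∈ part k (H3 k C) r) :
    innerD X (jmul Y Z) = innerD (jmul X Y) Z - sgn k (p * q) • innerD Y (jmul X Z) := by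
  rw [← span_genJ h2] at hX hY hZ
  suffices h : InnerCyclic p q X Y Z by
    rw [InnerCyclic] at h
    convert h using 1
  induction hZ using Submodule.span_induction with
  | mem Z hZ =>
    induction hX, hY using Submodule.span_induction₂ with
    | mem_mem x y hx hy => exact innerCyclic_of_genJ h2 hx hy hZ
    | zero_left => simp [InnerCyclic]
    | zero_right => simp [InnerCyclic]
    | add_left x y z _ _ _ h h' =>
      simp only [InnerCyclic, map_add, LinearMap.add_apply] at h h' ⊢; rw [h, h']; module
    | add_right x y z _ _ _ h h' =>
      simp only [InnerCyclic, map_add, LinearMap.add_apply] at h h' ⊢; rw [h, h']; module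
    | smul_left c x y _ _ h =>
      simp only [InnerCyclic, map_smul, LinearMap.smul_apply] at h ⊢; rw [h]; module
    | smul_right c x y _ _ h =>
      simp only [InnerCyclic, map_smul, LinearMap.smul_apply] at h ⊢; rw [h]; module
  | zero => simp [InnerCyclic]
  | add x y _ _ h h' => simp only [InnerCyclic, map_add] at h h' ⊢; rw [h, h']; module
  | smul c x _ h => simp only [InnerCyclic, map_smul] at h ⊢; rw [h]; module

end InnerDer

namespace IsQuaternionAlgebra

variable {k Q : Type*} [Field k] [NonAssocRing Q] [Module k Q] [IsScalarTower k Q Q]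
  [SMulCommClass k Q Q] [HurwitzSuperalgebra k Q]

theorem even (hQ : IsQuaternionAlgebra k Q) (x : Q) : x ∈ part k Q 0 := by
  refine mem_part_of_proj_eq_zero ?_
  have h := proj_mem_part (k := k) (0 + 1) x
  rw [zero_add, hQ.odd_eq_bot] at h
  rw [zero_add]
  exact (Submodule.mem_bot k).1 h

theorem b_comm (hQ : IsQuaternionAlgebra k Q) (x y : Q) : (b x y : k) = b y x := by
  rw [b_supersymm 0 0 x (hQ.even x) y (hQ.even y)]; simp

theorem conj_mul' (hQ : IsQuaternionAlgebra k Q) (x y : Q) :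
    conj k Q (x * y) = conj k Q y * conj k Q x := by
  rw [conj_mul_of_mem (hQ.even x) (hQ.even y)]; simp

theorem b_left_adjoint (hQ : IsQuaternionAlgebra k Q) (x y z : Q) :
    (b (x * y) z : k) = b y (conj k Q x * z) := by
  rw [b_mul_left_adjoint (hQ.even x) (hQ.even y) (hQ.even z)]; simp

theorem b_right_adjoint (hQ : IsQuaternionAlgebra k Q) (x y z : Q) :
    (b (x * y) z : k) = b x (z * conj k Q y) := by
  rw [b_mul_right_adjoint (hQ.even x) (hQ.even y) (hQ.even z)]; simp

theorem conj_mul_mul (hQ : IsQuaternionAlgebra k Q) (x z y : Q) :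
    conj k Q x * (z * y) + conj k Q z * (x * y) = (b x z : k) • y := by
  have h := conj_mul_mul_add (k := k) (hQ.even x) (hQ.even y) (hQ.even z)
  simpa using h

theorem mul_mul_conj (hQ : IsQuaternionAlgebra k Q) (x z y : Q) :
    y * z * conj k Q x + y * x * conj k Q z = (b x z : k) • y := by
  have h := congrArg (conj k Q) (hQ.conj_mul_mul (conj k Q x) (conj k Q z) (conj k Q y))
  simpa [hQ.conj_mul', conj_conj, b_conj_conj] using h

theorem mul_add_mul' (hQ : IsQuaternionAlgebra k Q) (x y : Q) :
    x * y + y * x = (b y (1 : Q) : k) • x + (b x (1 : Q) : k) • y - (b x y : k) • (1 : Q) := by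
  have h := mul_add_mul (k := k) 0 0 (hQ.even x) (hQ.even y)
  simpa using h

theorem associator_swap_left (hQ : IsQuaternionAlgebra k Q) (x z y : Q) :
    associator x z y = -associator z x y := by
  have h := hQ.conj_mul_mul x z y
  have h' := congrArg (· * y) (hQ.mul_add_mul' x z)
  simp only [associator_apply, conj_apply, sub_mul, add_mul, smul_mul_assoc, one_mul] at h h' ⊢
  linear_combination (norm := module) h' + h

theorem associator_swap_right (hQ : IsQuaternionAlgebra k Q) (x z y : Q) :
    associator x z y = -associator x y z := by
  have h := hQ.mul_mul_conj y z x
  have h' := congrArg (x * ·) (hQ.mul_add_mul' y z)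
  simp only [associator_apply, conj_apply, mul_sub, mul_add, mul_smul_comm, mul_one] at h h' ⊢
  linear_combination (norm := module) -h' - h

theorem associator_self_left (h2 : (2 : k) ≠ 0) (hQ : IsQuaternionAlgebra k Q) (x y : Q) :
    associator x x y = 0 := by
  have h : (2 : k) • associator x x y = 0 := by
    rw [two_smul]; exact add_eq_zero_iff_eq_neg.2 (hQ.associator_swap_left x x y)
  exact (smul_eq_zero.1 h).resolve_left h2

theorem associator_self_right (h2 : (2 : k) ≠ 0) (hQ : IsQuaternionAlgebra k Q) (x y : Q) :
    associator x y y = 0 := by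
  have h : (2 : k) • associator x y y = 0 := by
    rw [two_smul]; exact add_eq_zero_iff_eq_neg.2 (hQ.associator_swap_right x y y)
  exact (smul_eq_zero.1 h).resolve_left h2

theorem b_associator_one (hQ : IsQuaternionAlgebra k Q) (x y z : Q) :
    (b (associator x y z) (1 : Q) : k) = 0 := by
  rw [associator_apply, map_sub, LinearMap.sub_apply, hQ.b_right_adjoint (x * y),
    hQ.b_left_adjoint x (y * z), hQ.b_right_adjoint y z, hQ.b_left_adjoint x y, one_mul, mul_one,
    sub_self]

theorem b_associator_left (h2 : (2 : k) ≠ 0) (hQ : IsQuaternionAlgebra k Q) (x y z : Q) :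
    (b (associator x y z) x : k) = 0 := by
  have h : ∀ w, conj k Q x * (x * w) = ((2 : k)⁻¹ * b x x) • w := by
    intro w
    have := hQ.conj_mul_mul x x w
    rw [← two_smul k] at this
    rw [mul_smul, ← this, smul_smul, inv_mul_cancel₀ h2, one_smul]
  have h1 : conj k Q x * x = ((2 : k)⁻¹ * b x x) • 1 := by simpa using h 1
  rw [associator_apply, map_sub, LinearMap.sub_apply, hQ.b_right_adjoint (x * y),
    hQ.b_left_adjoint x (y * z), hQ.b_left_adjoint x y, h, h1, map_smul, map_smul,
    hQ.b_right_adjoint y z, one_mul, sub_self]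

theorem assoc (h2 : (2 : k) ≠ 0) (hQ : IsQuaternionAlgebra k Q) (x y z : Q) :
    x * y * z = x * (y * z) := by
  rw [← sub_eq_zero, ← associator_apply]
  have hx := hQ.b_associator_left h2 x y z
  have hy : (b (associator x y z) y : k) = 0 := by
    rw [hQ.associator_swap_left, map_neg, LinearMap.neg_apply, hQ.b_associator_left h2, neg_zero]
  have hz : (b (associator x y z) z : k) = 0 := by
    rw [hQ.associator_swap_right, hQ.associator_swap_left, neg_neg, hQ.b_associator_left h2]
  have h1 := hQ.b_associator_one x y z
  have : FiniteDimensional k Q := FiniteDimensional.of_finrank_pos (by simp [hQ.finrank_eq])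
  by_cases hli : LinearIndependent k ![1, x, y, z]
  · have hs := hli.span_eq_top_of_card_eq_finrank' (by simp [hQ.finrank_eq])
    refine (b_nondegenerate (k := k) (C := Q)).1 _ fun t => ?_
    have ht : t ∈ Submodule.span k (Set.range ![1, x, y, z]) := hs ▸ Submodule.mem_top
    induction ht using Submodule.span_induction with
    | mem t ht =>
      obtain ⟨i, rfl⟩ := ht
      fin_cases i <;> assumption
    | zero => simp
    | add u v _ _ hu hv => rw [map_add, hu, hv, add_zero]
    | smul c u _ hu => rw [map_smul, hu, smul_zero]
  · rw [Fintype.linearIndependent_iff] at hli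
    push Not at hli
    obtain ⟨g, hg, i, hi⟩ := hli
    by_contra hne
    rw [Fin.sum_univ_four] at hg
    simp only [Matrix.cons_val] at hg
    have hl : ∀ u v w : Q, associator (g 0 • 1 + g 1 • u + g 2 • v + g 3 • w) y z =
        g 1 • associator u y z + g 2 • associator v y z + g 3 • associator w y z := by
      intro u v w
      simp only [associator_apply, add_mul, smul_mul_assoc, one_mul]
      module
    have hm : ∀ u v w : Q, associator x (g 0 • 1 + g 1 • u + g 2 • v + g 3 • w) z =
        g 1 • associator x u z + g 2 • associator x v z + g 3 • associator x w z := by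
      intro u v w
      simp only [associator_apply, add_mul, mul_add, smul_mul_assoc, mul_smul_comm, one_mul, mul_one]
      module
    have hr : ∀ u v w : Q, associator x y (g 0 • 1 + g 1 • u + g 2 • v + g 3 • w) =
        g 1 • associator x y u + g 2 • associator x y v + g 3 • associator x y w := by
      intro u v w
      simp only [associator_apply, mul_add, mul_smul_comm, mul_one]
      module
    have houter : ∀ u v : Q, associator u v u = 0 := fun u v => by
      rw [hQ.associator_swap_left, hQ.associator_self_right h2, neg_zero]
    have h0 : ∀ u v : Q, associator 0 u v = 0 ∧ associator u 0 v = 0 ∧ associator u v 0 = 0 := by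
      intro u v; simp [associator_apply]
    have g1 : g 1 = 0 := by
      have h := hl x y z
      rw [hg, (h0 _ _).1, hQ.associator_self_left h2, houter, smul_zero, smul_zero, add_zero,
        add_zero] at h
      exact (smul_eq_zero.1 h.symm).resolve_right hne
    have g2 : g 2 = 0 := by
      have h := hm x y z
      rw [hg, (h0 _ _).2.1, hQ.associator_self_left h2, hQ.associator_self_right h2, smul_zero,
        smul_zero, zero_add, add_zero] at h
      exact (smul_eq_zero.1 h.symm).resolve_right hne
    have g3 : g 3 = 0 := by
      have h := hr x y z
      rw [hg, (h0 _ _).2.2, hQ.associator_self_right h2, houter, smul_zero, smul_zero, zero_add,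
        zero_add] at h
      exact (smul_eq_zero.1 h.symm).resolve_right hne
    rw [g1, g2, g3, zero_smul, zero_smul, zero_smul, add_zero, add_zero, add_zero] at hg
    have g0 : g 0 = 0 := by
      refine (smul_eq_zero.1 hg).resolve_right fun h => hne ?_
      rw [← one_mul (associator x y z), h, zero_mul]
    refine hi ?_
    fin_cases i <;> assumption

/-! ### Commutators of trace zero elements -/

theorem mem_traceZero {a : Q} : a ∈ traceZero k Q ↔ (b a (1 : Q) : k) = 0 := Iff.rfl

theorem conj_of_mem_traceZero {a : Q} (ha : a ∈ traceZero k Q) : conj k Q a = -a := by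
  rw [conj_apply, mem_traceZero.1 ha, zero_smul, zero_sub]

theorem mul_add_mul_of_traceZero (hQ : IsQuaternionAlgebra k Q) {a c : Q}
    (ha : a ∈ traceZero k Q) (hc : c ∈ traceZero k Q) : a * c + c * a = -((b a c : k) • 1) := by
  rw [hQ.mul_add_mul', mem_traceZero.1 ha, mem_traceZero.1 hc]; simp

theorem commutator_mem_traceZero (hQ : IsQuaternionAlgebra k Q) (x y : Q) :
    x * y - y * x ∈ traceZero k Q := by
  rw [mem_traceZero, map_sub, LinearMap.sub_apply, hQ.b_left_adjoint x y, hQ.b_right_adjoint y x,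
    one_mul, mul_one, sub_self]

theorem commutator_commutator (h2 : (2 : k) ≠ 0) (hQ : IsQuaternionAlgebra k Q) {a c e : Q}
    (ha : a ∈ traceZero k Q) (hc : c ∈ traceZero k Q) (he : e ∈ traceZero k Q) :
    (a * c - c * a) * e - e * (a * c - c * a) =
      (2 * b a e : k) • c - (2 * b c e : k) • a := by
  have hae := hQ.mul_add_mul_of_traceZero ha he
  have hce := hQ.mul_add_mul_of_traceZero hc he
  have h1 := congrArg (· * c) hae
  have h2' := congrArg (a * ·) hce
  have h3 := congrArg (· * a) hce
  have h4 := congrArg (c * ·) hae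
  simp only [sub_mul, mul_sub, add_mul, mul_add, neg_mul, mul_neg, smul_mul_assoc, mul_smul_comm,
    one_mul, mul_one, hQ.assoc h2] at h1 h2' h3 h4 ⊢
  linear_combination (norm := module) -h1 + h2' + h3 - h4

theorem b_commutator_right (hQ : IsQuaternionAlgebra k Q) {a c e : Q} (hc : c ∈ traceZero k Q) :
    (b (a * c - c * a) e : k) = b a (c * e - e * c) := by
  rw [map_sub, LinearMap.sub_apply, hQ.b_right_adjoint a c, hQ.b_left_adjoint c a,
    conj_of_mem_traceZero hc, map_sub]
  simp; ring

end IsQuaternionAlgebra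

namespace Superspace

variable {k V : Type*} [Field k] [AddCommGroup V] [Module k V] [Superspace k V]

theorem superSkew_eq (F : V →ₗ[k] V →ₗ[k] V) (x y : V) :
    superSkew k (fun u v => F u v) x y = (F - superFlip F) x y := by
  rw [superSkew, LinearMap.sub_apply, LinearMap.sub_apply, superFlip_apply]

theorem sub_superFlip_of_mem (F : V →ₗ[k] V →ₗ[k] V) {p q : ZMod 2} {x y : V}
    (hx : x ∈ part k V p) (hy : y ∈ part k V q) :
    (F - superFlip F) x y = F x y - sgn k (p * q) • F y x := by
  rw [LinearMap.sub_apply, LinearMap.sub_apply, superFlip_of_mem _ hx hy]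

end Superspace

/-! ### The Tits construction of a supercommutative superalgebra -/

/-- The space `(Q ⊗ J) ⊕ End J`. -/
abbrev TitsSum (k Q J : Type*) [Field k] [AddCommGroup Q] [Module k Q] [AddCommGroup J]
    [Module k J] : Type _ := (Q ⊗[k] J) × Module.End k J

/-- `d_{X,Y} = [L_X, L_Y]`, where `L_X = m X`. -/
noncomputable def innerDer {k J : Type*} [Field k] [AddCommGroup J] [Module k J] [Superspace k J]
    (m : J →ₗ[k] J →ₗ[k] J) : J →ₗ[k] J →ₗ[k] Module.End k J :=
  (superComm k J).compl₁₂ m m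

/-- `m` is a supercommutative product on `J` and `Der` a Lie superalgebra of superderivations
of `J` that contains the `d_{X,Y}`, for which `d_{X,YZ} = d_{XY,Z} - (-1)^{XY} d_{Y,XZ}`. -/
structure IsTitsDatum {k J : Type*} [Field k] [AddCommGroup J] [Module k J] [Superspace k J]
    (m : J →ₗ[k] J →ₗ[k] J) (Der : ZMod 2 → Submodule k (Module.End k J)) : Prop where
  mul_mem : ∀ {p q X Y}, X ∈ part k J p → Y ∈ part k J q → m X Y ∈ part k J (p + q)
  mul_comm : ∀ {p q X Y}, X ∈ part k J p → Y ∈ part k J q → m X Y = sgn k (p * q) • m Y X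
  der_mem : ∀ {p d}, d ∈ Der p → d ∈ part k (Module.End k J) p
  leibniz : ∀ {p r d X}, d ∈ Der p → X ∈ part k J r → ∀ Y,
    d (m X Y) = m (d X) Y + sgn k (p * r) • m X (d Y)
  comm_mem : ∀ {p q d e}, d ∈ Der p → e ∈ Der q → superComm k J d e ∈ Der (p + q)
  inner_mem : ∀ {p q X Y}, X ∈ part k J p → Y ∈ part k J q → innerDer m X Y ∈ Der (p + q)
  comm_inner : ∀ {p q r d X Y}, d ∈ Der p → X ∈ part k J q → Y ∈ part k J r →
    superComm k J d (innerDer m X Y) =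
      innerDer m (d X) Y + sgn k (p * q) • innerDer m X (d Y)
  cyclic : ∀ {p q r X Y Z}, X ∈ part k J p → Y ∈ part k J q → Z ∈ part k J r →
    innerDer m X (m Y Z) = innerDer m (m X Y) Z - sgn k (p * q) • innerDer m Y (m X Z)

namespace IsTitsDatum

variable {k J : Type*} [Field k] [AddCommGroup J] [Module k J] [Superspace k J]
  {m : J →ₗ[k] J →ₗ[k] J} {Der : ZMod 2 → Submodule k (Module.End k J)}

theorem mul_mem_end (h : IsTitsDatum m Der) {p : ZMod 2} {X : J} (hX : X ∈ part k J p) :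
    m X ∈ part k (Module.End k J) p :=
  mem_part_end.2 fun _ _ hY => h.mul_mem hX hY

theorem inner_apply (h : IsTitsDatum m Der) {p q : ZMod 2} {X Y : J} (hX : X ∈ part k J p)
    (hY : Y ∈ part k J q) (Z : J) :
    innerDer m X Y Z = m X (m Y Z) - sgn k (p * q) • m Y (m X Z) :=
  superComm_apply_of_mem (h.mul_mem_end hX) (h.mul_mem_end hY) Z

theorem inner_skew (h : IsTitsDatum m Der) {p q : ZMod 2} {X Y : J} (hX : X ∈ part k J p)
    (hY : Y ∈ part k J q) : innerDer m X Y = -(sgn k (p * q) • innerDer m Y X) :=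
  superComm_skew (h.mul_mem_end hX) (h.mul_mem_end hY)

end IsTitsDatum

section TitsLin

variable (k Q J : Type*) [Field k]
  [NonAssocRing Q] [Module k Q] [IsScalarTower k Q Q] [SMulCommClass k Q Q]
  [HurwitzSuperalgebra k Q] [AddCommGroup J] [Module k J] [Superspace k J]

/-- `(u, v) ↦ [d, z]` for the component `d` of `u` in `End J` and the component `z` of `v` in
`Q ⊗ J`. -/
def titsAct : TitsSum k Q J →ₗ[k] TitsSum k Q J →ₗ[k] TitsSum k Q J :=
  LinearMap.mk₂ k (fun u v => (u.2.lTensor Q v.1, 0))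
    (fun u u' v => by simp [LinearMap.lTensor_add])
    (fun c u v => by simp [LinearMap.lTensor_smul])
    (fun u v v' => by simp)
    (fun c u v => by simp)

variable {k J}

/-- The bracket of the Tits construction as a bilinear map. -/
noncomputable def titsLin (m : J →ₗ[k] J →ₗ[k] J) : TitsSum k Q J →ₗ[k] TitsSum k Q J →ₗ[k] TitsSum k Q J :=
  LinearMap.mk₂ k (fun u v =>
    (TensorProduct.map₂ (LinearMap.mul k Q - (LinearMap.mul k Q).flip) m u.1 v.1,
    superComm k J u.2 v.2
      - (2 : k) • TensorProduct.lid k (Module.End k J)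
          (TensorProduct.map₂ (b : Q →ₗ[k] Q →ₗ[k] k) (innerDer m) u.1 v.1)))
    (fun u u' v => by
      ext1
      · simp only [Prod.fst_add, map_add, LinearMap.add_apply]
      · simp only [Prod.fst_add, Prod.snd_add, map_add, LinearMap.add_apply]; module)
    (fun c u v => by
      ext1
      · simp only [Prod.smul_fst, map_smul, LinearMap.smul_apply]
      · simp only [Prod.smul_fst, Prod.smul_snd, map_smul, LinearMap.smul_apply]; module)
    (fun u v v' => by
      ext1
      · simp only [Prod.fst_add, map_add]
      · simp only [Prod.fst_add, Prod.snd_add, map_add]; module)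
    (fun c u v => by
      ext1
      · simp only [Prod.smul_fst, map_smul]
      · simp only [Prod.smul_fst, Prod.smul_snd, map_smul]; module)
  + (titsAct k Q J - superFlip (titsAct k Q J))

variable {Q} (m : J →ₗ[k] J →ₗ[k] J) (Der : ZMod 2 → Submodule k (Module.End k J))

variable (k J) in
/-- The element `a ⊗ X` of the Tits construction. -/
def titsTmul : Q →ₗ[k] J →ₗ[k] TitsSum k Q J :=
  (TensorProduct.mk k Q J).compr₂ (LinearMap.inl k _ _)

variable (k Q J) in
/-- The element `d` of `End J` as an element of the Tits construction. -/
def titsDer : Module.End k J →ₗ[k] TitsSum k Q J := LinearMap.inr k _ _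

theorem titsTmul_apply (a : Q) (X : J) : titsTmul k J a X = (a ⊗ₜ[k] X, 0) := rfl

theorem titsDer_apply (d : Module.End k J) : titsDer k Q J d = (0, d) := rfl

theorem titsTmul_mem (hQ : IsQuaternionAlgebra k Q) (a : Q) {p : ZMod 2} {X : J}
    (hX : X ∈ part k J p) : titsTmul k J a X ∈ part k (TitsSum k Q J) p := by
  refine mem_part_prod.2 ⟨?_, zero_mem _⟩
  have h := tmul_mem_part (hQ.even a) hX
  rwa [zero_add] at h

theorem titsDer_mem {p : ZMod 2} {d : Module.End k J} (hd : d ∈ part k (Module.End k J) p) :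
    titsDer k Q J d ∈ part k (TitsSum k Q J) p :=
  mem_part_prod.2 ⟨zero_mem _, hd⟩

theorem titsLin_of_mem {p q : ZMod 2} {u v : TitsSum k Q J} (hu : u ∈ part k _ p)
    (hv : v ∈ part k _ q) : titsLin Q m u v =
    (TensorProduct.map₂ (LinearMap.mul k Q - (LinearMap.mul k Q).flip) m u.1 v.1,
      superComm k J u.2 v.2
      - (2 : k) • TensorProduct.lid k (Module.End k J)
          (TensorProduct.map₂ (b : Q →ₗ[k] Q →ₗ[k] k) (innerDer m) u.1 v.1))
    + ((u.2.lTensor Q v.1, 0) - sgn k (p * q) • (v.2.lTensor Q u.1, 0)) := by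
  rw [titsLin, LinearMap.add_apply, LinearMap.add_apply, sub_superFlip_of_mem _ hu hv]
  rfl

section Table

variable {p q : ZMod 2} {X Y : J} {d e : Module.End k J}

theorem titsLin_tmul_tmul (hQ : IsQuaternionAlgebra k Q) (a c : Q)
    (hX : X ∈ part k J p) (hY : Y ∈ part k J q) :
    titsLin Q m (titsTmul k J a X) (titsTmul k J c Y) =
      titsTmul k J (a * c - c * a) (m X Y) - titsDer k Q J ((2 * b a c : k) • innerDer m X Y) := by
  rw [titsLin_of_mem m (titsTmul_mem hQ a hX) (titsTmul_mem hQ c hY)]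
  ext1
  · simp [titsTmul_apply, titsDer_apply, TensorProduct.map₂_apply_tmul, TensorProduct.sub_tmul]
  · simp [titsTmul_apply, titsDer_apply, TensorProduct.map₂_apply_tmul, mul_smul]

theorem titsLin_der_tmul (hQ : IsQuaternionAlgebra k Q) (hd : d ∈ part k (Module.End k J) p)
    (a : Q) (hX : X ∈ part k J q) :
    titsLin Q m (titsDer k Q J d) (titsTmul k J a X) = titsTmul k J a (d X) := by
  rw [titsLin_of_mem m (titsDer_mem hd) (titsTmul_mem hQ a hX)]
  ext1 <;> simp [titsTmul_apply, titsDer_apply]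

theorem titsLin_tmul_der (hQ : IsQuaternionAlgebra k Q) (a : Q) (hX : X ∈ part k J p)
    (hd : d ∈ part k (Module.End k J) q) :
    titsLin Q m (titsTmul k J a X) (titsDer k Q J d) =
      -(sgn k (p * q) • titsTmul k J a (d X)) := by
  rw [titsLin_of_mem m (titsTmul_mem hQ a hX) (titsDer_mem hd)]
  ext1 <;> simp [titsTmul_apply, titsDer_apply]

theorem titsLin_der_der (hd : d ∈ part k (Module.End k J) p) (he : e ∈ part k (Module.End k J) q) :
    titsLin Q m (titsDer k Q J d) (titsDer k Q J e) = titsDer k Q J (superComm k J d e) := by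
  rw [titsLin_of_mem m (titsDer_mem hd) (titsDer_mem he)]
  ext1 <;> simp [titsDer_apply]

end Table

variable (Q) in
/-- Homogeneous generators of the Tits construction. -/
def titsGen (p : ZMod 2) : Set (TitsSum k Q J) :=
  {u | (∃ a ∈ traceZero k Q, ∃ X ∈ part k J p, u = titsTmul k J a X) ∨
    ∃ d ∈ Der p, u = titsDer k Q J d}

variable (Q) in
/-- The subspace `(Q⁰ ⊗ J) ⊕ Der`. -/
def titsSub : Submodule k (TitsSum k Q J) :=
  (LinearMap.range ((traceZero k Q).subtype.rTensor J)).prod (Der 0 ⊔ Der 1)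

variable {Der}

theorem titsTmul_mem_titsSub {a : Q} (ha : a ∈ traceZero k Q) (X : J) :
    titsTmul k J a X ∈ titsSub Q Der :=
  ⟨⟨(⟨a, ha⟩ : traceZero k Q) ⊗ₜ[k] X, by simp [titsTmul_apply]⟩, zero_mem _⟩

theorem titsDer_mem_titsSub {p : ZMod 2} {d : Module.End k J} (hd : d ∈ Der p) :
    titsDer k Q J d ∈ titsSub Q Der := by
  refine ⟨zero_mem _, ?_⟩
  rcases parity_cases p with rfl | rfl
  · exact Submodule.mem_sup_left hd
  · exact Submodule.mem_sup_right hd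

theorem titsSub_eq_span :
    titsSub Q Der = Submodule.span k (titsGen Q Der 0) ⊔ Submodule.span k (titsGen Q Der 1) := by
  apply le_antisymm
  · rintro ⟨z, d⟩ ⟨⟨w, hw⟩, hd⟩
    change _ = z at hw
    have e : ((z, d) : TitsSum k Q J) = (z, 0) + titsDer k Q J d := by simp [titsDer_apply]
    rw [e]
    refine add_mem ?_ ?_
    · subst hw
      clear e hd
      induction w with
      | zero => rw [map_zero]; exact zero_mem _
      | add u v hu hv =>
        have := add_mem hu hv
        rwa [Prod.mk_add_mk, ← map_add, zero_add] at this
      | tmul a X =>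
        have e : (((traceZero k Q).subtype.rTensor J (a ⊗ₜ[k] X), 0) : TitsSum k Q J) =
            titsTmul k J a.1 (proj (k := k) 0 X) + titsTmul k J a.1 (proj (k := k) 1 X) := by
          rw [← map_add, proj_add]; simp [titsTmul_apply]
        rw [e]
        exact Submodule.add_mem_sup
          (Submodule.subset_span (Or.inl ⟨a.1, a.2, _, proj_mem_part 0 X, rfl⟩))
          (Submodule.subset_span (Or.inl ⟨a.1, a.2, _, proj_mem_part 1 X, rfl⟩))
    · obtain ⟨d₀, h₀, d₁, h₁, rfl⟩ := Submodule.mem_sup.1 hd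
      rw [map_add]
      exact Submodule.add_mem_sup (Submodule.subset_span (Or.inr ⟨d₀, h₀, rfl⟩))
        (Submodule.subset_span (Or.inr ⟨d₁, h₁, rfl⟩))
  · have h : ∀ p, Submodule.span k (titsGen Q Der p) ≤ titsSub Q Der := by
      intro p
      rw [Submodule.span_le]
      rintro _ (⟨a, ha, X, hX, rfl⟩ | ⟨d, hd, rfl⟩)
      · exact titsTmul_mem_titsSub ha X
      · exact titsDer_mem_titsSub hd
    exact sup_le (h 0) (h 1)

end TitsLin

namespace IsTitsDatum

variable {k Q J : Type*} [Field k]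
  [NonAssocRing Q] [Module k Q] [IsScalarTower k Q Q] [SMulCommClass k Q Q]
  [HurwitzSuperalgebra k Q] [AddCommGroup J] [Module k J] [Superspace k J]
  {m : J →ₗ[k] J →ₗ[k] J} {Der : ZMod 2 → Submodule k (Module.End k J)}
  {p q r : ZMod 2} {d e f : Module.End k J} {X Y Z : J} {u v w : TitsSum k Q J}

theorem titsGen_subset (h : IsTitsDatum m Der) (hQ : IsQuaternionAlgebra k Q) (p : ZMod 2) :
    titsGen Q Der p ⊆ part k (TitsSum k Q J) p := by
  rintro _ (⟨a, -, X, hX, rfl⟩ | ⟨d, hd, rfl⟩)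
  · exact titsTmul_mem hQ a hX
  · exact titsDer_mem (h.der_mem hd)

theorem titsLin_mem_titsSub (h : IsTitsDatum m Der) (hQ : IsQuaternionAlgebra k Q)
    (hu : u ∈ titsGen Q Der p) (hv : v ∈ titsGen Q Der q) : titsLin Q m u v ∈ titsSub Q Der := by
  rcases hu with ⟨a, ha, X, hX, rfl⟩ | ⟨d, hd, rfl⟩ <;>
    rcases hv with ⟨c, hc, Y, hY, rfl⟩ | ⟨e, he, rfl⟩
  · rw [titsLin_tmul_tmul m hQ a c hX hY]
    exact sub_mem (titsTmul_mem_titsSub (hQ.commutator_mem_traceZero a c) _)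
      (titsDer_mem_titsSub (Submodule.smul_mem _ _ (h.inner_mem hX hY)))
  · rw [titsLin_tmul_der m hQ a hX (h.der_mem he)]
    exact neg_mem (Submodule.smul_mem _ _ (titsTmul_mem_titsSub ha _))
  · rw [titsLin_der_tmul m hQ (h.der_mem hd) c hY]
    exact titsTmul_mem_titsSub hc _
  · rw [titsLin_der_der m (h.der_mem hd) (h.der_mem he)]
    exact titsDer_mem_titsSub (h.comm_mem hd he)

theorem titsLin_mem_part (h : IsTitsDatum m Der) (hQ : IsQuaternionAlgebra k Q)
    (hu : u ∈ titsGen Q Der p) (hv : v ∈ titsGen Q Der q) :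
    titsLin Q m u v ∈ part k (TitsSum k Q J) (p + q) := by
  rcases hu with ⟨a, ha, X, hX, rfl⟩ | ⟨d, hd, rfl⟩ <;>
    rcases hv with ⟨c, hc, Y, hY, rfl⟩ | ⟨e, he, rfl⟩
  · rw [titsLin_tmul_tmul m hQ a c hX hY]
    exact sub_mem (titsTmul_mem hQ _ (h.mul_mem hX hY))
      (titsDer_mem (Submodule.smul_mem _ _ (h.der_mem (h.inner_mem hX hY))))
  · rw [titsLin_tmul_der m hQ a hX (h.der_mem he), add_comm]
    exact neg_mem (Submodule.smul_mem _ _ (titsTmul_mem hQ _ (apply_mem_part (h.der_mem he) hX)))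
  · rw [titsLin_der_tmul m hQ (h.der_mem hd) c hY]
    exact titsTmul_mem hQ _ (apply_mem_part (h.der_mem hd) hY)
  · rw [titsLin_der_der m (h.der_mem hd) (h.der_mem he)]
    exact titsDer_mem (superComm_mem_part (h.der_mem hd) (h.der_mem he))

theorem titsLin_skew (h : IsTitsDatum m Der) (hQ : IsQuaternionAlgebra k Q)
    (hu : u ∈ titsGen Q Der p) (hv : v ∈ titsGen Q Der q) :
    titsLin Q m u v = -(sgn k (p * q) • titsLin Q m v u) := by
  rcases hu with ⟨a, ha, X, hX, rfl⟩ | ⟨d, hd, rfl⟩ <;>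
    rcases hv with ⟨c, hc, Y, hY, rfl⟩ | ⟨e, he, rfl⟩
  · rw [titsLin_tmul_tmul m hQ a c hX hY, titsLin_tmul_tmul m hQ c a hY hX, h.mul_comm hX hY,
      h.inner_skew hX hY, hQ.b_comm a c]
    simp only [map_sub, map_smul, map_neg, LinearMap.sub_apply, smul_sub, smul_neg]
    module
  · rw [titsLin_tmul_der m hQ a hX (h.der_mem he), titsLin_der_tmul m hQ (h.der_mem he) a hX]
  · rw [titsLin_der_tmul m hQ (h.der_mem hd) c hY, titsLin_tmul_der m hQ c hY (h.der_mem hd),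
      smul_neg, neg_neg, smul_smul, _root_.mul_comm q p, sgn_mul_self, one_smul]
  · rw [titsLin_der_der m (h.der_mem hd) (h.der_mem he),
      titsLin_der_der m (h.der_mem he) (h.der_mem hd),
      superComm_skew (h.der_mem hd) (h.der_mem he), map_neg, map_smul]

theorem titsLin_jacobi_tmul (h : IsTitsDatum m Der) (h2 : (2 : k) ≠ 0)
    (hQ : IsQuaternionAlgebra k Q) {a c e : Q}
    (ha : a ∈ traceZero k Q) (hc : c ∈ traceZero k Q) (he : e ∈ traceZero k Q)
    (hX : X ∈ part k J p) (hY : Y ∈ part k J q) (hZ : Z ∈ part k J r) :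
    titsLin Q m (titsTmul k J a X) (titsLin Q m (titsTmul k J c Y) (titsTmul k J e Z)) =
      titsLin Q m (titsLin Q m (titsTmul k J a X) (titsTmul k J c Y)) (titsTmul k J e Z) +
      sgn k (p * q) •
        titsLin Q m (titsTmul k J c Y) (titsLin Q m (titsTmul k J a X) (titsTmul k J e Z)) := by
  have hace := hQ.commutator_commutator h2 ha hc he
  have hcea := congrArg Neg.neg (hQ.commutator_commutator h2 hc he ha)
  have haec := congrArg Neg.neg (hQ.commutator_commutator h2 ha he hc)
  rw [neg_sub, neg_sub] at hcea haec
  have hβ := hQ.b_commutator_right (a := a) (e := e) hc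
  have hβ' := hQ.b_commutator_right (a := c) (e := e) ha
  rw [← neg_sub, map_neg, LinearMap.neg_apply] at hβ'
  have hR : ∀ (u v : TitsSum k Q J) (s : k) (d : Module.End k J),
      titsLin Q m u (v - titsDer k Q J (s • d)) =
        titsLin Q m u v - s • titsLin Q m u (titsDer k Q J d) := by
    intro u v s d; rw [map_sub, map_smul, map_smul]
  have hL : ∀ (u v : TitsSum k Q J) (s : k) (d : Module.End k J),
      titsLin Q m (v - titsDer k Q J (s • d)) u =
        titsLin Q m v u - s • titsLin Q m (titsDer k Q J d) u := by
    intro u v s d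
    rw [map_sub, map_smul, map_smul, LinearMap.sub_apply, LinearMap.smul_apply]
  have iYZ := h.der_mem (h.inner_mem hY hZ)
  have iXZ := h.der_mem (h.inner_mem hX hZ)
  have iXY := h.der_mem (h.inner_mem hX hY)
  rw [titsLin_tmul_tmul m hQ c e hY hZ, titsLin_tmul_tmul m hQ a c hX hY,
    titsLin_tmul_tmul m hQ a e hX hZ, hR, hL, hR,
    titsLin_tmul_tmul m hQ a _ hX (h.mul_mem hY hZ), titsLin_tmul_tmul m hQ c _ hY (h.mul_mem hX hZ),
    titsLin_tmul_tmul m hQ _ e (h.mul_mem hX hY) hZ, titsLin_tmul_der m hQ a hX iYZ,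
    titsLin_tmul_der m hQ c hY iXZ, titsLin_der_tmul m hQ iXY e hZ,
    h.inner_apply hX hY, h.inner_apply hX hZ, h.inner_apply hY hZ, hace, hcea, haec, ← hβ, ← hβ',
    h.cyclic hX hY hZ, hQ.b_comm e a, hQ.b_comm e c, hQ.b_comm c a,
    h.mul_comm hZ hY, h.mul_comm hZ hX, h.mul_comm hZ (h.mul_mem hX hY), h.mul_comm hY hX,
    map_smul, map_smul, map_smul, h.mul_comm hZ (h.mul_mem hX hY)]
  simp only [map_sub, map_smul, LinearMap.sub_apply, LinearMap.smul_apply, smul_sub, smul_neg]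
  rcases parity_cases p with rfl | rfl <;> rcases parity_cases q with rfl | rfl <;>
    rcases parity_cases r with rfl | rfl <;>
    simp only [one_add_one, mul_zero, mul_one, add_zero, zero_add, sgn_zero, sgn_one] <;>
    module

theorem titsLin_jacobi_der_tmul_tmul (h : IsTitsDatum m Der) (hQ : IsQuaternionAlgebra k Q) (a c : Q)
    (hd : d ∈ Der p) (hX : X ∈ part k J q) (hY : Y ∈ part k J r) :
    titsLin Q m (titsDer k Q J d) (titsLin Q m (titsTmul k J a X) (titsTmul k J c Y)) =
      titsLin Q m (titsLin Q m (titsDer k Q J d) (titsTmul k J a X)) (titsTmul k J c Y) +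
      sgn k (p * q) •
        titsLin Q m (titsTmul k J a X) (titsLin Q m (titsDer k Q J d) (titsTmul k J c Y)) := by
  have hd' := h.der_mem hd
  rw [titsLin_tmul_tmul m hQ a c hX hY, titsLin_der_tmul m hQ hd' a hX,
    titsLin_der_tmul m hQ hd' c hY, titsLin_tmul_tmul m hQ a c (apply_mem_part hd' hX) hY,
    titsLin_tmul_tmul m hQ a c hX (apply_mem_part hd' hY), map_sub, map_smul, map_smul,
    titsLin_der_tmul m hQ hd' _ (h.mul_mem hX hY),
    titsLin_der_der m hd' (h.der_mem (h.inner_mem hX hY)), h.comm_inner hd hX hY, h.leibniz hd hX]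
  simp only [map_add, map_smul]
  module

theorem titsLin_jacobi_der_der_tmul (hQ : IsQuaternionAlgebra k Q) (a : Q)
    (hd : d ∈ part k (Module.End k J) p) (he : e ∈ part k (Module.End k J) q)
    (hX : X ∈ part k J r) :
    titsLin Q m (titsDer k Q J d) (titsLin Q m (titsDer k Q J e) (titsTmul k J a X)) =
      titsLin Q m (titsLin Q m (titsDer k Q J d) (titsDer k Q J e)) (titsTmul k J a X) +
      sgn k (p * q) •
        titsLin Q m (titsDer k Q J e) (titsLin Q m (titsDer k Q J d) (titsTmul k J a X)) := by
  rw [titsLin_der_der m hd he, titsLin_der_tmul m hQ he a hX, titsLin_der_tmul m hQ hd a hX,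
    titsLin_der_tmul m hQ hd a (apply_mem_part he hX),
    titsLin_der_tmul m hQ he a (apply_mem_part hd hX),
    titsLin_der_tmul m hQ (superComm_mem_part hd he) a hX, superComm_apply_of_mem hd he,
    map_sub, map_smul]
  module

/-- The Jacobi identity for three homogeneous elements follows from that for the first two
exchanged. -/
theorem jacobi_swap_left {A : Type*} [AddCommGroup A] [Module k A] (B : A →ₗ[k] A →ₗ[k] A)
    {p q : ZMod 2} {u v w : A} (hskew : B u v = -(sgn k (p * q) • B v u))
    (h : B v (B u w) = B (B v u) w + sgn k (q * p) • B u (B v w)) :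
    B u (B v w) = B (B u v) w + sgn k (p * q) • B v (B u w) := by
  have e := sgn_mul_self (k := k) (p * q)
  rw [hskew, h, _root_.mul_comm q p, map_neg, map_smul, LinearMap.neg_apply, LinearMap.smul_apply,
    smul_add, smul_smul, e]
  module

end IsTitsDatum

namespace IsTitsDatum

variable {k Q J : Type*} [Field k]
  [NonAssocRing Q] [Module k Q] [IsScalarTower k Q Q] [SMulCommClass k Q Q]
  [HurwitzSuperalgebra k Q] [AddCommGroup J] [Module k J] [Superspace k J]
  {m : J →ₗ[k] J →ₗ[k] J} {Der : ZMod 2 → Submodule k (Module.End k J)}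
  {p q r : ZMod 2} {d e f : Module.End k J} {X Y Z : J} {u v w : TitsSum k Q J}

theorem titsLin_jacobi (h : IsTitsDatum m Der) (h2 : (2 : k) ≠ 0) (hQ : IsQuaternionAlgebra k Q)
    (hu : u ∈ titsGen Q Der p) (hv : v ∈ titsGen Q Der q) (hw : w ∈ titsGen Q Der r) :
    titsLin Q m u (titsLin Q m v w) =
      titsLin Q m (titsLin Q m u v) w + sgn k (p * q) • titsLin Q m v (titsLin Q m u w) := by
  have huv := h.titsLin_skew hQ hu hv
  rcases hu with ⟨a, ha, X, hX, rfl⟩ | ⟨d, hd, rfl⟩ <;>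
    rcases hv with ⟨c, hc, Y, hY, rfl⟩ | ⟨e, he, rfl⟩ <;>
    rcases hw with ⟨g, hg, Z, hZ, rfl⟩ | ⟨f, hf, rfl⟩
  · convert h.titsLin_jacobi_tmul h2 hQ ha hc hg hX hY hZ using 1
  · have hf' := h.der_mem hf
    have hR : ∀ (u v : TitsSum k Q J) (s : k) (d : Module.End k J),
        titsLin Q m (v - titsDer k Q J (s • d)) u =
          titsLin Q m v u - s • titsLin Q m (titsDer k Q J d) u := by
      intro u v s d
      rw [map_sub, map_smul, map_smul, LinearMap.sub_apply, LinearMap.smul_apply]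
    have iXY := h.der_mem (h.inner_mem hX hY)
    rw [titsLin_tmul_der m hQ c hY hf', titsLin_tmul_der m hQ a hX hf',
      titsLin_tmul_tmul m hQ a c hX hY, hR, map_neg, map_smul, map_neg, map_smul,
      titsLin_tmul_tmul m hQ a c hX (apply_mem_part hf' hY),
      titsLin_tmul_tmul m hQ c a hY (apply_mem_part hf' hX),
      titsLin_tmul_der m hQ _ (h.mul_mem hX hY) hf', titsLin_der_der m iXY hf',
      superComm_skew iXY hf', h.comm_inner hf hX hY, h.leibniz hf hX,
      h.mul_comm hY (apply_mem_part hf' hX), h.inner_skew hY (apply_mem_part hf' hX),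
      hQ.b_comm c a]
    simp only [map_sub, map_smul, map_add, map_neg, LinearMap.sub_apply, smul_sub, smul_neg, smul_add]
    rcases parity_cases p with rfl | rfl <;> rcases parity_cases q with rfl | rfl <;>
      rcases parity_cases r with rfl | rfl <;>
      simp only [one_add_one, mul_zero, mul_one, add_zero, zero_add, sgn_zero,
        sgn_one] <;>
      module
  · convert jacobi_swap_left (titsLin Q m) huv (w := titsTmul k J g Z) ?_ using 1
    convert h.titsLin_jacobi_der_tmul_tmul hQ a g he hX hZ using 1
  · have he' := h.der_mem he
    have hf' := h.der_mem hf
    rw [titsLin_der_der m he' hf', titsLin_tmul_der m hQ a hX he', titsLin_tmul_der m hQ a hX hf',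
      titsLin_tmul_der m hQ a hX (superComm_mem_part he' hf'), map_neg, map_smul, map_neg, map_smul,
      LinearMap.neg_apply, LinearMap.smul_apply, titsLin_tmul_der m hQ a (apply_mem_part he' hX) hf',
      titsLin_der_tmul m hQ he' a (apply_mem_part hf' hX), superComm_apply_of_mem he' hf',
      map_sub, map_smul]
    rcases parity_cases p with rfl | rfl <;> rcases parity_cases q with rfl | rfl <;>
      rcases parity_cases r with rfl | rfl <;>
      simp only [one_add_one, mul_zero, mul_one, add_zero, zero_add, sgn_zero,
        sgn_one] <;>
      module
  · convert h.titsLin_jacobi_der_tmul_tmul hQ c g hd hY hZ using 1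
  · have hd' := h.der_mem hd
    have hf' := h.der_mem hf
    rw [titsLin_tmul_der m hQ c hY hf', titsLin_der_tmul m hQ hd' c hY, titsLin_der_der m hd' hf',
      titsLin_tmul_der m hQ c (apply_mem_part hd' hY) hf',
      titsLin_tmul_der m hQ c hY (superComm_mem_part hd' hf'), map_neg, map_smul,
      titsLin_der_tmul m hQ hd' c (apply_mem_part hf' hY), superComm_apply_of_mem hd' hf',
      map_sub, map_smul]
    rcases parity_cases p with rfl | rfl <;> rcases parity_cases q with rfl | rfl <;>
      rcases parity_cases r with rfl | rfl <;>
      simp only [one_add_one, mul_zero, mul_one, add_zero, zero_add, sgn_zero,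
        sgn_one] <;>
      module
  · convert titsLin_jacobi_der_der_tmul hQ g (h.der_mem hd) (h.der_mem he) hZ using 1
  · have hd' := h.der_mem hd
    have he' := h.der_mem he
    have hf' := h.der_mem hf
    rw [titsLin_der_der m he' hf', titsLin_der_der m hd' hf', titsLin_der_der m hd' he',
      titsLin_der_der m hd' (superComm_mem_part he' hf'),
      titsLin_der_der m he' (superComm_mem_part hd' hf'),
      titsLin_der_der m (superComm_mem_part hd' he') hf', superComm_jacobi hd' he' hf',
      map_add, map_smul]

theorem titsLin_odd_cube (h : IsTitsDatum m Der) (h2 : (2 : k) ≠ 0) (hQ : IsQuaternionAlgebra k Q)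
    (hu : u ∈ titsGen Q Der 1) : titsLin Q m (titsLin Q m u u) u = 0 := by
  rcases hu with ⟨a, ha, X, hX, rfl⟩ | ⟨d, hd, rfl⟩
  · have hXX : m X X = 0 := by
      have hc := h.mul_comm hX hX
      rw [mul_one, sgn_one, neg_smul, one_smul, eq_neg_iff_add_eq_zero, ← two_smul k] at hc
      exact (smul_eq_zero.1 hc).resolve_left h2
    rw [titsLin_tmul_tmul m hQ a a hX hX, hXX, sub_self, map_zero, zero_sub, map_neg,
      LinearMap.neg_apply, titsLin_der_tmul m hQ
        (Submodule.smul_mem _ _ (h.der_mem (h.inner_mem hX hX))) a hX, LinearMap.smul_apply,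
      h.inner_apply hX hX, hXX]
    simp
  · have hd' := h.der_mem hd
    rw [titsLin_der_der m hd' hd', titsLin_der_der m (superComm_mem_part hd' hd') hd',
      superComm_of_mem (superComm_mem_part hd' hd') hd', superComm_of_mem hd' hd']
    simp [one_add_one, mul_add, add_mul, mul_assoc, titsDer_apply]

theorem isLieSuperalgebra (h : IsTitsDatum m Der) (h2 : (2 : k) ≠ 0)
    (hQ : IsQuaternionAlgebra k Q) :
    IsLieSuperalgebra (fun u v => titsLin Q m u v) (titsSub Q Der) :=
  IsLieSuperalgebra.of_span (titsLin Q m) titsSub_eq_span (h.titsGen_subset hQ)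
    (fun _ _ _ hu _ hv => h.titsLin_mem_titsSub hQ hu hv)
    (fun _ _ _ hu _ hv => h.titsLin_mem_part hQ hu hv)
    (fun _ _ _ hu _ hv => h.titsLin_skew hQ hu hv)
    (fun _ _ _ _ hu _ hv _ hw => h.titsLin_jacobi h2 hQ hu hv hw)
    (fun _ hu => h.titsLin_odd_cube h2 hQ hu)

end IsTitsDatum

section TitsH3

set_option maxSynthPendingDepth 5

variable {k Q C : Type*} [Field k]
  [NonAssocRing Q] [Module k Q] [IsScalarTower k Q Q] [SMulCommClass k Q Q]
  [HurwitzSuperalgebra k Q]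
  [NonAssocRing C] [Module k C] [IsScalarTower k C C] [SMulCommClass k C C]
  [HurwitzSuperalgebra k C]

theorem innerDer_jmul (X Y : H3 k C) : innerDer jmul X Y = innerD X Y := rfl

theorem isTitsDatum_jmul (h2 : (2 : k) ≠ 0) : IsTitsDatum (jmul (k := k) (C := C)) (derPart k C) where
  mul_mem hX hY := jmul_mem hX hY
  mul_comm hX hY := jmul_comm hX hY
  der_mem h := h.1
  leibniz hd hX Y := hd.2 _ _ hX Y
  comm_mem hd he := superComm_mem_derPart hd he
  inner_mem hX hY := by rw [innerDer_jmul]; exact innerD_mem_derPart h2 hX hY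
  comm_inner hd hX hY := by
    rw [innerDer_jmul, innerDer_jmul, innerDer_jmul]
    convert superComm_innerD hd hX hY using 1
  cyclic hX hY hZ := by
    rw [innerDer_jmul, innerDer_jmul, innerDer_jmul]
    convert innerD_cyclic h2 hX hY hZ using 1

theorem titsBracket_eq : titsBracket k Q C = fun u v => titsLin Q jmul u v := by
  ext1 u
  ext1 v
  rw [titsLin, LinearMap.add_apply, LinearMap.add_apply, ← superSkew_eq]
  rfl

theorem tits_isLieSuperalgebra (h2 : (2 : k) ≠ 0) (hQ : IsQuaternionAlgebra k Q) :
    IsLieSuperalgebra (titsBracket k Q C) (tits k Q C) := by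
  rw [titsBracket_eq]
  exact (isTitsDatum_jmul h2).isLieSuperalgebra h2 hQ

end TitsH3

namespace IsQuaternionAlgebra

variable {k Q : Type*} [Field k] [NonAssocRing Q] [Module k Q] [IsScalarTower k Q Q]
  [SMulCommClass k Q Q] [HurwitzSuperalgebra k Q]

/-! ### The triality Lie algebra of a quaternion algebra -/

theorem even_end (hQ : IsQuaternionAlgebra k Q) (d : Module.End k Q) :
    d ∈ part k (Module.End k Q) 0 := by
  refine mem_part_end.2 fun q v hv => ?_
  rcases parity_cases q with rfl | rfl
  · exact hQ.even _
  · rw [eq_zero_of_mem_part one_ne_zero hv (hQ.even v), map_zero]; exact zero_mem _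

theorem mem_triPart_zero (hQ : IsQuaternionAlgebra k Q) {d : Fin 3 → Module.End k Q} :
    d ∈ triPart (paraMulOp k Q) b 0 ↔
      (∀ i x y, (b (d i x) y : k) + b x (d i y) = 0) ∧
        ∀ x y, d 0 (conj k Q (x * y)) = conj k Q (d 1 x * y) + conj k Q (x * d 2 y) := by
  constructor
  · rintro ⟨h, h'⟩
    refine ⟨fun i x y => ?_, fun x y => ?_⟩
    · simpa using (h i).2 0 x (hQ.even x) y
    · simpa [paraMulOp_apply] using h' 0 x (hQ.even x) y
  · rintro ⟨h, h'⟩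
    refine ⟨fun i => ⟨hQ.even_end _, fun r x hx y => ?_⟩, fun r x hx y => ?_⟩
    · simpa using h i x y
    · simpa [paraMulOp_apply] using h' x y

theorem triPart_one (hQ : IsQuaternionAlgebra k Q) :
    triPart (paraMulOp k Q) (b : Q →ₗ[k] Q →ₗ[k] k) 1 = ⊥ := by
  refine eq_bot_iff.2 fun d hd => ?_
  rw [Submodule.mem_bot]
  ext1 i
  exact eq_zero_of_mem_part one_ne_zero (hd.1 i).1 (hQ.even_end _)

theorem tri_eq (hQ : IsQuaternionAlgebra k Q) :
    tri (paraMulOp k Q) (b : Q →ₗ[k] Q →ₗ[k] k) = triPart (paraMulOp k Q) b 0 := by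
  rw [tri, hQ.triPart_one, sup_bot_eq]

theorem mem_tri (hQ : IsQuaternionAlgebra k Q) {d : Fin 3 → Module.End k Q} :
    d ∈ tri (paraMulOp k Q) b ↔
      (∀ i x y, (b (d i x) y : k) + b x (d i y) = 0) ∧
        ∀ x y, d 0 (conj k Q (x * y)) = conj k Q (d 1 x * y) + conj k Q (x * d 2 y) := by
  rw [hQ.tri_eq, hQ.mem_triPart_zero]

theorem apply_one_mem_traceZero (h2 : (2 : k) ≠ 0) (hQ : IsQuaternionAlgebra k Q)
    {d : Module.End k Q} (hd : ∀ x y, (b (d x) y : k) + b x (d y) = 0) : d 1 ∈ traceZero k Q := by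
  have h := hd 1 1
  rw [hQ.b_comm 1, ← two_mul] at h
  exact (mul_eq_zero.1 h).resolve_left h2

theorem kerElt_mem_tri (h2 : (2 : k) ≠ 0) (hQ : IsQuaternionAlgebra k Q) {a : Q}
    (ha : a ∈ traceZero k Q) (i : Fin 3) : kerElt k a i ∈ tri (paraMulOp k Q) b := by
  have ha' := conj_of_mem_traceZero ha
  have hL : ∀ x y, (b (a * x) y : k) + b x (a * y) = 0 := fun x y => by
    rw [hQ.b_left_adjoint, ha', neg_mul, map_neg, neg_add_cancel]
  have hR : ∀ x y, (b (-(x * a)) y : k) + b x (-(y * a)) = 0 := fun x y => by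
    rw [map_neg, LinearMap.neg_apply, hQ.b_right_adjoint, ha', mul_neg, map_neg, neg_neg,
      add_neg_cancel]
  rw [hQ.mem_tri]
  constructor
  · intro j x y
    fin_cases i <;> fin_cases j <;> simp [kerElt] <;>
      first | exact hL x y | (have := hR x y; simpa using this)
  · intro x y
    fin_cases i <;> simp [kerElt, hQ.conj_mul', ha', hQ.assoc h2]

theorem eq_kerElt_of_apply_eq_zero (h2 : (2 : k) ≠ 0) (hQ : IsQuaternionAlgebra k Q) {i : Fin 3}
    {d : Fin 3 → Module.End k Q} (hd : d ∈ tri (paraMulOp k Q) (b : Q →ₗ[k] Q →ₗ[k] k))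
    (hi : d i = 0) : ∃ a ∈ traceZero k Q, d = kerElt k a i := by
  obtain ⟨hs, ht⟩ := hQ.mem_tri.1 hd
  have hz := fun j => hQ.apply_one_mem_traceZero h2 (hs j)
  have ht1 := fun y => ht 1 y
  have htx := fun x => ht x 1
  simp only [one_mul, mul_one] at ht1 htx
  fin_cases i
  · refine ⟨d 2 1, hz 2, ?_⟩
    have h0 : d 0 = 0 := hi
    have hc : ∀ u v : Q, 0 = conj k Q u + conj k Q v → u = -v := by
      intro u v h
      have := congrArg (conj k Q) h
      rw [map_zero, map_add, conj_conj, conj_conj] at this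
      exact eq_neg_of_add_eq_zero_left this.symm
    have e1 : ∀ x, d 1 x = -(x * d 2 1) := fun x => hc _ _ (by simpa [h0] using htx x)
    have e2 : ∀ y, d 2 y = d 2 1 * y := fun y => by
      have := hc _ _ (by simpa [h0] using ht1 y)
      rw [e1 1] at this
      simpa using this.symm
    ext1 j
    ext1 x
    fin_cases j
    · simp [kerElt, h0]
    · simpa [kerElt] using e1 x
    · simpa [kerElt] using e2 x
  · refine ⟨d 0 1, hz 0, ?_⟩
    have h0 : d 1 = 0 := hi
    have e1 : ∀ y, d 0 (conj k Q y) = conj k Q (d 2 y) := fun y => by simpa [h0] using ht1 y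
    have e0 : ∀ x, d 0 x = d 0 1 * x := fun x => by
      have := htx (conj k Q x)
      rw [h0, LinearMap.zero_apply, map_zero, zero_add, hQ.conj_mul', conj_conj, ← e1 1,
        conj_one] at this
      exact this
    have e2 : ∀ x, d 2 x = -(x * d 0 1) := fun x => by
      rw [← conj_conj (k := k) (d 2 x), ← e1, e0, hQ.conj_mul', conj_conj,
        conj_of_mem_traceZero (hz 0), mul_neg]
    ext1 j
    ext1 x
    fin_cases j
    · simpa [kerElt] using e0 x
    · simp [kerElt, h0]
    · simpa [kerElt] using e2 x
  · refine ⟨d 1 1, hz 1, ?_⟩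
    have h0 : d 2 = 0 := hi
    have e1 : ∀ y, d 0 (conj k Q y) = conj k Q (d 1 y) := fun y => by simpa [h0] using htx y
    have e0 : ∀ x, d 0 x = -(x * d 1 1) := fun x => by
      have := ht1 (conj k Q x)
      rw [h0, LinearMap.zero_apply, map_zero, add_zero, hQ.conj_mul', conj_conj,
        conj_of_mem_traceZero (hz 1), mul_neg] at this
      exact this
    have e2 : ∀ x, d 1 x = d 1 1 * x := fun x => by
      rw [← conj_conj (k := k) (d 1 x), ← e1, e0, map_neg, hQ.conj_mul', conj_conj,
        conj_of_mem_traceZero (hz 1), neg_mul, neg_neg]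
    ext1 j
    ext1 x
    fin_cases j
    · simpa [kerElt] using e0 x
    · simpa [kerElt] using e2 x
    · simp [kerElt, h0]

theorem exists_dual_bases (hQ : IsQuaternionAlgebra k Q) : ∃ e f : Fin 4 → Q,
    (∀ z, z = ∑ i, (b z (e i) : k) • f i) ∧ (∀ z, z = ∑ i, (b z (f i) : k) • e i) ∧
      ∀ i, (b (e i) (f i) : k) = 1 := by
  have hpos : 0 < Module.finrank k Q := by simp [hQ.finrank_eq]
  have : FiniteDimensional k Q := FiniteDimensional.of_finrank_pos hpos
  let e := Module.finBasisOfFinrankEq k Q hQ.finrank_eq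
  have hn : LinearMap.BilinForm.Nondegenerate (b : Q →ₗ[k] Q →ₗ[k] k) := b_nondegenerate
  let f := LinearMap.BilinForm.dualBasis (b : Q →ₗ[k] Q →ₗ[k] k) hn e
  have hef : ∀ i j, (b (e i) (f j) : k) = if i = j then 1 else 0 := fun i j => by
    rw [hQ.b_comm]; exact LinearMap.BilinForm.apply_dualBasis_left hn e j i
  refine ⟨e, f, fun z => ?_, fun z => ?_, fun i => by rw [hef, if_pos rfl]⟩
  · conv_lhs => rw [← f.sum_repr z]
    exact Finset.sum_congr rfl fun i _ => by
      rw [LinearMap.BilinForm.dualBasis_repr_apply]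
  · conv_lhs => rw [← e.sum_repr z]
    refine Finset.sum_congr rfl fun i _ => ?_
    congr 1
    have h := congrArg (fun w => (b w (f i) : k)) (e.sum_repr z)
    simp only [map_sum, map_smul, LinearMap.sum_apply, LinearMap.smul_apply, hef] at h
    rw [← h]
    simp

theorem sub_mem_traceZero (h2 : (2 : k) ≠ 0) (hQ : IsQuaternionAlgebra k Q) (x : Q) :
    x - ((2 : k)⁻¹ * b x (1 : Q)) • (1 : Q) ∈ traceZero k Q := by
  have hn : Nontrivial Q := Module.nontrivial_of_finrank_pos (R := k) (by simp [hQ.finrank_eq])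
  rw [mem_traceZero, map_sub, LinearMap.sub_apply, map_smul, LinearMap.smul_apply, smul_eq_mul,
    b_one_one]
  field_simp
  ring

theorem exists_eq_smul_one_add (h2 : (2 : k) ≠ 0) (hQ : IsQuaternionAlgebra k Q) (x : Q) :
    ∃ (α : k), ∃ a ∈ traceZero k Q, x = α • (1 : Q) + a :=
  ⟨_, _, hQ.sub_mem_traceZero h2 x, (add_sub_cancel _ x).symm⟩

theorem smul_sub_smul (h2 : (2 : k) ≠ 0) (hQ : IsQuaternionAlgebra k Q) (x y z : Q) :
    (b x z : k) • y - (b y z : k) • x = z * (conj k Q x * y) - x * conj k Q y * z := by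
  have e1 := congrArg (· * y) (mul_conj_add (k := k) (hQ.even x) (hQ.even z))
  have e2 := congrArg (x * ·) (conj_mul_add (k := k) (hQ.even y) (hQ.even z))
  simp only [mul_zero, sgn_zero, one_smul, smul_mul_assoc, mul_smul_comm, one_mul, mul_one,
    add_mul, mul_add, hQ.assoc h2] at e1 e2 ⊢
  rw [← e1, ← e2]
  abel

/-- Every skew-symmetric map of `Q` is `L_a - R_c` for some `a` and `c` of trace zero. -/
theorem exists_eq_mulLeft_sub_mulRight (h2 : (2 : k) ≠ 0) (hQ : IsQuaternionAlgebra k Q)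
    {d : Module.End k Q} (hd : ∀ x y, (b (d x) y : k) + b x (d y) = 0) :
    ∃ a ∈ traceZero k Q, ∃ c ∈ traceZero k Q,
      d = LinearMap.mulLeft k a - LinearMap.mulRight k c := by
  obtain ⟨e, f, hf, he, -⟩ := hQ.exists_dual_bases
  set l := (2 : k)⁻¹ • ∑ i, e i * conj k Q (d (f i)) with hl
  set r := (2 : k)⁻¹ • ∑ i, conj k Q (e i) * d (f i) with hr
  have hlr : (b l (1 : Q) : k) = b r (1 : Q) := by
    simp only [hl, hr, map_smul, map_sum, LinearMap.smul_apply, LinearMap.sum_apply]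
    congr 1
    refine Finset.sum_congr rfl fun i _ => ?_
    rw [hQ.b_right_adjoint, conj_conj, one_mul, hQ.b_left_adjoint, conj_conj, mul_one, hQ.b_comm]
  have hdz : ∀ z, d z = z * r - l * z := by
    intro z
    have e1 : ∑ i, ((b (e i) z : k) • d (f i) - (b (d (f i)) z : k) • e i) = (2 : k) • d z := by
      rw [Finset.sum_sub_distrib]
      have a1 : ∑ i, (b (e i) z : k) • d (f i) = d z := by
        conv_rhs => rw [hf z]
        simp [map_sum, hQ.b_comm z]
      have a2 : ∑ i, (b (d (f i)) z : k) • e i = -d z := by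
        conv_rhs => rw [he (d z)]
        rw [← Finset.sum_neg_distrib]
        refine Finset.sum_congr rfl fun i _ => ?_
        rw [← neg_smul, eq_neg_of_add_eq_zero_left (hd (f i) z), hQ.b_comm (f i)]
      rw [a1, a2]; module
    simp only [hQ.smul_sub_smul h2, Finset.sum_sub_distrib, ← Finset.mul_sum, ← Finset.sum_mul] at e1
    rw [hr, hl, mul_smul_comm, smul_mul_assoc, ← smul_sub, e1, smul_smul, inv_mul_cancel₀ h2,
      one_smul]
  refine ⟨_, neg_mem (hQ.sub_mem_traceZero h2 l), _, neg_mem (hQ.sub_mem_traceZero h2 r), ?_⟩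
  ext z
  rw [hdz z, hlr]
  simp only [LinearMap.sub_apply, LinearMap.mulLeft_apply, LinearMap.mulRight_apply, sub_mul, mul_sub,
    smul_mul_assoc, mul_smul_comm, one_mul, mul_one, neg_mul, mul_neg]
  abel

/-- A linear map that maps `L_a` to `a` and `R_a` to zero, for `a` of trace zero. -/
theorem exists_leftPart (h2 : (2 : k) ≠ 0) (hQ : IsQuaternionAlgebra k Q) :
    ∃ l : Module.End k Q →ₗ[k] Q, ∀ a ∈ traceZero k Q,
      l (LinearMap.mulLeft k a) = a ∧ l (LinearMap.mulRight k a) = 0 := by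
  obtain ⟨e, f, hf, he, hef⟩ := hQ.exists_dual_bases
  have hω : ∑ i, e i * conj k Q (f i) = (2 : k) • (1 : Q) := by
    have s1 : ∑ i, f i * conj k Q (e i) = ∑ i, e i * conj k Q (f i) := by
      calc ∑ i, f i * conj k Q (e i)
          = ∑ i, ∑ j, (b (f i) (f j) : k) • (e j * conj k Q (e i)) := by
            refine Finset.sum_congr rfl fun i _ => ?_
            conv_lhs => rw [he (f i), Finset.sum_mul]
            simp only [smul_mul_assoc]
        _ = ∑ j, ∑ i, (b (f i) (f j) : k) • (e j * conj k Q (e i)) := Finset.sum_comm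
        _ = ∑ i, e i * conj k Q (f i) := by
            refine Finset.sum_congr rfl fun j _ => ?_
            conv_rhs => rw [he (f j), map_sum, Finset.mul_sum]
            simp only [map_smul, mul_smul_comm, hQ.b_comm (f j)]
    have s2 : (2 : k) • ∑ i, e i * conj k Q (f i) = (2 : k) • (2 : k) • (1 : Q) := by
      have s3 : ∑ i, e i * conj k Q (f i) + ∑ i, f i * conj k Q (e i) = ∑ _i : Fin 4, (1 : Q) := by
        rw [← Finset.sum_add_distrib]
        refine Finset.sum_congr rfl fun i _ => ?_
        have h := mul_conj_add (k := k) (hQ.even (e i)) (hQ.even (f i))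
        rw [hef] at h
        simpa using h
      rw [s1, ← two_smul k] at s3
      rw [s3, Fin.sum_univ_four]
      module
    exact smul_right_injective Q h2 s2
  have hω' : ∑ i, conj k Q (e i) * conj k Q (f i) = -1 := by
    simp only [conj_apply (k := k) (e _), sub_mul, smul_mul_assoc, one_mul, Finset.sum_sub_distrib,
      hω]
    have := congrArg (conj k Q) (hf 1)
    rw [conj_one, map_sum] at this
    simp only [map_smul, b_one_left] at this
    rw [← this]
    module
  have hmem : ∀ a ∈ traceZero k Q, ∀ x : Q, x * a = a * conj k Q x - (b x a : k) • 1 := by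
    intro a ha x
    have h := hQ.mul_add_mul' x a
    rw [mem_traceZero.1 ha] at h
    rw [conj_apply, mul_sub, mul_smul_comm, mul_one]
    linear_combination (norm := module) h
  refine ⟨(2 : k)⁻¹ • ∑ i, LinearMap.mulRight k (conj k Q (f i)) ∘ₗ LinearMap.applyₗ (e i),
    fun a ha => ⟨?_, ?_⟩⟩
  · simp only [LinearMap.smul_apply, LinearMap.sum_apply, LinearMap.comp_apply,
      LinearMap.applyₗ_apply_apply, LinearMap.mulLeft_apply, LinearMap.mulRight_apply, hQ.assoc h2,
      ← Finset.mul_sum, hω]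
    rw [mul_smul_comm, mul_one, smul_smul, inv_mul_cancel₀ h2, one_smul]
  · simp only [LinearMap.smul_apply, LinearMap.sum_apply, LinearMap.comp_apply,
      LinearMap.applyₗ_apply_apply, LinearMap.mulRight_apply, hmem a ha, sub_mul, hQ.assoc h2,
      smul_mul_assoc, one_mul, Finset.sum_sub_distrib, ← Finset.mul_sum, hω']
    have := congrArg (conj k Q) (hf a)
    rw [map_sum, conj_of_mem_traceZero ha] at this
    simp only [map_smul, hQ.b_comm a] at this
    rw [← this]
    simp

theorem mem_tri_and_apply_eq_zero_iff (h2 : (2 : k) ≠ 0) (hQ : IsQuaternionAlgebra k Q) (i : Fin 3)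
    (d : Fin 3 → Module.End k Q) :
    (d ∈ tri (paraMulOp k Q) b ∧ d i = 0) ↔ ∃ a ∈ traceZero k Q, d = kerElt k a i := by
  constructor
  · rintro ⟨hd, hi⟩
    exact hQ.eq_kerElt_of_apply_eq_zero h2 hd hi
  · rintro ⟨a, ha, rfl⟩
    refine ⟨hQ.kerElt_mem_tri h2 ha i, ?_⟩
    fin_cases i <;> rfl


/-! ### Sums of the elements of the kernels -/

theorem kerElt_self (a : Q) (i : Fin 3) : kerElt k a i i = 0 := by fin_cases i <;> rfl

theorem kerElt_one (a : Q) (i : Fin 3) : kerElt k a i (i + 1) = -LinearMap.mulRight k a := by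
  fin_cases i <;> rfl

theorem kerElt_two (a : Q) (i : Fin 3) : kerElt k a i (i + 2) = LinearMap.mulLeft k a := by
  fin_cases i <;> rfl

theorem kerElt_zero (a : Q) (i : Fin 3) : kerElt k a (i + 2) i = -LinearMap.mulRight k a := by
  fin_cases i <;> rfl

theorem kerElt_zero' (a : Q) (i : Fin 3) : kerElt k a (i + 1) i = LinearMap.mulLeft k a := by
  fin_cases i <;> rfl

theorem exists_eq_sum_kerElt (h2 : (2 : k) ≠ 0) (hQ : IsQuaternionAlgebra k Q)
    {d : Fin 3 → Module.End k Q} (hd : d ∈ tri (paraMulOp k Q) (b : Q →ₗ[k] Q →ₗ[k] k)) :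
    ∃ a : Fin 3 → Q, (∀ i, a i ∈ traceZero k Q) ∧ d = ∑ i, kerElt k (a i) i := by
  obtain ⟨a, ha, c, hc, h⟩ := hQ.exists_eq_mulLeft_sub_mulRight h2 (d := d 0)
    ((hQ.mem_tri.1 hd).1 0)
  obtain ⟨e, he, h'⟩ := hQ.eq_kerElt_of_apply_eq_zero h2 (i := 0)
    (sub_mem (sub_mem hd (hQ.kerElt_mem_tri h2 ha 1)) (hQ.kerElt_mem_tri h2 hc 2)) (by
      rw [Pi.sub_apply, Pi.sub_apply, h]
      have e1 : kerElt k a 1 0 = LinearMap.mulLeft k a := rfl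
      have e2 : kerElt k c 2 0 = -LinearMap.mulRight k c := rfl
      rw [e1, e2]; abel)
  refine ⟨![e, a, c], fun i => by fin_cases i <;> assumption, ?_⟩
  rw [Fin.sum_univ_three]
  simp only [Matrix.cons_val]
  rw [← h']
  abel

variable (k) in
/-- `kerElt k a i` as a linear function of `a`. -/
def kerLin (i : Fin 3) : Q →ₗ[k] Fin 3 → Module.End k Q where
  toFun a := kerElt k a i
  map_add' a c := by
    ext j x
    fin_cases i <;> fin_cases j <;> simp [kerElt, add_mul, mul_add, add_comm]
  map_smul' r a := by
    ext j x
    fin_cases i <;> fin_cases j <;> simp [kerElt, smul_mul_assoc, mul_smul_comm]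

theorem kerLin_apply (i : Fin 3) (a : Q) : kerLin k i a = kerElt k a i := rfl

theorem superComm_kerElt_self (h2 : (2 : k) ≠ 0) (hQ : IsQuaternionAlgebra k Q) (a c : Q)
    (i j : Fin 3) : superComm k Q (kerElt k a i j) (kerElt k c i j) =
      kerElt k (a * c - c * a) i j := by
  rw [superComm_of_mem (hQ.even_end _) (hQ.even_end _)]
  ext x
  rcases fin3_cases i j with rfl | rfl | rfl
  · simp [kerElt_self]
  · simp [kerElt_one, hQ.assoc h2, mul_sub]
  · simp [kerElt_two, hQ.assoc h2, sub_mul]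

theorem superComm_kerElt_of_ne (h2 : (2 : k) ≠ 0) (hQ : IsQuaternionAlgebra k Q) (a c : Q)
    {i i' : Fin 3} (hi : i ≠ i') (j : Fin 3) :
    superComm k Q (kerElt k a i j) (kerElt k c i' j) = 0 := by
  rw [superComm_of_mem (hQ.even_end _) (hQ.even_end _)]
  ext x
  fin_cases i <;> fin_cases i' <;> fin_cases j <;>
    first | exact absurd rfl hi | simp [kerElt, hQ.assoc h2]

theorem theta_kerElt (a : Q) (i j : Fin 3) : theta i (kerElt k a j) = kerElt k a (j + i) := by
  ext1 l
  fin_cases i <;> fin_cases j <;> fin_cases l <;> rfl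

/-- `t_{x,y}` for `x = α 1 + a` and `y = γ 1 + c`. -/
theorem tElt_paraMulOp (h2 : (2 : k) ≠ 0) (hQ : IsQuaternionAlgebra k Q) (α γ : k) {a c : Q}
    (ha : a ∈ traceZero k Q) (hc : c ∈ traceZero k Q) :
    tElt (paraMulOp k Q) b (α • 1 + a) (γ • 1 + c) =
      kerElt k (γ • a - α • c + (2 : k)⁻¹ • (a * c - c * a)) 2 +
      kerElt k (α • c - γ • a + (2 : k)⁻¹ • (a * c - c * a)) 1 := by
  have hn : Nontrivial Q := Module.nontrivial_of_finrank_pos (R := k) (by simp [hQ.finrank_eq])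
  have hac := hQ.mul_add_mul_of_traceZero ha hc
  have hx : conj k Q (α • 1 + a) = α • 1 - a := by
    rw [map_add, map_smul, conj_one, conj_of_mem_traceZero ha, sub_eq_add_neg]
  have hy : conj k Q (γ • 1 + c) = γ • 1 - c := by
    rw [map_add, map_smul, conj_one, conj_of_mem_traceZero hc, sub_eq_add_neg]
  have hb : (b (α • 1 + a) (γ • 1 + c) : k) = 2 * α * γ + b a c := by
    simp only [map_add, map_smul, LinearMap.add_apply, LinearMap.smul_apply, smul_eq_mul, b_one_one,
      b_one_left c, mem_traceZero.1 ha, mem_traceZero.1 hc]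
    ring
  have hzr := fun z : Q => congrArg (z * ·) hac
  have hzl := fun z : Q => congrArg (· * z) hac
  simp only [mul_add, add_mul, mul_neg, neg_mul, mul_smul_comm, smul_mul_assoc, mul_one,
    one_mul, hQ.assoc h2] at hzr hzl
  ext j z
  rw [Pi.add_apply, LinearMap.add_apply]
  fin_cases j
  · have h := hQ.smul_sub_smul h2 (α • 1 + a) (γ • 1 + c) z
    rw [hx, hy] at h
    change tElt (paraMulOp k Q) b (α • 1 + a) (γ • 1 + c) 0 z = -(z * _) + _ * z
    rw [tElt_zero, sigma_of_mem _ (hQ.even _) (hQ.even _) (hQ.even z), mul_zero, zero_mul, sgn_zero,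
      one_smul, one_smul, h]
    simp only [mul_add, add_mul, mul_sub, sub_mul, mul_smul_comm, smul_mul_assoc, mul_one, one_mul,
      hQ.assoc h2]
    linear_combination (norm := skip) (-(2 : k)⁻¹) • hzr z + (2 : k)⁻¹ • hzl z
    match_scalars <;> field_simp <;> ring
  · change tElt (paraMulOp k Q) b (α • 1 + a) (γ • 1 + c) 1 z = _ * z + (0 : Q)
    rw [tElt_one, superFlip_of_mem _ (hQ.even _) (hQ.even _), mul_zero, sgn_zero, one_smul,
      paraMulOp_apply, paraMulOp_apply, hQ.conj_mul' (conj k Q _), conj_conj, hx, hb]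
    simp only [add_mul, mul_add, sub_mul, smul_mul_assoc, mul_smul_comm, one_mul, hQ.assoc h2]
    linear_combination (norm := skip) (2 : k)⁻¹ • hzl z
    match_scalars <;> field_simp <;> ring
  · change tElt (paraMulOp k Q) b (α • 1 + a) (γ • 1 + c) 2 z = (0 : Q) + -(z * _)
    rw [tElt_two, superFlip_of_mem _ (hQ.even _) (hQ.even _), mul_zero, sgn_zero, one_smul,
      paraMulOp_apply, paraMulOp_apply, hQ.conj_mul' _ (conj k Q _), conj_conj, hx, hb]
    simp only [add_mul, mul_add, mul_sub, smul_mul_assoc, mul_smul_comm, mul_one, hQ.assoc h2]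
    linear_combination (norm := skip) (2 : k)⁻¹ • hzr z
    match_scalars <;> field_simp <;> ring

end IsQuaternionAlgebra

/-! ### The bracket of `g(A, B)` as a bilinear map -/

section Magic

variable {k A B : Type*} [Field k] [AddCommGroup A] [Module k A] [Superspace k A]
  [AddCommGroup B] [Module k B] [Superspace k B]

variable (k A B) in
/-- `rightAct` as a bilinear map. -/
noncomputable def rightActLin : Module.End k B →ₗ[k] A ⊗[k] B →ₗ[k] A ⊗[k] B :=
  ∑ p : ZMod 2, ∑ q : ZMod 2, sgn k (p * q) •
    (TensorProduct.mapBilinear (RingHom.id k) A B A B (proj (k := k) q)) ∘ₗ proj (k := k) p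

theorem rightActLin_apply (d : Module.End k B) (z : A ⊗[k] B) :
    rightActLin k A B d z = rightAct d z := by
  simp [rightActLin, rightAct, LinearMap.sum_apply]

/-- `tensorMul` as a bilinear map. -/
noncomputable def tensorMulLin (m : A →ₗ[k] A →ₗ[k] A) (m' : B →ₗ[k] B →ₗ[k] B) :
    A ⊗[k] B →ₗ[k] A ⊗[k] B →ₗ[k] A ⊗[k] B :=
  ∑ p : ZMod 2, ∑ q : ZMod 2, sgn k (p * q) •
    TensorProduct.map₂ (m.compl₂ (proj (k := k) q)) (m' ∘ₗ proj (k := k) p)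

theorem tensorMulLin_apply (m : A →ₗ[k] A →ₗ[k] A) (m' : B →ₗ[k] B →ₗ[k] B) (z w : A ⊗[k] B) :
    tensorMulLin m m' z w = tensorMul m m' z w := by
  simp [tensorMulLin, tensorMul, LinearMap.sum_apply]

/-- `tensorTriLeft` as a bilinear map. -/
noncomputable def tensorTriLeftLin (m : A →ₗ[k] A →ₗ[k] A) (β : A →ₗ[k] A →ₗ[k] k)
    (β' : B →ₗ[k] B →ₗ[k] k) :
    A ⊗[k] B →ₗ[k] A ⊗[k] B →ₗ[k] (Fin 3 → Module.End k A) :=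
  ∑ x : ZMod 2, ∑ x' : ZMod 2, ∑ y : ZMod 2, ∑ y' : ZMod 2,
    sgn k (x * x' + x * y' + y * y') •
      ((TensorProduct.map₂ (tElt m β) β').compr₂
        (TensorProduct.rid k (Fin 3 → Module.End k A)).toLinearMap).compl₁₂
        (TensorProduct.map (proj (k := k) x) (proj (k := k) x'))
        (TensorProduct.map (proj (k := k) y) (proj (k := k) y'))

theorem tensorTriLeftLin_apply (m : A →ₗ[k] A →ₗ[k] A) (β : A →ₗ[k] A →ₗ[k] k)
    (β' : B →ₗ[k] B →ₗ[k] k) (z w : A ⊗[k] B) :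
    tensorTriLeftLin m β β' z w = tensorTriLeft m β β' z w := by
  simp only [tensorTriLeftLin, tensorTriLeft, LinearMap.sum_apply, LinearMap.smul_apply,
    LinearMap.compl₁₂_apply, LinearMap.compr₂_apply, LinearEquiv.coe_coe, biproj]

/-- `tensorTriRight` as a bilinear map. -/
noncomputable def tensorTriRightLin (β : A →ₗ[k] A →ₗ[k] k) (m' : B →ₗ[k] B →ₗ[k] B)
    (β' : B →ₗ[k] B →ₗ[k] k) :
    A ⊗[k] B →ₗ[k] A ⊗[k] B →ₗ[k] (Fin 3 → Module.End k B) :=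
  ∑ x : ZMod 2, ∑ x' : ZMod 2, ∑ y : ZMod 2, ∑ y' : ZMod 2,
    sgn k (y * x') •
      ((TensorProduct.map₂ β (tElt m' β')).compr₂
        (TensorProduct.lid k (Fin 3 → Module.End k B)).toLinearMap).compl₁₂
        (TensorProduct.map (proj (k := k) x) (proj (k := k) x'))
        (TensorProduct.map (proj (k := k) y) (proj (k := k) y'))

theorem tensorTriRightLin_apply (β : A →ₗ[k] A →ₗ[k] k) (m' : B →ₗ[k] B →ₗ[k] B)
    (β' : B →ₗ[k] B →ₗ[k] k) (z w : A ⊗[k] B) :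
    tensorTriRightLin β m' β' z w = tensorTriRight β m' β' z w := by
  simp only [tensorTriRightLin, tensorTriRight, LinearMap.sum_apply, LinearMap.smul_apply,
    LinearMap.compl₁₂_apply, LinearMap.compr₂_apply, LinearEquiv.coe_coe, biproj]

section Homogeneous

variable {p q p' q' : ZMod 2} {a c : A} {x y : B}

theorem rightAct_tmul {d : Module.End k B} (hd : d ∈ part k (Module.End k B) p)
    (ha : a ∈ part k A q) (x : B) :
    rightAct d (a ⊗ₜ[k] x) = sgn k (p * q) • a ⊗ₜ[k] d x := by
  simp only [rightAct, sum_two, TensorProduct.map_tmul, proj_eq_ite _ hd, proj_eq_ite _ ha]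
  rcases parity_cases p with rfl | rfl <;> rcases parity_cases q with rfl | rfl <;> simp

theorem tensorMul_tmul (m : A →ₗ[k] A →ₗ[k] A) (m' : B →ₗ[k] B →ₗ[k] B) (a : A)
    (hx : x ∈ part k B p) (hc : c ∈ part k A q) (y : B) :
    tensorMul m m' (a ⊗ₜ[k] x) (c ⊗ₜ[k] y) = sgn k (p * q) • m a c ⊗ₜ[k] m' x y := by
  simp only [tensorMul, sum_two, TensorProduct.map₂_apply_tmul,
    LinearMap.comp_apply, proj_eq_ite _ hx]
  rcases parity_cases p with rfl | rfl <;> rcases parity_cases q with rfl | rfl <;>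
    simp [proj_eq_ite _ hc]

theorem tensorTriLeft_tmul (m : A →ₗ[k] A →ₗ[k] A) (β : A →ₗ[k] A →ₗ[k] k)
    (β' : B →ₗ[k] B →ₗ[k] k) (ha : a ∈ part k A p) (hx : x ∈ part k B p') (hc : c ∈ part k A q)
    (hy : y ∈ part k B q') :
    tensorTriLeft m β β' (a ⊗ₜ[k] x) (c ⊗ₜ[k] y) =
      sgn k (p * p' + p * q' + q * q') • β' x y • tElt m β a c := by
  simp only [tensorTriLeft, biproj, sum_two, TensorProduct.map_tmul,
    proj_eq_ite _ hx, proj_eq_ite _ hc, proj_eq_ite _ ha, proj_eq_ite _ hy]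
  rcases parity_cases p with rfl | rfl <;> rcases parity_cases q with rfl | rfl <;>
    rcases parity_cases p' with rfl | rfl <;> rcases parity_cases q' with rfl | rfl <;>
    simp [TensorProduct.map₂_apply_tmul]

theorem tensorTriRight_tmul (β : A →ₗ[k] A →ₗ[k] k) (m' : B →ₗ[k] B →ₗ[k] B)
    (β' : B →ₗ[k] B →ₗ[k] k) (ha : a ∈ part k A p) (hx : x ∈ part k B p') (hc : c ∈ part k A q)
    (hy : y ∈ part k B q') :
    tensorTriRight β m' β' (a ⊗ₜ[k] x) (c ⊗ₜ[k] y) =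
      sgn k (q * p') • β a c • tElt m' β' x y := by
  simp only [tensorTriRight, biproj, sum_two, TensorProduct.map_tmul,
    proj_eq_ite _ hx, proj_eq_ite _ hc, proj_eq_ite _ ha, proj_eq_ite _ hy]
  rcases parity_cases p with rfl | rfl <;> rcases parity_cases q with rfl | rfl <;>
    rcases parity_cases p' with rfl | rfl <;> rcases parity_cases q' with rfl | rfl <;>
    simp [TensorProduct.map₂_apply_tmul]

end Homogeneous

/-- `theta` as a linear map. -/
def thetaLin (k A : Type*) [Field k] [AddCommGroup A] [Module k A] (n : Fin 3) :
    (Fin 3 → Module.End k A) →ₗ[k] (Fin 3 → Module.End k A) where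
  toFun := theta n
  map_add' _ _ := rfl
  map_smul' _ _ := rfl

theorem thetaLin_apply (n : Fin 3) (d : Fin 3 → Module.End k A) :
    thetaLin k A n d = theta n d := rfl

/-- `magicOrdered` as a bilinear map. -/
noncomputable def magicOrderedLin (m : A →ₗ[k] A →ₗ[k] A) (m' : B →ₗ[k] B →ₗ[k] B) :
    MagicSpace k A B →ₗ[k] MagicSpace k A B →ₗ[k] MagicSpace k A B :=
  LinearMap.mk₂ k (magicOrdered m m')
    (fun u u' v => by
      refine Prod.ext (by simp [magicOrdered]) (Prod.ext (by simp [magicOrdered]) (funext fun i => ?_))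
      simp only [magicOrdered, ← rightActLin_apply, ← tensorMulLin_apply, Prod.fst_add, Prod.snd_add,
        Pi.add_apply, map_add, LinearMap.add_apply, LinearMap.rTensor_add]
      abel)
    (fun c u v => by
      refine Prod.ext (by simp [magicOrdered]) (Prod.ext (by simp [magicOrdered]) (funext fun i => ?_))
      simp only [magicOrdered, ← rightActLin_apply, ← tensorMulLin_apply, Prod.smul_fst,
        Prod.smul_snd, Pi.smul_apply, map_smul, LinearMap.smul_apply, LinearMap.rTensor_smul,
        smul_add])
    (fun u v v' => by
      refine Prod.ext (by simp [magicOrdered]) (Prod.ext (by simp [magicOrdered]) (funext fun i => ?_))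
      simp only [magicOrdered, ← rightActLin_apply, ← tensorMulLin_apply, Prod.snd_add,
        Pi.add_apply, map_add]
      abel)
    (fun c u v => by
      refine Prod.ext (by simp [magicOrdered]) (Prod.ext (by simp [magicOrdered]) (funext fun i => ?_))
      simp only [magicOrdered, ← rightActLin_apply, ← tensorMulLin_apply,
        Prod.smul_snd, Pi.smul_apply, map_smul, smul_add])

/-- The bracket of `g(A, B)` as a bilinear map. -/
noncomputable def magicLin (m : A →ₗ[k] A →ₗ[k] A) (β : A →ₗ[k] A →ₗ[k] k)
    (m' : B →ₗ[k] B →ₗ[k] B) (β' : B →ₗ[k] B →ₗ[k] k) :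
    MagicSpace k A B →ₗ[k] MagicSpace k A B →ₗ[k] MagicSpace k A B :=
  LinearMap.mk₂ k (fun u v =>
    (fun j => superComm k A (u.1 j) (v.1 j), fun j => superComm k B (u.2.1 j) (v.2.1 j), 0)
    + (∑ i, thetaLin k A i (tensorTriLeftLin m β β' (u.2.2 i) (v.2.2 i)),
      ∑ i, thetaLin k B i (tensorTriRightLin β m' β' (u.2.2 i) (v.2.2 i)), 0))
    (fun u u' v => by
      refine Prod.ext (funext fun j => ?_) (Prod.ext (funext fun j => ?_) (by simp)) <;>
      simp only [Prod.fst_add, Prod.snd_add, Pi.add_apply, map_add, LinearMap.add_apply,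
        Finset.sum_add_distrib] <;>
      abel)
    (fun c u v => by
      refine Prod.ext (funext fun j => ?_) (Prod.ext (funext fun j => ?_) (by simp)) <;>
      simp only [Prod.fst_add, Prod.snd_add, Prod.smul_fst, Prod.smul_snd, Pi.add_apply,
        Pi.smul_apply, map_smul, LinearMap.smul_apply, ← Finset.smul_sum, smul_add])
    (fun u v v' => by
      refine Prod.ext (funext fun j => ?_) (Prod.ext (funext fun j => ?_) (by simp)) <;>
      simp only [Prod.fst_add, Prod.snd_add, Pi.add_apply, map_add,
        Finset.sum_add_distrib] <;>
      abel)
    (fun c u v => by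
      refine Prod.ext (funext fun j => ?_) (Prod.ext (funext fun j => ?_) (by simp)) <;>
      simp only [Prod.fst_add, Prod.snd_add, Prod.smul_fst, Prod.smul_snd, Pi.add_apply,
        Pi.smul_apply, map_smul, ← Finset.smul_sum, smul_add])
  + (magicOrderedLin m m' - superFlip (magicOrderedLin m m'))

theorem magicBracket_eq (m : A →ₗ[k] A →ₗ[k] A) (β : A →ₗ[k] A →ₗ[k] k)
    (m' : B →ₗ[k] B →ₗ[k] B) (β' : B →ₗ[k] B →ₗ[k] k) :
    magicBracket m β m' β' = fun u v => magicLin m β m' β' u v := by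
  ext1 u
  ext1 v
  rw [magicLin, LinearMap.add_apply, LinearMap.add_apply, ← superSkew_eq, LinearMap.mk₂_apply]
  simp only [tensorTriLeftLin_apply, tensorTriRightLin_apply, thetaLin_apply]
  rfl

theorem magicLin_of_mem (m : A →ₗ[k] A →ₗ[k] A) (β : A →ₗ[k] A →ₗ[k] k)
    (m' : B →ₗ[k] B →ₗ[k] B) (β' : B →ₗ[k] B →ₗ[k] k) {p q : ZMod 2} {u v : MagicSpace k A B}
    (hu : u ∈ part k _ p) (hv : v ∈ part k _ q) :
    magicLin m β m' β' u v =
    (fun j => superComm k A (u.1 j) (v.1 j), fun j => superComm k B (u.2.1 j) (v.2.1 j), 0)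
    + (∑ i, thetaLin k A i (tensorTriLeftLin m β β' (u.2.2 i) (v.2.2 i)),
      ∑ i, thetaLin k B i (tensorTriRightLin β m' β' (u.2.2 i) (v.2.2 i)), 0)
    + (magicOrderedLin m m' u v - sgn k (p * q) • magicOrderedLin m m' v u) := by
  rw [magicLin, LinearMap.add_apply, LinearMap.add_apply, sub_superFlip_of_mem _ hu hv,
    LinearMap.mk₂_apply]

end Magic

section MagicTable

variable {k A B : Type*} [Field k] [AddCommGroup A] [Module k A] [Superspace k A]
  [AddCommGroup B] [Module k B] [Superspace k B]

variable (k A B) in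
/-- The triples of endomorphisms of `A` in `g(A, B)`. -/
def magicL : (Fin 3 → Module.End k A) →ₗ[k] MagicSpace k A B := LinearMap.inl k _ _

variable (k A B) in
/-- The triples of endomorphisms of `B` in `g(A, B)`. -/
def magicR : (Fin 3 → Module.End k B) →ₗ[k] MagicSpace k A B :=
  LinearMap.inr k _ _ ∘ₗ LinearMap.inl k _ _

variable (k A B) in
/-- `ιᵢ : A ⊗ B → g(A, B)`. -/
def magicI (i : Fin 3) : A ⊗[k] B →ₗ[k] MagicSpace k A B :=
  LinearMap.inr k _ _ ∘ₗ LinearMap.inr k _ _ ∘ₗ LinearMap.single k (fun _ : Fin 3 => A ⊗[k] B) i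

theorem magicL_apply (d : Fin 3 → Module.End k A) : magicL k A B d = (d, 0, 0) := rfl

theorem magicR_apply (d : Fin 3 → Module.End k B) : magicR k A B d = (0, d, 0) := rfl

theorem magicI_apply (i : Fin 3) (z : A ⊗[k] B) : magicI k A B i z = (0, 0, Pi.single i z) := rfl

theorem magicL_mem {p : ZMod 2} {d : Fin 3 → Module.End k A}
    (hd : ∀ i, d i ∈ part k (Module.End k A) p) : magicL k A B d ∈ part k (MagicSpace k A B) p :=
  mem_part_prod.2 ⟨mem_part_pi.2 hd, zero_mem _⟩

theorem magicR_mem {p : ZMod 2} {d : Fin 3 → Module.End k B}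
    (hd : ∀ i, d i ∈ part k (Module.End k B) p) : magicR k A B d ∈ part k (MagicSpace k A B) p :=
  mem_part_prod.2 ⟨zero_mem _, mem_part_prod.2 ⟨mem_part_pi.2 hd, zero_mem _⟩⟩

theorem magicI_mem {p : ZMod 2} (i : Fin 3) {z : A ⊗[k] B} (hz : z ∈ part k (A ⊗[k] B) p) :
    magicI k A B i z ∈ part k (MagicSpace k A B) p := by
  refine mem_part_prod.2 ⟨zero_mem _, mem_part_prod.2 ⟨zero_mem _, mem_part_pi.2 fun j => ?_⟩⟩
  rw [magicI_apply]
  change (Pi.single i z : Fin 3 → A ⊗[k] B) j ∈ _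
  rcases eq_or_ne j i with rfl | h
  · rwa [Pi.single_eq_same]
  · rw [Pi.single_eq_of_ne h]; exact zero_mem _

theorem eq_magicL_add (u : MagicSpace k A B) :
    u = magicL k A B u.1 + magicR k A B u.2.1 + ∑ i, magicI k A B i (u.2.2 i) := by
  refine Prod.ext ?_ (Prod.ext ?_ ?_)
  · simp [magicL_apply, magicR_apply, magicI_apply, Prod.fst_sum]
  · simp [magicL_apply, magicR_apply, magicI_apply, Prod.fst_sum, Prod.snd_sum]
  · simp [magicL_apply, magicR_apply, magicI_apply, Prod.snd_sum, Finset.univ_sum_single]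

section Ordered

variable (m : A →ₗ[k] A →ₗ[k] A) (m' : B →ₗ[k] B →ₗ[k] B)

theorem magicOrderedLin_apply (u v : MagicSpace k A B) :
    magicOrderedLin m m' u v = (0, 0, fun i => (u.1 i).rTensor B (v.2.2 i)
      + rightActLin k A B (u.2.1 i) (v.2.2 i) + tensorMulLin m m' (u.2.2 (i + 1)) (v.2.2 (i + 2))) := by
  simp only [rightActLin_apply, tensorMulLin_apply]
  rfl

theorem magicOrderedLin_of_eq_zero (u : MagicSpace k A B) {v : MagicSpace k A B} (hv : v.2.2 = 0) :
    magicOrderedLin m m' u v = 0 := by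
  rw [magicOrderedLin_apply, hv]
  simp
  rfl

theorem magicOrderedLin_L_I (d : Fin 3 → Module.End k A) (i : Fin 3) (z : A ⊗[k] B) :
    magicOrderedLin m m' (magicL k A B d) (magicI k A B i z) = magicI k A B i ((d i).rTensor B z) := by
  rw [magicOrderedLin_apply]
  refine Prod.ext rfl (Prod.ext rfl (funext fun j => ?_))
  rcases eq_or_ne j i with rfl | h
  · simp [magicL_apply, magicI_apply]
  · simp [magicL_apply, magicI_apply, h]

theorem magicOrderedLin_R_I (d : Fin 3 → Module.End k B) (i : Fin 3) (z : A ⊗[k] B) :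
    magicOrderedLin m m' (magicR k A B d) (magicI k A B i z) =
      magicI k A B i (rightAct (d i) z) := by
  rw [magicOrderedLin_apply, ← rightActLin_apply]
  refine Prod.ext rfl (Prod.ext rfl (funext fun j => ?_))
  rcases eq_or_ne j i with rfl | h
  · simp [magicR_apply, magicI_apply]
  · simp [magicR_apply, magicI_apply, h]

theorem magicOrderedLin_I_I_succ (i : Fin 3) (z w : A ⊗[k] B) :
    magicOrderedLin m m' (magicI k A B i z) (magicI k A B (i + 1) w) =
      magicI k A B (i + 2) (tensorMul m m' z w) := by
  rw [magicOrderedLin_apply, ← tensorMulLin_apply]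
  refine Prod.ext rfl (Prod.ext rfl (funext fun j => ?_))
  rcases fin3_cases i j with rfl | rfl | rfl <;> simp [magicI_apply, add_assoc]

theorem magicOrderedLin_I_I_of_ne {i j : Fin 3} (h : j ≠ i + 1) (z w : A ⊗[k] B) :
    magicOrderedLin m m' (magicI k A B i z) (magicI k A B j w) = 0 := by
  rw [magicOrderedLin_apply]
  refine Prod.ext rfl (Prod.ext rfl (funext fun l => ?_))
  rcases eq_or_ne (l + 1) i with rfl | h'
  · have h'' : l + 2 ≠ j := fun e => h (by rw [← e, fin3_one_one])
    simp [magicI_apply, Pi.single_eq_of_ne h'']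
  · simp [magicI_apply, Pi.single_eq_of_ne h']

end Ordered

section Bracket

variable (m : A →ₗ[k] A →ₗ[k] A) (β : A →ₗ[k] A →ₗ[k] k) (m' : B →ₗ[k] B →ₗ[k] B)
  (β' : B →ₗ[k] B →ₗ[k] k) {p q : ZMod 2} {d e : Fin 3 → Module.End k A}
  {d' e' : Fin 3 → Module.End k B} {a c : A} {x y : B}

theorem magicLin_skew {u v : MagicSpace k A B} (hu : u ∈ part k _ p) (hv : v ∈ part k _ q)
    (h : ∀ i, u.2.2 i = 0 ∨ v.2.2 i = 0) :
    magicLin m β m' β' u v = -(sgn k (p * q) • magicLin m β m' β' v u) := by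
  have e := sgn_mul_self (k := k) (p * q)
  have h1 : ∀ i, tensorTriLeftLin m β β' (u.2.2 i) (v.2.2 i) = 0 := fun i => by
    rcases h i with h | h <;> simp [h]
  have h2 : ∀ i, tensorTriLeftLin m β β' (v.2.2 i) (u.2.2 i) = 0 := fun i => by
    rcases h i with h | h <;> simp [h]
  have h3 : ∀ i, tensorTriRightLin β m' β' (u.2.2 i) (v.2.2 i) = 0 := fun i => by
    rcases h i with h | h <;> simp [h]
  have h4 : ∀ i, tensorTriRightLin β m' β' (v.2.2 i) (u.2.2 i) = 0 := fun i => by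
    rcases h i with h | h <;> simp [h]
  have hu1 := mem_part_prod.1 hu
  have hu2 := mem_part_prod.1 hu1.2
  have hv1 := mem_part_prod.1 hv
  have hv2 := mem_part_prod.1 hv1.2
  have hA : (fun j => superComm k A (u.1 j) (v.1 j)) =
      -(sgn k (p * q) • fun j => superComm k A (v.1 j) (u.1 j)) := funext fun j =>
    superComm_skew (mem_part_pi.1 hu1.1 j) (mem_part_pi.1 hv1.1 j)
  have hB : (fun j => superComm k B (u.2.1 j) (v.2.1 j)) =
      -(sgn k (p * q) • fun j => superComm k B (v.2.1 j) (u.2.1 j)) := funext fun j =>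
    superComm_skew (mem_part_pi.1 hu2.1 j) (mem_part_pi.1 hv2.1 j)
  have hAB : ((fun j => superComm k A (u.1 j) (v.1 j), fun j => superComm k B (u.2.1 j) (v.2.1 j), 0)
      : MagicSpace k A B) = -(sgn k (p * q) •
      (fun j => superComm k A (v.1 j) (u.1 j), fun j => superComm k B (v.2.1 j) (u.2.1 j), 0)) := by
    rw [hA, hB]
    refine Prod.ext rfl (Prod.ext rfl ?_)
    simp
  rw [magicLin_of_mem m β m' β' hu hv, magicLin_of_mem m β m' β' hv hu, hAB]
  simp only [h1, h2, h3, h4, map_zero, Finset.sum_const_zero, mul_comm q p]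
  rw [← Prod.zero_eq_mk, ← Prod.zero_eq_mk, smul_add, smul_add, smul_sub, smul_smul, e]
  module

theorem magicLin_L_L (hd : ∀ i, d i ∈ part k (Module.End k A) p)
    (he : ∀ i, e i ∈ part k (Module.End k A) q) :
    magicLin m β m' β' (magicL k A B d) (magicL k A B e) =
      magicL k A B fun i => superComm k A (d i) (e i) := by
  rw [magicLin_of_mem m β m' β' (magicL_mem hd) (magicL_mem he),
    magicOrderedLin_of_eq_zero m m' _ rfl, magicOrderedLin_of_eq_zero m m' _ rfl]
  refine Prod.ext ?_ (Prod.ext ?_ ?_)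
  · simp [magicL_apply]
  · ext; simp [magicL_apply]
  · simp [magicL_apply]

theorem magicLin_R_R (hd : ∀ i, d' i ∈ part k (Module.End k B) p)
    (he : ∀ i, e' i ∈ part k (Module.End k B) q) :
    magicLin m β m' β' (magicR k A B d') (magicR k A B e') =
      magicR k A B fun i => superComm k B (d' i) (e' i) := by
  rw [magicLin_of_mem m β m' β' (magicR_mem hd) (magicR_mem he),
    magicOrderedLin_of_eq_zero m m' _ rfl, magicOrderedLin_of_eq_zero m m' _ rfl]
  refine Prod.ext ?_ (Prod.ext ?_ ?_)
  · ext; simp [magicR_apply]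
  · simp [magicR_apply]
  · simp [magicR_apply]

theorem magicLin_L_R (hd : ∀ i, d i ∈ part k (Module.End k A) p)
    (he : ∀ i, e' i ∈ part k (Module.End k B) q) :
    magicLin m β m' β' (magicL k A B d) (magicR k A B e') = 0 := by
  rw [magicLin_of_mem m β m' β' (magicL_mem hd) (magicR_mem he),
    magicOrderedLin_of_eq_zero m m' _ rfl, magicOrderedLin_of_eq_zero m m' _ rfl]
  refine Prod.ext ?_ (Prod.ext ?_ ?_)
  · ext; simp [magicR_apply, magicL_apply]
  · ext; simp [magicR_apply, magicL_apply]
  · simp [magicR_apply, magicL_apply]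

theorem magicLin_L_I (hd : ∀ i, d i ∈ part k (Module.End k A) p) (ha : a ∈ part k A 0)
    (hx : x ∈ part k B q) (i : Fin 3) :
    magicLin m β m' β' (magicL k A B d) (magicI k A B i (a ⊗ₜ[k] x)) =
      magicI k A B i (d i a ⊗ₜ[k] x) := by
  rw [magicLin_of_mem m β m' β' (magicL_mem hd) (magicI_mem i (tmul_mem_part ha hx)),
    magicOrderedLin_L_I, magicOrderedLin_of_eq_zero m m' _ rfl]
  refine Prod.ext ?_ (Prod.ext ?_ ?_)
  · ext; simp [magicI_apply, magicL_apply]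
  · ext; simp [magicI_apply, magicL_apply]
  · simp [magicI_apply]

theorem magicLin_R_I (hd : ∀ i, d' i ∈ part k (Module.End k B) p) (ha : a ∈ part k A 0)
    (hx : x ∈ part k B q) (i : Fin 3) :
    magicLin m β m' β' (magicR k A B d') (magicI k A B i (a ⊗ₜ[k] x)) =
      magicI k A B i (a ⊗ₜ[k] d' i x) := by
  rw [magicLin_of_mem m β m' β' (magicR_mem hd) (magicI_mem i (tmul_mem_part ha hx)),
    magicOrderedLin_R_I, magicOrderedLin_of_eq_zero m m' _ rfl, rightAct_tmul (hd i) ha, mul_zero,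
    sgn_zero, one_smul]
  refine Prod.ext ?_ (Prod.ext ?_ ?_)
  · ext; simp [magicI_apply, magicR_apply]
  · ext; simp [magicI_apply, magicR_apply]
  · simp [magicI_apply]

theorem magicLin_I_I_succ (ha : a ∈ part k A 0) (hx : x ∈ part k B p) (hc : c ∈ part k A 0)
    (hy : y ∈ part k B q) (i : Fin 3) :
    magicLin m β m' β' (magicI k A B i (a ⊗ₜ[k] x)) (magicI k A B (i + 1) (c ⊗ₜ[k] y)) =
      magicI k A B (i + 2) (m a c ⊗ₜ[k] m' x y) := by
  have hi : i ≠ i + 1 + 1 := by revert i; decide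
  have h : ∀ j, (magicI k A B i (a ⊗ₜ[k] x)).2.2 j = 0 ∨
      (magicI k A B (i + 1) (c ⊗ₜ[k] y)).2.2 j = 0 := by
    intro j
    rcases eq_or_ne j i with rfl | h
    · right; simp [magicI_apply]
    · left; simp [magicI_apply, Pi.single_eq_of_ne h]
  have h1 : ∀ j, tensorTriLeftLin m β β' ((magicI k A B i (a ⊗ₜ[k] x)).2.2 j)
      ((magicI k A B (i + 1) (c ⊗ₜ[k] y)).2.2 j) = 0 := fun j => by
    rcases h j with h | h <;> simp [h]
  have h3 : ∀ j, tensorTriRightLin β m' β' ((magicI k A B i (a ⊗ₜ[k] x)).2.2 j)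
      ((magicI k A B (i + 1) (c ⊗ₜ[k] y)).2.2 j) = 0 := fun j => by
    rcases h j with h | h <;> simp [h]
  rw [magicLin_of_mem m β m' β' (magicI_mem i (tmul_mem_part ha hx))
      (magicI_mem _ (tmul_mem_part hc hy)), magicOrderedLin_I_I_succ,
    magicOrderedLin_I_I_of_ne m m' hi, tensorMul_tmul m m' a hx hc, mul_zero, sgn_zero, one_smul]
  simp only [h1, h3]
  refine Prod.ext ?_ (Prod.ext ?_ ?_)
  · ext; simp [magicI_apply]
  · ext; simp [magicI_apply]
  · simp [magicI_apply]

theorem magicLin_I_I_self (ha : a ∈ part k A 0) (hx : x ∈ part k B p) (hc : c ∈ part k A 0)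
    (hy : y ∈ part k B q) (i : Fin 3) :
    magicLin m β m' β' (magicI k A B i (a ⊗ₜ[k] x)) (magicI k A B i (c ⊗ₜ[k] y)) =
      magicL k A B (β' x y • theta i (tElt m β a c)) +
        magicR k A B (β a c • theta i (tElt m' β' x y)) := by
  have hi : i ≠ i + 1 := by revert i; decide
  have h1 : ∑ j, thetaLin k A j (tensorTriLeftLin m β β' ((magicI k A B i (a ⊗ₜ[k] x)).2.2 j)
      ((magicI k A B i (c ⊗ₜ[k] y)).2.2 j)) = β' x y • theta i (tElt m β a c) := by
    rw [Finset.sum_eq_single i]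
    · simp only [magicI_apply, Pi.single_eq_same, tensorTriLeftLin_apply,
        tensorTriLeft_tmul m β β' ha hx hc hy, zero_mul, add_zero, sgn_zero, one_smul, map_smul,
        thetaLin_apply]
    · intro j _ hj
      simp [magicI_apply, Pi.single_eq_of_ne hj]
    · simp
  have h3 : ∑ j, thetaLin k B j (tensorTriRightLin β m' β' ((magicI k A B i (a ⊗ₜ[k] x)).2.2 j)
      ((magicI k A B i (c ⊗ₜ[k] y)).2.2 j)) = β a c • theta i (tElt m' β' x y) := by
    rw [Finset.sum_eq_single i]
    · simp only [magicI_apply, Pi.single_eq_same, tensorTriRightLin_apply,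
        tensorTriRight_tmul β m' β' ha hx hc hy, zero_mul, sgn_zero, one_smul, map_smul,
        thetaLin_apply]
    · intro j _ hj
      simp [magicI_apply, Pi.single_eq_of_ne hj]
    · simp
  rw [magicLin_of_mem m β m' β' (magicI_mem i (tmul_mem_part ha hx))
      (magicI_mem _ (tmul_mem_part hc hy)), magicOrderedLin_I_I_of_ne m m' hi,
    magicOrderedLin_I_I_of_ne m m' hi, h1, h3]
  refine Prod.ext ?_ (Prod.ext ?_ ?_)
  · ext; simp [magicI_apply, magicL_apply, magicR_apply]
  · ext; simp [magicI_apply, magicL_apply, magicR_apply]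
  · simp [magicL_apply, magicR_apply]

end Bracket

end MagicTable

/-! ### The isomorphism on homogeneous generators -/

/-- The products of the elements `eᵢ` and `ιᵢ(x)` of `J`, and the values and brackets of the
derivations `Dᵢ(x)` and `D_{(d₀,d₁,d₂)}`. -/
structure IsPeirceDatum {k C J : Type*} [Field k] [NonAssocRing C] [Module k C]
    [IsScalarTower k C C] [SMulCommClass k C C] [HurwitzSuperalgebra k C]
    [AddCommGroup J] [Module k J] [Superspace k J]
    (m : J →ₗ[k] J →ₗ[k] J) (e : Fin 3 → J) (ι : Fin 3 → C →ₗ[k] J)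
    (D : Fin 3 → C →ₗ[k] Module.End k J) (T : (Fin 3 → Module.End k C) →ₗ[k] Module.End k J) :
    Prop where
  e_mem : ∀ i, e i ∈ part k J 0
  iota_mem : ∀ i {p x}, x ∈ part k C p → ι i x ∈ part k J p
  D_mem : ∀ i {p x}, x ∈ part k C p → D i x ∈ part k (Module.End k J) p
  T_mem : ∀ {p d}, (∀ i, d i ∈ part k (Module.End k C) p) → T d ∈ part k (Module.End k J) p
  mul_e_e : ∀ i j, m (e i) (e j) = if i = j then e i else 0
  mul_e_iota : ∀ i j x, m (e j) (ι i x) = if j = i then 0 else (2 : k)⁻¹ • ι i x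
  mul_iota_self : ∀ i x y, m (ι i x) (ι i y) = ((2 : k) * b x y) • (e (i + 1) + e (i + 2))
  mul_iota_succ : ∀ i x y, m (ι i x) (ι (i + 1) y) = ι (i + 2) (paraMul k C x y)
  inner_e_e : ∀ i j, innerDer m (e i) (e j) = 0
  inner_e_iota_self : ∀ i {p x}, x ∈ part k C p → innerDer m (e i) (ι i x) = 0
  inner_e_iota_one : ∀ i {p x}, x ∈ part k C p →
    innerDer m (e (i + 1)) (ι i x) = -((2 : k)⁻¹ • D i x)
  inner_e_iota_two : ∀ i {p x}, x ∈ part k C p →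
    innerDer m (e (i + 2)) (ι i x) = (2 : k)⁻¹ • D i x
  inner_iota_self : ∀ i {p q x y}, x ∈ part k C p → y ∈ part k C q →
    innerDer m (ι i x) (ι i y) = -T ((2 : k) • theta i (tElt (paraMul k C) b x y))
  inner_iota_succ : ∀ i {p q x y}, x ∈ part k C p → y ∈ part k C q →
    innerDer m (ι i x) (ι (i + 1) y) = D (i + 2) (paraMul k C x y)
  T_e : ∀ d i, T d (e i) = 0
  T_iota : ∀ d i x, T d (ι i x) = ι i (d i x)
  D_e_self : ∀ i {p x}, x ∈ part k C p → D i x (e i) = 0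
  D_e_one : ∀ i {p x}, x ∈ part k C p → D i x (e (i + 1)) = (2 : k)⁻¹ • ι i x
  D_e_two : ∀ i {p x}, x ∈ part k C p → D i x (e (i + 2)) = -((2 : k)⁻¹ • ι i x)
  D_iota_self : ∀ i {p x}, x ∈ part k C p → ∀ y,
    D i x (ι i y) = ((2 : k) * b x y) • (e (i + 2) - e (i + 1))
  D_iota_one : ∀ i {p x}, x ∈ part k C p → ∀ y,
    D i x (ι (i + 1) y) = -ι (i + 2) (paraMul k C x y)
  D_iota_two : ∀ i {p q x y}, x ∈ part k C p → y ∈ part k C q →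
    D i x (ι (i + 2) y) = sgn k (p * q) • ι (i + 1) (paraMul k C y x)
  comm_D_self : ∀ i {p q x y}, x ∈ part k C p → y ∈ part k C q →
    superComm k J (D i x) (D i y) = T ((2 : k) • theta i (tElt (paraMul k C) b x y))
  comm_D_succ : ∀ i {p q x y}, x ∈ part k C p → y ∈ part k C q →
    superComm k J (D i x) (D (i + 1) y) = D (i + 2) (paraMul k C x y)
  comm_T_D : ∀ i {p q d x}, d ∈ triPart (paraMul k C) b p → x ∈ part k C q →
    superComm k J (T d) (D i x) = D i (d i x)
  comm_T : ∀ {p q d d'}, (∀ i, d i ∈ part k (Module.End k C) p) →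
    (∀ i, d' i ∈ part k (Module.End k C) q) →
    superComm k J (T d) (T d') = T fun i => superComm k C (d i) (d' i)

section PhiMap

variable {k Q C J : Type*} [Field k]
  [NonAssocRing Q] [Module k Q] [IsScalarTower k Q Q] [SMulCommClass k Q Q]
  [HurwitzSuperalgebra k Q]
  [NonAssocRing C] [Module k C] [IsScalarTower k C C] [SMulCommClass k C C]
  [HurwitzSuperalgebra k C]
  [AddCommGroup J] [Module k J] [Superspace k J]

/-- `a ⊗ x ↦ ½ b(a, 1) Dᵢ(x) - ½ (a - ½ b(a, 1) 1) ⊗ ιᵢ(x)`. -/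
noncomputable def phiTensor (ι : Fin 3 → C →ₗ[k] J) (D : Fin 3 → C →ₗ[k] Module.End k J)
    (i : Fin 3) : Q ⊗[k] C →ₗ[k] TitsSum k Q J :=
  TensorProduct.lift (LinearMap.mk₂ k
    (fun (a : Q) (x : C) => ((2 : k)⁻¹ * b a (1 : Q)) • titsDer k Q J (D i x)
      - (2 : k)⁻¹ • titsTmul k J (a - ((2 : k)⁻¹ * b a (1 : Q)) • (1 : Q)) (ι i x))
    (fun a a' x => by
      simp only [map_add, map_sub, map_smul, LinearMap.add_apply, LinearMap.sub_apply,
        LinearMap.smul_apply]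
      module)
    (fun c a x => by
      simp only [map_sub, map_smul, LinearMap.sub_apply, LinearMap.smul_apply, smul_eq_mul]
      module)
    (fun a x x' => by simp only [map_add]; module)
    (fun c a x => by simp only [map_smul]; module))

/-- The map `Φ₃`, where `l` extracts the part `a` from `L_a - R_c`. -/
noncomputable def phiLin (l : Module.End k Q →ₗ[k] Q) (e : Fin 3 → J) (ι : Fin 3 → C →ₗ[k] J)
    (D : Fin 3 → C →ₗ[k] Module.End k J) (T : (Fin 3 → Module.End k C) →ₗ[k] Module.End k J) :
    MagicSpace k Q C →ₗ[k] TitsSum k Q J where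
  toFun u := ∑ i, titsTmul k J (l (u.1 (i + 2))) (e i) + titsDer k Q J (T u.2.1)
    + ∑ i, phiTensor ι D i (u.2.2 i)
  map_add' u v := by
    simp only [Prod.fst_add, Prod.snd_add, Pi.add_apply, map_add, LinearMap.add_apply,
      Finset.sum_add_distrib]
    abel
  map_smul' c u := by
    simp only [Prod.smul_fst, Prod.smul_snd, Pi.smul_apply, map_smul, LinearMap.smul_apply,
      ← Finset.smul_sum, smul_add, RingHom.id_apply]

variable {m : J →ₗ[k] J →ₗ[k] J} {e : Fin 3 → J} {ι : Fin 3 → C →ₗ[k] J}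
  {D : Fin 3 → C →ₗ[k] Module.End k J} {T : (Fin 3 → Module.End k C) →ₗ[k] Module.End k J}
  {l : Module.End k Q →ₗ[k] Q}

theorem phiLin_apply (u : MagicSpace k Q C) : phiLin l e ι D T u =
    ∑ i, titsTmul k J (l (u.1 (i + 2))) (e i) + titsDer k Q J (T u.2.1)
      + ∑ i, phiTensor ι D i (u.2.2 i) := rfl

theorem phiLin_R (d : Fin 3 → Module.End k C) :
    phiLin l e ι D T (magicR k Q C d) = titsDer k Q J (T d) := by
  rw [phiLin_apply]; simp [magicR_apply]

theorem phiLin_L (hl : ∀ a ∈ traceZero k Q, l (LinearMap.mulLeft k a) = a ∧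
    l (LinearMap.mulRight k a) = 0) {a : Q} (ha : a ∈ traceZero k Q) (i : Fin 3) :
    phiLin l e ι D T (magicL k Q C (kerElt k a i)) = titsTmul k J a (e i) := by
  have h : ∀ j, l (kerElt k a i (j + 2)) = if j = i then a else 0 := by
    intro j
    rcases fin3_cases i j with rfl | rfl | rfl
    · rw [IsQuaternionAlgebra.kerElt_two, (hl a ha).1, if_pos rfl]
    · rw [fin3_one_two, IsQuaternionAlgebra.kerElt_self, map_zero, if_neg (by simp)]
    · rw [fin3_two_two, IsQuaternionAlgebra.kerElt_one, map_neg, (hl a ha).2, neg_zero,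
        if_neg (by simp)]
  rw [phiLin_apply]
  simp only [magicL_apply, h]
  simp [apply_ite, ite_apply]

theorem phiLin_I (i : Fin 3) (z : Q ⊗[k] C) :
    phiLin l e ι D T (magicI k Q C i z) = phiTensor ι D i z := by
  rw [phiLin_apply, Finset.sum_eq_single (s := Finset.univ) (a := i) (f := fun j => phiTensor ι D j _)]
  · simp [magicI_apply]
  · intro j _ hj
    simp [magicI_apply, Pi.single_eq_of_ne hj]
  · simp

theorem phiTensor_tmul (h2 : (2 : k) ≠ 0) (hQ : IsQuaternionAlgebra k Q) (i : Fin 3) (α : k) {a : Q}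
    (ha : a ∈ traceZero k Q) (x : C) :
    phiTensor ι D i ((α • 1 + a) ⊗ₜ[k] x) =
      α • titsDer k Q J (D i x) - (2 : k)⁻¹ • titsTmul k J a (ι i x) := by
  have hn : Nontrivial Q := Module.nontrivial_of_finrank_pos (R := k) (by simp [hQ.finrank_eq])
  have hb : (2 : k)⁻¹ * b (α • (1 : Q) + a) (1 : Q) = α := by
    rw [map_add, map_smul, LinearMap.add_apply, LinearMap.smul_apply, b_one_one,
      IsQuaternionAlgebra.mem_traceZero.1 ha, add_zero, smul_eq_mul]
    field_simp
  rw [phiTensor, TensorProduct.lift.tmul, LinearMap.mk₂_apply, hb, add_sub_cancel_left]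

end PhiMap

namespace IsQuaternionAlgebra

variable {k Q : Type*} [Field k] [NonAssocRing Q] [Module k Q] [IsScalarTower k Q Q]
  [SMulCommClass k Q Q] [HurwitzSuperalgebra k Q] {a c : Q}

theorem mul_of_traceZero (h2 : (2 : k) ≠ 0) (hQ : IsQuaternionAlgebra k Q) (ha : a ∈ traceZero k Q)
    (hc : c ∈ traceZero k Q) : a * c = -((2 : k)⁻¹ * b a c) • (1 : Q) + (2 : k)⁻¹ • (a * c - c * a) := by
  have h := hQ.mul_add_mul_of_traceZero ha hc
  have e : c * a = -((b a c : k) • (1 : Q)) - a * c := by rw [← h]; abel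
  rw [e]
  match_scalars <;> field_simp <;> ring

theorem smul_one_add_mul (h2 : (2 : k) ≠ 0) (hQ : IsQuaternionAlgebra k Q) (α γ : k)
    (ha : a ∈ traceZero k Q) (hc : c ∈ traceZero k Q) : (α • 1 + a) * (γ • 1 + c) =
      (α * γ - (2 : k)⁻¹ * b a c) • (1 : Q) + (α • c + γ • a + (2 : k)⁻¹ • (a * c - c * a)) := by
  have e : (α • 1 + a) * (γ • 1 + c) = (α * γ) • (1 : Q) + α • c + γ • a + a * c := by
    simp only [add_mul, mul_add, smul_mul_assoc, mul_smul_comm, one_mul, mul_one]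
    module
  rw [e]
  nth_rw 1 [hQ.mul_of_traceZero h2 ha hc]
  module

theorem b_smul_one_add [Nontrivial Q] (hQ : IsQuaternionAlgebra k Q) (α γ : k)
    (ha : a ∈ traceZero k Q) (hc : c ∈ traceZero k Q) :
    (b (α • 1 + a) (γ • 1 + c) : k) = 2 * (α * γ) + b a c := by
  have h1 := mem_traceZero.1 ha
  have h3 := mem_traceZero.1 hc
  rw [hQ.b_comm] at h3
  simp only [map_add, map_smul, LinearMap.add_apply, LinearMap.smul_apply, b_one_one, h1, h3,
    smul_eq_mul]
  ring

theorem paraMulOp_smul_one_add [Nontrivial Q] (h2 : (2 : k) ≠ 0) (hQ : IsQuaternionAlgebra k Q)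
    (α γ : k) (ha : a ∈ traceZero k Q) (hc : c ∈ traceZero k Q) :
    paraMulOp k Q (α • 1 + a) (γ • 1 + c) =
      (α * γ - (2 : k)⁻¹ * b a c) • (1 : Q) + -(α • c + γ • a + (2 : k)⁻¹ • (a * c - c * a)) := by
  have h : α • c + γ • a + (2 : k)⁻¹ • (a * c - c * a) ∈ traceZero k Q :=
    add_mem (add_mem (Submodule.smul_mem _ _ hc) (Submodule.smul_mem _ _ ha))
      (Submodule.smul_mem _ _ (hQ.commutator_mem_traceZero a c))
  rw [paraMulOp_apply, hQ.smul_one_add_mul h2 α γ ha hc, map_add, map_smul, conj_one,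
    conj_of_mem_traceZero h]

end IsQuaternionAlgebra

namespace IsPeirceDatum

variable {k Q C J : Type*} [Field k]
  [NonAssocRing Q] [Module k Q] [IsScalarTower k Q Q] [SMulCommClass k Q Q]
  [HurwitzSuperalgebra k Q]
  [NonAssocRing C] [Module k C] [IsScalarTower k C C] [SMulCommClass k C C]
  [HurwitzSuperalgebra k C]
  [AddCommGroup J] [Module k J] [Superspace k J]
  {m : J →ₗ[k] J →ₗ[k] J} {e : Fin 3 → J} {ι : Fin 3 → C →ₗ[k] J}
  {D : Fin 3 → C →ₗ[k] Module.End k J} {T : (Fin 3 → Module.End k C) →ₗ[k] Module.End k J}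
  {l : Module.End k Q →ₗ[k] Q} {p q : ZMod 2} {x y : C} {a c : Q} {d d' : Fin 3 → Module.End k C}

theorem phiLin_L_L (h : IsPeirceDatum m e ι D T) (h2 : (2 : k) ≠ 0) (hQ : IsQuaternionAlgebra k Q)
    (hl : ∀ a ∈ traceZero k Q, l (LinearMap.mulLeft k a) = a ∧ l (LinearMap.mulRight k a) = 0)
    (a c : Q) (i j : Fin 3) :
    phiLin l e ι D T (magicLin (paraMulOp k Q) b (paraMul k C) b
      (magicL k Q C (kerElt k a i)) (magicL k Q C (kerElt k c j))) =
    titsLin Q m (titsTmul k J a (e i)) (titsTmul k J c (e j)) := by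
  rw [magicLin_L_L _ _ _ _ (fun _ => hQ.even_end _) (fun _ => hQ.even_end _),
    titsLin_tmul_tmul m hQ a c (h.e_mem i) (h.e_mem j), h.inner_e_e, smul_zero, map_zero, sub_zero,
    h.mul_e_e]
  rcases eq_or_ne i j with rfl | hij
  · rw [if_pos rfl, ← phiLin_L (C := C) (ι := ι) (D := D) (T := T) hl (hQ.commutator_mem_traceZero a c)]
    congr 2
    ext1 j
    exact IsQuaternionAlgebra.superComm_kerElt_self h2 hQ a c i j
  · rw [if_neg hij, map_zero]
    convert map_zero (phiLin l e ι D T)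
    convert map_zero (magicL k Q C)
    exact IsQuaternionAlgebra.superComm_kerElt_of_ne h2 hQ a c hij _

theorem phiLin_L_R (h : IsPeirceDatum m e ι D T) (hQ : IsQuaternionAlgebra k Q)
    (hd : d ∈ triPart (paraMul k C) b p) (i : Fin 3) :
    phiLin l e ι D T (magicLin (paraMulOp k Q) b (paraMul k C) b
      (magicL k Q C (kerElt k a i)) (magicR k Q C d)) =
    titsLin Q m (titsTmul k J a (e i)) (titsDer k Q J (T d)) := by
  rw [magicLin_L_R _ _ _ _ (fun _ => hQ.even_end _) (fun i => (hd.1 i).1), map_zero,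
    titsLin_tmul_der m hQ a (h.e_mem i) (h.T_mem fun i => (hd.1 i).1), h.T_e]
  simp

theorem phiLin_R_R (h : IsPeirceDatum m e ι D T) (hd : d ∈ triPart (paraMul k C) b p)
    (hd' : d' ∈ triPart (paraMul k C) b q) :
    phiLin l e ι D T (magicLin (paraMulOp k Q) b (paraMul k C) b
      (magicR k Q C d) (magicR k Q C d')) =
    titsLin Q m (titsDer k Q J (T d)) (titsDer k Q J (T d')) := by
  have h1 : ∀ i, d i ∈ part k (Module.End k C) p := fun i => (hd.1 i).1
  have h2 : ∀ i, d' i ∈ part k (Module.End k C) q := fun i => (hd'.1 i).1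
  rw [magicLin_R_R _ _ _ _ h1 h2, phiLin_R, titsLin_der_der m (h.T_mem h1) (h.T_mem h2),
    h.comm_T h1 h2]

theorem phiLin_R_I (h : IsPeirceDatum m e ι D T) (h2 : (2 : k) ≠ 0) (hQ : IsQuaternionAlgebra k Q)
    (hd : d ∈ triPart (paraMul k C) b p) (γ : k) (hc : c ∈ traceZero k Q) (hx : x ∈ part k C q)
    (i : Fin 3) :
    phiLin l e ι D T (magicLin (paraMulOp k Q) b (paraMul k C) b
      (magicR k Q C d) (magicI k Q C i ((γ • 1 + c) ⊗ₜ[k] x))) =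
    titsLin Q m (titsDer k Q J (T d))
      (γ • titsDer k Q J (D i x) - (2 : k)⁻¹ • titsTmul k J c (ι i x)) := by
  have h1 : ∀ i, d i ∈ part k (Module.End k C) p := fun i => (hd.1 i).1
  rw [magicLin_R_I _ _ _ _ h1 (hQ.even _) hx, phiLin_I, phiTensor_tmul h2 hQ i γ hc, map_sub,
    map_smul, map_smul, titsLin_der_der m (h.T_mem h1) (h.D_mem i hx), h.comm_T_D i hd hx,
    titsLin_der_tmul m hQ (h.T_mem h1) c (h.iota_mem i hx), h.T_iota]

theorem phiLin_L_I (h : IsPeirceDatum m e ι D T) (h2 : (2 : k) ≠ 0) (hQ : IsQuaternionAlgebra k Q)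
    (ha : a ∈ traceZero k Q) (γ : k) (hc : c ∈ traceZero k Q) (hx : x ∈ part k C q) (i j : Fin 3) :
    phiLin l e ι D T (magicLin (paraMulOp k Q) b (paraMul k C) b
      (magicL k Q C (kerElt k a i)) (magicI k Q C j ((γ • 1 + c) ⊗ₜ[k] x))) =
    titsLin Q m (titsTmul k J a (e i))
      (γ • titsDer k Q J (D j x) - (2 : k)⁻¹ • titsTmul k J c (ι j x)) := by
  have hR : titsLin Q m (titsTmul k J a (e i))
      (γ • titsDer k Q J (D j x) - (2 : k)⁻¹ • titsTmul k J c (ι j x)) =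
      -(γ • titsTmul k J a (D j x (e i))) - (2 : k)⁻¹ •
        (titsTmul k J (a * c - c * a) (m (e i) (ι j x)) -
          titsDer k Q J ((2 * b a c : k) • innerDer m (e i) (ι j x))) := by
    rw [map_sub, map_smul, map_smul, titsLin_tmul_der m hQ a (h.e_mem i) (h.D_mem j hx), zero_mul,
      sgn_zero, one_smul, smul_neg, titsLin_tmul_tmul m hQ a c (h.e_mem i) (h.iota_mem j hx)]
  rw [hR, magicLin_L_I _ _ _ _ (fun _ => hQ.even_end _) (hQ.even _) hx, phiLin_I]
  rcases fin3_cases j i with rfl | rfl | rfl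
  · rw [IsQuaternionAlgebra.kerElt_self, h.D_e_self j hx, h.inner_e_iota_self j hx, h.mul_e_iota,
      if_pos rfl]
    simp
  · have e1 : kerElt k a (j + 1) j (γ • 1 + c) =
        (-((2 : k)⁻¹ * b a c)) • (1 : Q) + (γ • a + (2 : k)⁻¹ • (a * c - c * a)) := by
      rw [IsQuaternionAlgebra.kerElt_zero', LinearMap.mulLeft_apply, mul_add, mul_smul_comm, mul_one]
      linear_combination (norm := module) hQ.mul_of_traceZero h2 ha hc
    rw [e1, phiTensor_tmul h2 hQ j _ (add_mem (Submodule.smul_mem _ _ ha)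
      (Submodule.smul_mem _ _ (hQ.commutator_mem_traceZero a c))), h.D_e_one j hx,
      h.inner_e_iota_one j hx, h.mul_e_iota, if_neg (by simp)]
    simp only [map_add, map_smul, map_neg, LinearMap.add_apply, LinearMap.smul_apply]
    match_scalars <;> field_simp
  · have e1 : kerElt k a (j + 2) j (γ • 1 + c) =
        ((2 : k)⁻¹ * b a c) • (1 : Q) + -(γ • a - (2 : k)⁻¹ • (a * c - c * a)) := by
      rw [IsQuaternionAlgebra.kerElt_zero, LinearMap.neg_apply, LinearMap.mulRight_apply, add_mul,
        smul_mul_assoc, one_mul, hQ.b_comm]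
      linear_combination (norm := module) -hQ.mul_of_traceZero h2 hc ha
    rw [e1, phiTensor_tmul h2 hQ j _ (neg_mem (sub_mem (Submodule.smul_mem _ _ ha)
      (Submodule.smul_mem _ _ (hQ.commutator_mem_traceZero a c)))), h.D_e_two j hx,
      h.inner_e_iota_two j hx, h.mul_e_iota, if_neg (by simp)]
    simp only [map_sub, map_smul, map_neg, LinearMap.sub_apply, LinearMap.smul_apply,
      LinearMap.neg_apply]
    match_scalars <;> field_simp

theorem phiLin_I_I_self (h : IsPeirceDatum m e ι D T) (h2 : (2 : k) ≠ 0)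
    (hQ : IsQuaternionAlgebra k Q)
    (hl : ∀ a ∈ traceZero k Q, l (LinearMap.mulLeft k a) = a ∧ l (LinearMap.mulRight k a) = 0)
    (α γ : k) (ha : a ∈ traceZero k Q) (hc : c ∈ traceZero k Q) (hx : x ∈ part k C p)
    (hy : y ∈ part k C q) (i : Fin 3) :
    phiLin l e ι D T (magicLin (paraMulOp k Q) b (paraMul k C) b
      (magicI k Q C i ((α • 1 + a) ⊗ₜ[k] x)) (magicI k Q C i ((γ • 1 + c) ⊗ₜ[k] y))) =
    titsLin Q m (α • titsDer k Q J (D i x) - (2 : k)⁻¹ • titsTmul k J a (ι i x))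
      (γ • titsDer k Q J (D i y) - (2 : k)⁻¹ • titsTmul k J c (ι i y)) := by
  have hn : Nontrivial Q := Module.nontrivial_of_finrank_pos (R := k) (by simp [hQ.finrank_eq])
  have hac := hQ.commutator_mem_traceZero a c
  have hb := b_supersymm (k := k) p q x hx y hy
  have e3 : ∀ u v : Fin 3 → Module.End k Q, theta i (u + v) = theta i u + theta i v :=
    fun _ _ => rfl
  rw [magicLin_I_I_self _ _ _ _ (hQ.even _) hx (hQ.even _) hy, map_add, phiLin_R,
    IsQuaternionAlgebra.tElt_paraMulOp h2 hQ α γ ha hc, e3, IsQuaternionAlgebra.theta_kerElt,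
    IsQuaternionAlgebra.theta_kerElt, map_smul, map_add, map_smul, map_add,
    phiLin_L hl (add_mem (sub_mem (Submodule.smul_mem _ _ ha) (Submodule.smul_mem _ _ hc))
      (Submodule.smul_mem _ _ hac)),
    phiLin_L hl (add_mem (sub_mem (Submodule.smul_mem _ _ hc) (Submodule.smul_mem _ _ ha))
      (Submodule.smul_mem _ _ hac)),
    hQ.b_smul_one_add α γ ha hc, add_comm 2 i, add_comm 1 i]
  simp only [map_sub, map_smul, LinearMap.sub_apply, LinearMap.smul_apply]
  rw [titsLin_der_der m (h.D_mem i hx) (h.D_mem i hy), h.comm_D_self i hx hy,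
    titsLin_der_tmul m hQ (h.D_mem i hx) c (h.iota_mem i hy), h.D_iota_self i hx,
    titsLin_tmul_der m hQ a (h.iota_mem i hx) (h.D_mem i hy), h.D_iota_self i hy,
    titsLin_tmul_tmul m hQ a c (h.iota_mem i hx) (h.iota_mem i hy), h.inner_iota_self i hx hy,
    h.mul_iota_self, hb]
  simp only [map_add, map_sub, map_smul, map_neg, LinearMap.add_apply, LinearMap.sub_apply,
    LinearMap.smul_apply]
  match_scalars <;> field_simp <;> ring

theorem phiLin_I_I_succ (h : IsPeirceDatum m e ι D T) (h2 : (2 : k) ≠ 0)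
    (hQ : IsQuaternionAlgebra k Q)
    (α γ : k) (ha : a ∈ traceZero k Q) (hc : c ∈ traceZero k Q) (hx : x ∈ part k C p)
    (hy : y ∈ part k C q) (i : Fin 3) :
    phiLin l e ι D T (magicLin (paraMulOp k Q) b (paraMul k C) b
      (magicI k Q C i ((α • 1 + a) ⊗ₜ[k] x)) (magicI k Q C (i + 1) ((γ • 1 + c) ⊗ₜ[k] y))) =
    titsLin Q m (α • titsDer k Q J (D i x) - (2 : k)⁻¹ • titsTmul k J a (ι i x))
      (γ • titsDer k Q J (D (i + 1) y) - (2 : k)⁻¹ • titsTmul k J c (ι (i + 1) y)) := by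
  have hn : Nontrivial Q := Module.nontrivial_of_finrank_pos (R := k) (by simp [hQ.finrank_eq])
  have hac := hQ.commutator_mem_traceZero a c
  have e1 : D (i + 1) y (ι i x) = sgn k (p * q) • ι (i + 2) (paraMul k C x y) := by
    have := h.D_iota_two (i + 1) hy hx
    rwa [fin3_one_two, fin3_one_one, mul_comm] at this
  have hs := sgn_mul_self (k := k) (p * q)
  rw [magicLin_I_I_succ _ _ _ _ (hQ.even _) hx (hQ.even _) hy, phiLin_I,
    hQ.paraMulOp_smul_one_add h2 α γ ha hc,
    phiTensor_tmul h2 hQ _ _ (neg_mem (add_mem (add_mem (Submodule.smul_mem _ _ hc)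
      (Submodule.smul_mem _ _ ha)) (Submodule.smul_mem _ _ hac)))]
  simp only [map_sub, map_smul, LinearMap.sub_apply, LinearMap.smul_apply]
  rw [titsLin_der_der m (h.D_mem i hx) (h.D_mem (i + 1) hy), h.comm_D_succ i hx hy,
    titsLin_der_tmul m hQ (h.D_mem i hx) c (h.iota_mem (i + 1) hy), h.D_iota_one i hx,
    titsLin_tmul_der m hQ a (h.iota_mem i hx) (h.D_mem (i + 1) hy), e1,
    titsLin_tmul_tmul m hQ a c (h.iota_mem i hx) (h.iota_mem (i + 1) hy),
    h.inner_iota_succ i hx hy, h.mul_iota_succ, map_smul, smul_smul (sgn k (p * q)), hs, one_smul]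
  simp only [map_add, map_sub, map_smul, map_neg, LinearMap.add_apply, LinearMap.sub_apply,
    LinearMap.smul_apply, LinearMap.neg_apply]
  match_scalars <;> field_simp

end IsPeirceDatum

section MagicGen

variable {k Q C : Type*} [Field k]
  [NonAssocRing Q] [Module k Q] [IsScalarTower k Q Q] [SMulCommClass k Q Q]
  [HurwitzSuperalgebra k Q]
  [NonAssocRing C] [Module k C] [IsScalarTower k C C] [SMulCommClass k C C]
  [HurwitzSuperalgebra k C] {p q : ZMod 2} {u v : MagicSpace k Q C}

variable (k Q C) in
/-- Homogeneous generators of `g(Q̄, S)`. -/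
def magicGen (p : ZMod 2) : Set (MagicSpace k Q C) :=
  {u | (p = 0 ∧ ∃ a ∈ traceZero k Q, ∃ i, u = magicL k Q C (kerElt k a i)) ∨
    (∃ d ∈ triPart (paraMul k C) b p, u = magicR k Q C d) ∨
    ∃ (i : Fin 3) (α : k), ∃ a ∈ traceZero k Q, ∃ x ∈ part k C p,
      u = magicI k Q C i ((α • 1 + a) ⊗ₜ[k] x)}

theorem magicGen_subset (hQ : IsQuaternionAlgebra k Q) (p : ZMod 2) :
    magicGen k Q C p ⊆ part k (MagicSpace k Q C) p := by
  rintro _ (⟨rfl, a, ha, i, rfl⟩ | ⟨d, hd, rfl⟩ | ⟨i, α, a, ha, x, hx, rfl⟩)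
  · exact magicL_mem fun j => hQ.even_end _
  · exact magicR_mem fun j => (hd.1 j).1
  · have h := tmul_mem_part (hQ.even (α • 1 + a)) hx
    rw [zero_add] at h
    exact magicI_mem i h

theorem magicL_mem_gQS {d : Fin 3 → Module.End k Q}
    (hd : d ∈ tri (paraMulOp k Q) (b : Q →ₗ[k] Q →ₗ[k] k)) : magicL k Q C d ∈ gQS k Q C :=
  ⟨hd, zero_mem _, trivial⟩

theorem magicR_mem_gQS {d : Fin 3 → Module.End k C}
    (hd : d ∈ triPart (paraMul k C) (b : C →ₗ[k] C →ₗ[k] k) p) : magicR k Q C d ∈ gQS k Q C := by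
  refine ⟨zero_mem _, ?_, trivial⟩
  rcases parity_cases p with rfl | rfl
  · exact Submodule.mem_sup_left hd
  · exact Submodule.mem_sup_right hd

theorem magicI_mem_gQS (i : Fin 3) (z : Q ⊗[k] C) : magicI k Q C i z ∈ gQS k Q C :=
  ⟨zero_mem _, zero_mem _, trivial⟩

theorem magicGen_subset_gQS (h2 : (2 : k) ≠ 0) (hQ : IsQuaternionAlgebra k Q) (p : ZMod 2) :
    magicGen k Q C p ⊆ gQS k Q C := by
  rintro _ (⟨rfl, a, ha, i, rfl⟩ | ⟨d, hd, rfl⟩ | ⟨i, α, a, ha, x, hx, rfl⟩)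
  · exact magicL_mem_gQS (hQ.kerElt_mem_tri h2 ha i)
  · exact magicR_mem_gQS hd
  · exact magicI_mem_gQS _ _

theorem gQS_eq_span (h2 : (2 : k) ≠ 0) (hQ : IsQuaternionAlgebra k Q) :
    gQS k Q C = Submodule.span k (magicGen k Q C 0) ⊔ Submodule.span k (magicGen k Q C 1) := by
  apply le_antisymm
  · intro u hu
    rw [eq_magicL_add u]
    refine add_mem (add_mem ?_ ?_) (sum_mem fun i _ => ?_)
    · obtain ⟨a, ha, h⟩ := hQ.exists_eq_sum_kerElt h2 hu.1
      rw [h, map_sum]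
      exact sum_mem fun i _ => Submodule.mem_sup_left
        (Submodule.subset_span (Or.inl ⟨rfl, a i, ha i, i, rfl⟩))
    · obtain ⟨d, hd, d', hd', h⟩ := Submodule.mem_sup.1 hu.2.1
      rw [← h, map_add]
      exact Submodule.add_mem_sup (Submodule.subset_span (Or.inr (Or.inl ⟨d, hd, rfl⟩)))
        (Submodule.subset_span (Or.inr (Or.inl ⟨d', hd', rfl⟩)))
    · generalize u.2.2 i = z
      induction z with
      | zero => rw [map_zero]; exact zero_mem _
      | add z w hz hw => rw [map_add]; exact add_mem hz hw
      | tmul c x =>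
        obtain ⟨α, a, ha, rfl⟩ := hQ.exists_eq_smul_one_add h2 c
        rw [← proj_add (k := k) x, TensorProduct.tmul_add, map_add]
        exact Submodule.add_mem_sup
          (Submodule.subset_span (Or.inr (Or.inr ⟨i, α, a, ha, _, proj_mem_part 0 x, rfl⟩)))
          (Submodule.subset_span (Or.inr (Or.inr ⟨i, α, a, ha, _, proj_mem_part 1 x, rfl⟩)))
  · exact sup_le (Submodule.span_le.2 (magicGen_subset_gQS h2 hQ 0))
      (Submodule.span_le.2 (magicGen_subset_gQS h2 hQ 1))

theorem magicI_disjoint {i j : Fin 3} (hij : i ≠ j) (z w : Q ⊗[k] C) (n : Fin 3) :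
    (magicI k Q C i z).2.2 n = 0 ∨ (magicI k Q C j w).2.2 n = 0 := by
  rcases eq_or_ne n i with rfl | h
  · exact Or.inr (by simp [magicI_apply, hij])
  · exact Or.inl (by simp [magicI_apply, h])

section Closed

set_option maxSynthPendingDepth 5

theorem superComm_mem_triPart [Nontrivial C] (h2 : (2 : k) ≠ 0) {d e : Fin 3 → Module.End k C}
    (hd : d ∈ triPart (paraMul k C) b p) (he : e ∈ triPart (paraMul k C) b q) :
    (fun i => superComm k C (d i) (e i)) ∈
      triPart (paraMul k C) (b : C →ₗ[k] C →ₗ[k] k) (p + q) := by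
  have hc := superComm_DtriJ h2 (fun i => (hd.1 i).1) (fun i => (he.1 i).1)
  have h := compJ_mem_triPart h2
    (superComm_mem_derPart (DtriJ_mem_derPart h2 hd) (DtriJ_mem_derPart h2 he))
    (fun l => by rw [hc, DtriJ_eJ])
  rw [hc] at h
  simpa only [compJ_DtriJ h2] using h

theorem magicLin_mem_gQS [Nontrivial C] (h2 : (2 : k) ≠ 0) (hQ : IsQuaternionAlgebra k Q)
    (hu : u ∈ magicGen k Q C p) (hv : v ∈ magicGen k Q C q) :
    magicLin (paraMulOp k Q) b (paraMul k C) b u v ∈ gQS k Q C := by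
  have hu' := magicGen_subset hQ p hu
  have hv' := magicGen_subset hQ q hv
  have hswap : (∀ i, u.2.2 i = 0 ∨ v.2.2 i = 0) →
      magicLin (paraMulOp k Q) b (paraMul k C) b v u ∈ gQS k Q C →
      magicLin (paraMulOp k Q) b (paraMul k C) b u v ∈ gQS k Q C := fun h h' => by
    rw [magicLin_skew _ _ _ _ hu' hv' h]
    exact neg_mem (Submodule.smul_mem _ _ h')
  rcases hu with ⟨rfl, a, ha, i, rfl⟩ | ⟨d, hd, rfl⟩ | ⟨i, α, a, ha, x, hx, rfl⟩ <;>
    rcases hv with ⟨rfl, c, hc, j, rfl⟩ | ⟨e, he, rfl⟩ | ⟨j, γ, c, hc, y, hy, rfl⟩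
  · rw [magicLin_L_L _ _ _ _ (fun _ => hQ.even_end _) (fun _ => hQ.even_end _)]
    apply magicL_mem_gQS
    rcases eq_or_ne i j with rfl | hij
    · simp only [IsQuaternionAlgebra.superComm_kerElt_self h2 hQ]
      exact hQ.kerElt_mem_tri h2 (hQ.commutator_mem_traceZero a c) i
    · simp only [IsQuaternionAlgebra.superComm_kerElt_of_ne h2 hQ a c hij]
      exact zero_mem _
  · rw [magicLin_L_R _ _ _ _ (fun _ => hQ.even_end _) (fun i => (he.1 i).1)]
    exact zero_mem _
  · rw [magicLin_L_I _ _ _ _ (fun _ => hQ.even_end _) (hQ.even _) hy]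
    exact magicI_mem_gQS _ _
  · refine hswap (fun i => Or.inl rfl) ?_
    rw [magicLin_L_R _ _ _ _ (fun _ => hQ.even_end _) (fun i => (hd.1 i).1)]
    exact zero_mem _
  · rw [magicLin_R_R _ _ _ _ (fun i => (hd.1 i).1) (fun i => (he.1 i).1)]
    exact magicR_mem_gQS (superComm_mem_triPart h2 hd he)
  · rw [magicLin_R_I _ _ _ _ (fun i => (hd.1 i).1) (hQ.even _) hy]
    exact magicI_mem_gQS _ _
  · refine hswap (fun i => Or.inr rfl) ?_
    rw [magicLin_L_I _ _ _ _ (fun _ => hQ.even_end _) (hQ.even _) hx]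
    exact magicI_mem_gQS _ _
  · refine hswap (fun i => Or.inr rfl) ?_
    rw [magicLin_R_I _ _ _ _ (fun i => (he.1 i).1) (hQ.even _) hx]
    exact magicI_mem_gQS _ _
  · rcases fin3_cases i j with rfl | rfl | rfl
    · rw [magicLin_I_I_self _ _ _ _ (hQ.even _) hx (hQ.even _) hy,
        IsQuaternionAlgebra.tElt_paraMulOp h2 hQ α γ ha hc]
      have e3 : ∀ u v : Fin 3 → Module.End k Q, theta i (u + v) = theta i u + theta i v :=
        fun _ _ => rfl
      have hac := Submodule.smul_mem _ (2 : k)⁻¹ (hQ.commutator_mem_traceZero a c)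
      rw [e3, IsQuaternionAlgebra.theta_kerElt, IsQuaternionAlgebra.theta_kerElt]
      exact add_mem (magicL_mem_gQS (Submodule.smul_mem _ _ (add_mem
          (hQ.kerElt_mem_tri h2 (add_mem (sub_mem (Submodule.smul_mem _ _ ha)
            (Submodule.smul_mem _ _ hc)) hac) _)
          (hQ.kerElt_mem_tri h2 (add_mem (sub_mem (Submodule.smul_mem _ _ hc)
            (Submodule.smul_mem _ _ ha)) hac) _))))
        (magicR_mem_gQS (Submodule.smul_mem _ _ (theta_tElt_mem_triPart h2 i hx hy)))
    · rw [magicLin_I_I_succ _ _ _ _ (hQ.even _) hx (hQ.even _) hy]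
      exact magicI_mem_gQS _ _
    · refine hswap (magicI_disjoint (by simp) _ _) ?_
      have h := magicLin_I_I_succ (paraMulOp k Q) b (paraMul k C) b (hQ.even (γ • 1 + c)) hy
        (hQ.even (α • 1 + a)) hx (i + 2)
      rw [fin3_two_one] at h
      rw [h]
      exact magicI_mem_gQS _ _

end Closed

end MagicGen

namespace IsPeirceDatum

variable {k Q C J : Type*} [Field k]
  [NonAssocRing Q] [Module k Q] [IsScalarTower k Q Q] [SMulCommClass k Q Q]
  [HurwitzSuperalgebra k Q]
  [NonAssocRing C] [Module k C] [IsScalarTower k C C] [SMulCommClass k C C]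
  [HurwitzSuperalgebra k C]
  [AddCommGroup J] [Module k J] [Superspace k J]
  {m : J →ₗ[k] J →ₗ[k] J} {e : Fin 3 → J} {ι : Fin 3 → C →ₗ[k] J}
  {D : Fin 3 → C →ₗ[k] Module.End k J} {T : (Fin 3 → Module.End k C) →ₗ[k] Module.End k J}
  {l : Module.End k Q →ₗ[k] Q} {p q : ZMod 2} {u v : MagicSpace k Q C}
  {Der : ZMod 2 → Submodule k (Module.End k J)}

theorem phiLin_mem_part (h : IsPeirceDatum m e ι D T) (h2 : (2 : k) ≠ 0)
    (hQ : IsQuaternionAlgebra k Q)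
    (hl : ∀ a ∈ traceZero k Q, l (LinearMap.mulLeft k a) = a ∧ l (LinearMap.mulRight k a) = 0)
    (hu : u ∈ magicGen k Q C p) : phiLin l e ι D T u ∈ part k (TitsSum k Q J) p := by
  rcases hu with ⟨rfl, a, ha, i, rfl⟩ | ⟨d, hd, rfl⟩ | ⟨i, α, a, ha, x, hx, rfl⟩
  · rw [phiLin_L hl ha]
    exact titsTmul_mem hQ a (h.e_mem i)
  · rw [phiLin_R]
    exact titsDer_mem (h.T_mem fun i => (hd.1 i).1)
  · rw [phiLin_I, phiTensor_tmul h2 hQ i α ha]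
    exact sub_mem (Submodule.smul_mem _ _ (titsDer_mem (h.D_mem i hx)))
      (Submodule.smul_mem _ _ (titsTmul_mem hQ a (h.iota_mem i hx)))

theorem phiLin_mem_titsSub (h2 : (2 : k) ≠ 0) (hQ : IsQuaternionAlgebra k Q)
    (hD : ∀ i {p x}, x ∈ part k C p → D i x ∈ Der p)
    (hT : ∀ {p d}, d ∈ triPart (paraMul k C) b p → T d ∈ Der p)
    (hl : ∀ a ∈ traceZero k Q, l (LinearMap.mulLeft k a) = a ∧ l (LinearMap.mulRight k a) = 0)
    (hu : u ∈ magicGen k Q C p) : phiLin l e ι D T u ∈ titsSub Q Der := by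
  rcases hu with ⟨rfl, a, ha, i, rfl⟩ | ⟨d, hd, rfl⟩ | ⟨i, α, a, ha, x, hx, rfl⟩
  · rw [phiLin_L hl ha]
    exact titsTmul_mem_titsSub ha _
  · rw [phiLin_R]
    exact titsDer_mem_titsSub (hT hd)
  · rw [phiLin_I, phiTensor_tmul h2 hQ i α ha]
    exact sub_mem (Submodule.smul_mem _ _ (titsDer_mem_titsSub (hD i hx)))
      (Submodule.smul_mem _ _ (titsTmul_mem_titsSub ha _))

theorem phiLin_magicLin (h : IsPeirceDatum m e ι D T) (hm : IsTitsDatum m Der) (h2 : (2 : k) ≠ 0)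
    (hQ : IsQuaternionAlgebra k Q)
    (hD : ∀ i {p x}, x ∈ part k C p → D i x ∈ Der p)
    (hT : ∀ {p d}, d ∈ triPart (paraMul k C) b p → T d ∈ Der p)
    (hl : ∀ a ∈ traceZero k Q, l (LinearMap.mulLeft k a) = a ∧ l (LinearMap.mulRight k a) = 0)
    (hu : u ∈ magicGen k Q C p) (hv : v ∈ magicGen k Q C q) :
    phiLin l e ι D T (magicLin (paraMulOp k Q) b (paraMul k C) b u v) =
      titsLin Q m (phiLin l e ι D T u) (phiLin l e ι D T v) := by
  have hu' := magicGen_subset hQ p hu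
  have hv' := magicGen_subset hQ q hv
  have hswap : (∀ i, u.2.2 i = 0 ∨ v.2.2 i = 0) →
      phiLin l e ι D T (magicLin (paraMulOp k Q) b (paraMul k C) b v u) =
        titsLin Q m (phiLin l e ι D T v) (phiLin l e ι D T u) →
      phiLin l e ι D T (magicLin (paraMulOp k Q) b (paraMul k C) b u v) =
        titsLin Q m (phiLin l e ι D T u) (phiLin l e ι D T v) := fun h0 h' => by
    rw [magicLin_skew _ _ _ _ hu' hv' h0, map_neg, map_smul, h']
    exact ((hm.isLieSuperalgebra h2 hQ).skew p q _
      ⟨phiLin_mem_titsSub h2 hQ hD hT hl hu, h.phiLin_mem_part h2 hQ hl hu⟩ _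
      ⟨phiLin_mem_titsSub h2 hQ hD hT hl hv, h.phiLin_mem_part h2 hQ hl hv⟩).symm
  rcases hu with ⟨rfl, a, ha, i, rfl⟩ | ⟨d, hd, rfl⟩ | ⟨i, α, a, ha, x, hx, rfl⟩ <;>
    rcases hv with ⟨rfl, c, hc, j, rfl⟩ | ⟨d', hd', rfl⟩ | ⟨j, γ, c, hc, y, hy, rfl⟩
  · rw [h.phiLin_L_L h2 hQ hl a c, phiLin_L hl ha, phiLin_L hl hc]
  · rw [h.phiLin_L_R hQ hd', phiLin_L hl ha, phiLin_R]
  · rw [h.phiLin_L_I h2 hQ ha γ hc hy, phiLin_L hl ha, phiLin_I, phiTensor_tmul h2 hQ _ _ hc]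
  · refine hswap (fun i => Or.inl rfl) ?_
    rw [h.phiLin_L_R hQ hd, phiLin_L hl hc, phiLin_R]
  · rw [h.phiLin_R_R hd hd', phiLin_R, phiLin_R]
  · rw [h.phiLin_R_I h2 hQ hd γ hc hy, phiLin_R, phiLin_I, phiTensor_tmul h2 hQ _ _ hc]
  · refine hswap (fun i => Or.inr rfl) ?_
    rw [h.phiLin_L_I h2 hQ hc α ha hx, phiLin_L hl hc, phiLin_I, phiTensor_tmul h2 hQ _ _ ha]
  · refine hswap (fun i => Or.inr rfl) ?_
    rw [h.phiLin_R_I h2 hQ hd' α ha hx, phiLin_R, phiLin_I, phiTensor_tmul h2 hQ _ _ ha]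
  · rcases fin3_cases i j with rfl | rfl | rfl
    · rw [h.phiLin_I_I_self h2 hQ hl α γ ha hc hx hy, phiLin_I, phiLin_I,
        phiTensor_tmul h2 hQ _ _ ha, phiTensor_tmul h2 hQ _ _ hc]
    · rw [h.phiLin_I_I_succ h2 hQ α γ ha hc hx hy, phiLin_I, phiLin_I,
        phiTensor_tmul h2 hQ _ _ ha, phiTensor_tmul h2 hQ _ _ hc]
    · refine hswap (magicI_disjoint (by simp) _ _) ?_
      have h' := h.phiLin_I_I_succ (l := l) h2 hQ γ α hc ha hy hx (i + 2)
      rw [fin3_two_one] at h'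
      rw [h', phiLin_I, phiLin_I, phiTensor_tmul h2 hQ _ _ ha, phiTensor_tmul h2 hQ _ _ hc]

end IsPeirceDatum

/-- Coordinates with respect to the elements `eᵢ` and `ιᵢ(x)` of `J` and to the derivations
`Dᵢ(x)` and `D_{(d₀,d₁,d₂)}`. -/
structure IsPeirceCoordinates {k C J : Type*} [Field k] [NonAssocRing C] [Module k C]
    [IsScalarTower k C C] [SMulCommClass k C C] [HurwitzSuperalgebra k C]
    [AddCommGroup J] [Module k J] (Der : ZMod 2 → Submodule k (Module.End k J)) (e : Fin 3 → J)
    (ι : Fin 3 → C →ₗ[k] J) (D : Fin 3 → C →ₗ[k] Module.End k J)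
    (T : (Fin 3 → Module.End k C) →ₗ[k] Module.End k J) (δ : Fin 3 → J →ₗ[k] k)
    (κ : Fin 3 → J →ₗ[k] C) (τ : Fin 3 → Module.End k J →ₗ[k] Module.End k C) : Prop where
  D_mem : ∀ i {p x}, x ∈ part k C p → D i x ∈ Der p
  T_mem : ∀ {p d}, d ∈ triPart (paraMul k C) b p → T d ∈ Der p
  diag_e : ∀ i j, δ j (e i) = if j = i then 1 else 0
  diag_iota : ∀ i j x, δ j (ι i x) = 0
  coord_e : ∀ i j, κ j (e i) = 0
  coord_iota : ∀ i j x, κ j (ι i x) = if j = i then (2 : k) • x else 0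
  comp_T : ∀ d i, τ i (T d) = d i
  comp_D : ∀ {p x}, x ∈ part k C p → ∀ i j, τ j (D i x) = 0
  coord_D : ∀ {p x}, x ∈ part k C p → ∀ i j, κ i (D j x (e (i + 1))) = if i = j then x else 0
  eq_sum : ∀ X, X = ∑ i, (δ i X • e i + (2 : k)⁻¹ • ι i (κ i X))
  exists_eq : ∀ {p d}, d ∈ Der p → ∃ t ∈ triPart (paraMul k C) (b : C →ₗ[k] C →ₗ[k] k) p,
    ∃ x : Fin 3 → C, d = T t + ∑ i, D i (x i)

section Psi

variable {k Q C J : Type*} [Field k]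
  [NonAssocRing Q] [Module k Q] [IsScalarTower k Q Q] [SMulCommClass k Q Q]
  [HurwitzSuperalgebra k Q]
  [NonAssocRing C] [Module k C] [IsScalarTower k C C] [SMulCommClass k C C]
  [HurwitzSuperalgebra k C]
  [AddCommGroup J] [Module k J] [Superspace k J]

/-- The inverse of `Φ₃`, in terms of the coordinates of the elements of `J` and of the
endomorphisms of `J`. -/
noncomputable def psiLin (e : Fin 3 → J) (δ : Fin 3 → J →ₗ[k] k) (κ : Fin 3 → J →ₗ[k] C)
    (τ : Fin 3 → Module.End k J →ₗ[k] Module.End k C) : TitsSum k Q J →ₗ[k] MagicSpace k Q C :=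
  (∑ i, magicL k Q C ∘ₗ IsQuaternionAlgebra.kerLin k i ∘ₗ (TensorProduct.rid k Q).toLinearMap ∘ₗ
      (δ i).lTensor Q - ∑ i, magicI k Q C i ∘ₗ (κ i).lTensor Q) ∘ₗ LinearMap.fst k _ _ +
  (magicR k Q C ∘ₗ LinearMap.pi τ + ∑ i, magicI k Q C i ∘ₗ TensorProduct.mk k Q C 1 ∘ₗ κ i ∘ₗ
      LinearMap.applyₗ (e (i + 1))) ∘ₗ LinearMap.snd k _ _

variable {e : Fin 3 → J} {ι : Fin 3 → C →ₗ[k] J}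
  {D : Fin 3 → C →ₗ[k] Module.End k J} {T : (Fin 3 → Module.End k C) →ₗ[k] Module.End k J}
  {l : Module.End k Q →ₗ[k] Q} {δ : Fin 3 → J →ₗ[k] k} {κ : Fin 3 → J →ₗ[k] C}
  {τ : Fin 3 → Module.End k J →ₗ[k] Module.End k C}
  {Der : ZMod 2 → Submodule k (Module.End k J)}

theorem psiLin_tmul (a : Q) (X : J) : psiLin e δ κ τ (titsTmul k J a X) =
    ∑ i, δ i X • magicL k Q C (kerElt k a i) - ∑ i, magicI k Q C i (a ⊗ₜ[k] κ i X) := by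
  simp [psiLin, titsTmul_apply, IsQuaternionAlgebra.kerLin_apply]

theorem psiLin_der (d : Module.End k J) : psiLin e δ κ τ (titsDer k Q J d) =
    magicR k Q C (fun i => τ i d) + ∑ i, magicI k Q C i (1 ⊗ₜ[k] κ i (d (e (i + 1)))) := by
  simp [psiLin, titsDer_apply]
  rfl

theorem psiLin_phiLin (hP : IsPeirceCoordinates Der e ι D T δ κ τ) (h2 : (2 : k) ≠ 0)
    (hQ : IsQuaternionAlgebra k Q)
    (hl : ∀ a ∈ traceZero k Q, l (LinearMap.mulLeft k a) = a ∧ l (LinearMap.mulRight k a) = 0)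
    (hTe : ∀ d i, T d (e i) = 0) {p : ZMod 2} {u : MagicSpace k Q C} (hu : u ∈ magicGen k Q C p) :
    psiLin e δ κ τ (phiLin l e ι D T u) = u := by
  rcases hu with ⟨rfl, a, ha, i, rfl⟩ | ⟨d, hd, rfl⟩ | ⟨i, α, a, ha, x, hx, rfl⟩
  · rw [phiLin_L hl ha, psiLin_tmul]
    simp [hP.diag_e, hP.coord_e]
  · rw [phiLin_R, psiLin_der]
    simp [hP.comp_T, hTe]
  · rw [phiLin_I, phiTensor_tmul h2 hQ i α ha, map_sub, map_smul, map_smul, psiLin_tmul, psiLin_der]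
    have h1 : (fun j => τ j (D i x)) = 0 := funext fun j => hP.comp_D hx i j
    have h3 : ∀ j, magicI k Q C j ((1 : Q) ⊗ₜ[k] κ j (D i x (e (j + 1)))) =
        if j = i then magicI k Q C i (1 ⊗ₜ[k] x) else 0 := fun j => by
      rw [hP.coord_D hx]
      split_ifs with h
      · rw [h]
      · rw [TensorProduct.tmul_zero, map_zero]
    have h4 : ∀ j, magicI k Q C j (a ⊗ₜ[k] κ j (ι i x)) =
        if j = i then magicI k Q C i (a ⊗ₜ[k] ((2 : k) • x)) else 0 := fun j => by
      rw [hP.coord_iota]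
      split_ifs with h
      · rw [h]
      · rw [TensorProduct.tmul_zero, map_zero]
    simp only [h1, h3, h4, hP.diag_iota, map_zero, zero_smul, Finset.sum_const_zero, Finset.sum_ite_eq',
      Finset.mem_univ, if_true, zero_add, zero_sub, TensorProduct.add_tmul, map_add,
      TensorProduct.tmul_smul, ← TensorProduct.smul_tmul', map_smul]
    match_scalars <;> field_simp

theorem phiTensor_rTensor (h2 : (2 : k) ≠ 0) (hQ : IsQuaternionAlgebra k Q) (i : Fin 3)
    (z : k ⊗[k] C) : phiTensor ι D i ((LinearMap.toSpanSingleton k Q 1).rTensor C z) =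
      titsDer k Q J (D i (TensorProduct.lid k C z)) := by
  induction z with
  | zero => simp only [map_zero]
  | add z w hz hw => simp only [map_add, hz, hw]
  | tmul α x =>
    have h := phiTensor_tmul (ι := ι) (D := D) h2 hQ i α (zero_mem (traceZero k Q)) x
    rw [add_zero, map_zero, LinearMap.zero_apply, smul_zero, sub_zero] at h
    rw [LinearMap.rTensor_tmul, LinearMap.toSpanSingleton_apply, h, TensorProduct.lid_tmul,
      map_smul, map_smul]

theorem phiLin_inclS1 (h2 : (2 : k) ≠ 0) (hQ : IsQuaternionAlgebra k Q) (u : MagicSpace k k C) :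
    phiLin l e ι D T (inclS1 Q u) =
      (0, T u.2.1 + ∑ i, D i (TensorProduct.lid k C (u.2.2 i))) := by
  rw [phiLin_apply, ← titsDer_apply]
  have h1 : ∑ i, titsTmul k J (l ((inclS1 Q u).1 (i + 2))) (e i) = 0 := by
    refine Finset.sum_eq_zero fun i _ => ?_
    change titsTmul k J (l 0) (e i) = 0
    rw [map_zero, map_zero, LinearMap.zero_apply]
  rw [h1, zero_add, map_add, map_sum]
  congr 1
  exact Finset.sum_congr rfl fun i _ => phiTensor_rTensor h2 hQ i _

theorem phiLin_kerElt
    (hl : ∀ a ∈ traceZero k Q, l (LinearMap.mulLeft k a) = a ∧ l (LinearMap.mulRight k a) = 0)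
    {a : Q} (ha : a ∈ traceZero k Q) (i : Fin 3) :
    phiLin l e ι D T (kerElt k a i, 0, 0) = (a ⊗ₜ[k] e i, 0) :=
  phiLin_L hl ha i

theorem phiLin_single (h2 : (2 : k) ≠ 0) (hQ : IsQuaternionAlgebra k Q) {a : Q}
    (ha : a ∈ traceZero k Q) (i : Fin 3) (x : C) :
    phiLin l e ι D T (0, 0, Pi.single i (a ⊗ₜ[k] x)) = (-((2 : k)⁻¹ • (a ⊗ₜ[k] ι i x)), 0) := by
  have h := phiTensor_tmul (ι := ι) (D := D) h2 hQ i 0 ha x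
  rw [zero_smul, zero_add, zero_smul, zero_sub] at h
  rw [← magicI_apply, phiLin_I, h, titsTmul_apply, Prod.smul_mk, smul_zero, Prod.neg_mk, neg_zero]

theorem gQS_induction (h2 : (2 : k) ≠ 0) (hQ : IsQuaternionAlgebra k Q)
    {P : MagicSpace k Q C → Prop} (gen : ∀ p, ∀ u ∈ magicGen k Q C p, P u) (zero : P 0)
    (add : ∀ u v, P u → P v → P (u + v)) (smul : ∀ (c : k) u, P u → P (c • u))
    {u : MagicSpace k Q C} (hu : u ∈ gQS k Q C) : P u := by
  rw [gQS_eq_span h2 hQ, ← Submodule.span_union] at hu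
  induction hu using Submodule.span_induction with
  | mem u hu => rcases hu with hu | hu <;> exact gen _ u hu
  | zero => exact zero
  | add u v _ _ h h' => exact add u v h h'
  | smul c u _ h => exact smul c u h

theorem gQSBracket_eq :
    gQSBracket k Q C = fun u v => magicLin (paraMulOp k Q) b (paraMul k C) b u v := magicBracket_eq ..

theorem gQSBracket_mem [Nontrivial C] (h2 : (2 : k) ≠ 0) (hQ : IsQuaternionAlgebra k Q)
    {u v : MagicSpace k Q C} (hu : u ∈ gQS k Q C) (hv : v ∈ gQS k Q C) :
    gQSBracket k Q C u v ∈ gQS k Q C := by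
  rw [gQSBracket_eq]
  refine gQS_induction h2 hQ
    (P := fun u => magicLin (paraMulOp k Q) b (paraMul k C) b u v ∈ gQS k Q C)
    (fun p u hu => gQS_induction h2 hQ
      (P := fun v => magicLin (paraMulOp k Q) b (paraMul k C) b u v ∈ gQS k Q C)
      (fun q v hv => magicLin_mem_gQS h2 hQ hu hv) ?_ ?_ ?_ hv) ?_ ?_ ?_ hu
  · rw [map_zero]; exact zero_mem _
  · intro u v h h'; rw [map_add]; exact add_mem h h'
  · intro c u h; rw [map_smul]; exact Submodule.smul_mem _ _ h
  · rw [map_zero]; exact zero_mem _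
  · intro u v h h'; rw [map_add]; exact add_mem h h'
  · intro c u h; rw [map_smul]; exact Submodule.smul_mem _ _ h

theorem IsPeirceDatum.exists_equiv [Nontrivial C] {m : J →ₗ[k] J →ₗ[k] J}
    (h : IsPeirceDatum m e ι D T) (hP : IsPeirceCoordinates Der e ι D T δ κ τ)
    (hm : IsTitsDatum m Der) (h2 : (2 : k) ≠ 0) (hQ : IsQuaternionAlgebra k Q)
    (hl : ∀ a ∈ traceZero k Q, l (LinearMap.mulLeft k a) = a ∧ l (LinearMap.mulRight k a) = 0) :
    ∃ Φ : gQS k Q C ≃ₗ[k] titsSub Q Der, (∀ u, (Φ u : TitsSum k Q J) = phiLin l e ι D T u) ∧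
      IsLieSuperIso (gQSBracket k Q C) (gQS k Q C) (fun u v => titsLin Q m u v) (titsSub Q Der)
        Φ := by
  have hmem : ∀ u ∈ gQS k Q C, phiLin l e ι D T u ∈ titsSub Q Der := fun u hu => by
    refine gQS_induction h2 hQ (P := fun u => phiLin l e ι D T u ∈ titsSub Q Der)
      (fun p u hu => IsPeirceDatum.phiLin_mem_titsSub h2 hQ hP.D_mem hP.T_mem hl hu) ?_ ?_ ?_ hu
    · rw [map_zero]; exact zero_mem _
    · intro u v h h'; rw [map_add]; exact add_mem h h'
    · intro c u h; rw [map_smul]; exact Submodule.smul_mem _ _ h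
  have hinv : ∀ u ∈ gQS k Q C, psiLin e δ κ τ (phiLin l e ι D T u) = u := fun u hu => by
    refine gQS_induction h2 hQ (P := fun u => psiLin e δ κ τ (phiLin l e ι D T u) = u)
      (fun p u hu => psiLin_phiLin hP h2 hQ hl h.T_e hu) ?_ ?_ ?_ hu
    · rw [map_zero, map_zero]
    · intro u v h h'; rw [map_add, map_add, h, h']
    · intro c u h; rw [map_smul, map_smul, h]
  have hsurj : titsSub Q Der ≤ (gQS k Q C).map (phiLin l e ι D T) := by
    have key : ∀ p, ∀ v ∈ titsGen Q Der p, v ∈ (gQS k Q C).map (phiLin l e ι D T) := by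
      rintro p _ (⟨a, ha, X, -, rfl⟩ | ⟨d, hd, rfl⟩)
      · rw [hP.eq_sum X, map_sum]
        refine sum_mem fun i _ => ?_
        rw [map_add, map_smul, map_smul]
        refine add_mem (Submodule.smul_mem _ _ ?_) (Submodule.smul_mem _ _ ?_)
        · exact ⟨_, magicL_mem_gQS (hQ.kerElt_mem_tri h2 ha i), phiLin_L hl ha i⟩
        · refine ⟨magicI k Q C i (((0 : k) • 1 + -(2 : k) • a) ⊗ₜ[k] κ i X),
            magicI_mem_gQS _ _, ?_⟩
          rw [phiLin_I, phiTensor_tmul h2 hQ i 0 (Submodule.smul_mem _ _ ha), zero_smul,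
            zero_sub, map_smul, LinearMap.smul_apply, neg_smul, smul_neg, neg_neg,
            inv_smul_smul₀ h2]
      · obtain ⟨t, ht, x, rfl⟩ := hP.exists_eq hd
        rw [map_add, map_sum]
        refine add_mem ⟨_, magicR_mem_gQS ht, phiLin_R t⟩ (sum_mem fun i _ => ?_)
        refine ⟨magicI k Q C i (((1 : k) • 1 + 0) ⊗ₜ[k] x i), magicI_mem_gQS _ _, ?_⟩
        rw [phiLin_I, phiTensor_tmul h2 hQ i 1 (zero_mem _), one_smul, map_zero,
          LinearMap.zero_apply, smul_zero, sub_zero]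
    rw [titsSub_eq_span]
    exact sup_le (Submodule.span_le.2 (key 0)) (Submodule.span_le.2 (key 1))
  have heven : ∀ p, ∀ u ∈ gQS k Q C, u ∈ part k _ p →
      phiLin l e ι D T u ∈ part k (TitsSum k Q J) p := fun p u hu hp => by
    have hs : u ∈ Submodule.span k (magicGen k Q C p) := by
      rw [← IsLieSuperalgebra.inf_part_eq_span (gQS_eq_span h2 hQ) (magicGen_subset hQ) p]
      exact ⟨hu, hp⟩
    clear hu hp
    induction hs using Submodule.span_induction with
    | mem u hu => exact h.phiLin_mem_part h2 hQ hl hu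
    | zero => rw [map_zero]; exact zero_mem _
    | add u v _ _ h h' => rw [map_add]; exact add_mem h h'
    | smul c u _ h => rw [map_smul]; exact Submodule.smul_mem _ _ h
  have hbr : ∀ u ∈ gQS k Q C, ∀ v ∈ gQS k Q C, phiLin l e ι D T (gQSBracket k Q C u v) =
      titsLin Q m (phiLin l e ι D T u) (phiLin l e ι D T v) := fun u hu v hv => by
    rw [gQSBracket_eq]
    refine gQS_induction h2 hQ
      (P := fun u => phiLin l e ι D T (magicLin (paraMulOp k Q) b (paraMul k C) b u v) =
        titsLin Q m (phiLin l e ι D T u) (phiLin l e ι D T v))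
      (fun p u hu => gQS_induction h2 hQ
        (P := fun v => phiLin l e ι D T (magicLin (paraMulOp k Q) b (paraMul k C) b u v) =
          titsLin Q m (phiLin l e ι D T u) (phiLin l e ι D T v))
        (fun q v hv => h.phiLin_magicLin hm h2 hQ hP.D_mem hP.T_mem hl hu hv) ?_ ?_ ?_ hv)
      ?_ ?_ ?_ hu
    · simp only [map_zero]
    · intro u v h h'; simp only [map_add, h, h']
    · intro c u h; simp only [map_smul, h]
    · simp only [map_zero, LinearMap.zero_apply]
    · intro u v h h'; simp only [map_add, LinearMap.add_apply, h, h']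
    · intro c u h; simp only [map_smul, LinearMap.smul_apply, h]
  obtain ⟨Φ, hΦ⟩ : ∃ Φ : gQS k Q C ≃ₗ[k] titsSub Q Der,
      ∀ u, (Φ u : TitsSum k Q J) = phiLin l e ι D T u := by
    refine ⟨LinearEquiv.ofBijective ((phiLin l e ι D T).restrict hmem) ⟨?_, ?_⟩, fun u => rfl⟩
    · intro u v huv
      have e1 := congrArg (psiLin e δ κ τ) (congrArg Subtype.val huv)
      exact Subtype.ext (((hinv u u.2).symm.trans e1).trans (hinv v v.2))
    · rintro ⟨w, hw⟩
      obtain ⟨u, hu, rfl⟩ := hsurj hw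
      exact ⟨⟨u, hu⟩, rfl⟩
  refine ⟨Φ, hΦ, fun p u hp => ?_, fun u v w hw => ?_⟩
  · rw [hΦ]
    exact heven p u u.2 hp
  · rw [hΦ, hΦ, hΦ, hw, hbr u u.2 v v.2]

end Psi

section Final

set_option maxSynthPendingDepth 5

variable {k Q C : Type*} [Field k]
  [NonAssocRing Q] [Module k Q] [IsScalarTower k Q Q] [SMulCommClass k Q Q]
  [HurwitzSuperalgebra k Q]
  [NonAssocRing C] [Module k C] [IsScalarTower k C C] [SMulCommClass k C C]
  [HurwitzSuperalgebra k C]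

variable (k C) in
/-- `D_{(d₀,d₁,d₂)}` as a linear function of `(d₀, d₁, d₂)`. -/
noncomputable def DtriLin : (Fin 3 → Module.End k C) →ₗ[k] Module.End k (H3 k C) where
  toFun := DtriJ
  map_add' d d' := by
    ext1 X
    simp [DtriJ, Finset.sum_add_distrib]
  map_smul' c d := by
    ext1 X
    simp [DtriJ, Finset.smul_sum, smul_comm c]

theorem DtriLin_apply (d : Fin 3 → Module.End k C) : DtriLin k C d = DtriJ d := rfl

theorem isPeirceDatum_jmul [Nontrivial C] (h2 : (2 : k) ≠ 0) :
    IsPeirceDatum (jmul (k := k) (C := C)) (eJ k) iotaJ (DJlin k) (DtriLin k C) where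
  e_mem := eJ_mem
  iota_mem i _ _ hx := iotaJ_mem hx i
  D_mem i _ _ hx := by rw [DJlin_apply]; exact DJ_mem_part hx i
  T_mem hd := by rw [DtriLin_apply]; exact DtriJ_mem_part hd
  mul_e_e i j := by rw [jmul_eJ_eJ h2]
  mul_e_iota i j x := by rw [jmul_eJ_iotaJ]
  mul_iota_self i x y := by rw [jmul_iotaJ_self h2]
  mul_iota_succ i x y := by rw [jmul_iotaJ_succ h2]
  inner_e_e i j := by rw [innerDer_jmul, innerD_eJ_eJ h2]
  inner_e_iota_self i p x hx := by
    rw [innerDer_jmul, innerD_skew (eJ_mem i) (iotaJ_mem hx i), innerD_iotaJ_eJ_self h2 i hx,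
      smul_zero, neg_zero]
  inner_e_iota_one i p x hx := by
    rw [innerDer_jmul, innerD_skew (eJ_mem _) (iotaJ_mem hx i), innerD_iotaJ_eJ_one h2 i x, zero_mul,
      sgn_zero, one_smul, DJlin_apply]
  inner_e_iota_two i p x hx := by
    rw [innerDer_jmul, innerD_skew (eJ_mem _) (iotaJ_mem hx i), innerD_iotaJ_eJ_two h2 i hx, zero_mul,
      sgn_zero, one_smul, neg_neg, DJlin_apply]
  inner_iota_self i p q x y hx hy := by
    rw [innerDer_jmul, innerD_iotaJ_self h2 i hx hy, superComm_DJ_self h2 i hx hy, DtriLin_apply]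
  inner_iota_succ i p q x y hx hy := by
    rw [innerDer_jmul, innerD_iotaJ_succ h2 i hx hy, DJlin_apply]
  T_e d i := by rw [DtriLin_apply, DtriJ_eJ]
  T_iota d i x := by rw [DtriLin_apply, DtriJ_iotaJ h2]
  D_e_self i _ _ hx := by rw [DJlin_apply, DJ_eJ_self h2 hx i]
  D_e_one i _ _ hx := by rw [DJlin_apply, DJ_eJ_one h2 hx i]
  D_e_two i _ _ hx := by rw [DJlin_apply, DJ_eJ_two h2 hx i]
  D_iota_self i _ _ hx y := by rw [DJlin_apply, DJ_iotaJ_self h2 hx i y]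
  D_iota_one i _ _ hx y := by rw [DJlin_apply, DJ_iotaJ_one h2 hx i y]
  D_iota_two i _ _ _ _ hx hy := by rw [DJlin_apply, DJ_iotaJ_two h2 hx hy i]
  comm_D_self i _ _ _ _ hx hy := by
    rw [DJlin_apply, DJlin_apply, superComm_DJ_self h2 i hx hy, DtriLin_apply]
  comm_D_succ i _ _ _ _ hx hy := by
    rw [DJlin_apply, DJlin_apply, superComm_DJ_succ h2 i hx hy, DJlin_apply]
  comm_T_D i _ _ _ _ hd hx := by
    rw [DJlin_apply, DtriLin_apply, superComm_DtriJ_DJ h2 i hd hx, DJlin_apply]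
  comm_T hd he := by
    rw [DtriLin_apply, DtriLin_apply, superComm_DtriJ h2 hd he, DtriLin_apply]

theorem compJ_DJ (h2 : (2 : k) ≠ 0) {p : ZMod 2} {x : C} (hx : x ∈ part k C p) (i j : Fin 3) :
    compJ k j (DJ i x) = 0 := by
  refine linearMap_ext fun q y hy => ?_
  rw [compJ_apply, LinearMap.zero_apply]
  rcases fin3_cases i j with rfl | rfl | rfl
  · rw [DJ_iotaJ_self h2 hx, map_smul, map_sub, coordJ_eJ, coordJ_eJ, sub_zero, smul_zero, smul_zero]
  · rw [DJ_iotaJ_one h2 hx, map_neg, coordJ_iotaJ, if_neg (by simp), neg_zero, smul_zero]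
  · rw [DJ_iotaJ_two h2 hx hy, map_smul, coordJ_iotaJ, if_neg (by simp), smul_zero, smul_zero]

theorem isPeirceCoordinates_jmul [Nontrivial C] (h2 : (2 : k) ≠ 0) :
    IsPeirceCoordinates (derPart k C) (eJ k) iotaJ (DJlin k) (DtriLin k C) diagJ coordJ
      (compJ k) where
  D_mem i _ _ hx := by rw [DJlin_apply]; exact DJ_mem_derPart h2 hx i
  T_mem hd := by rw [DtriLin_apply]; exact DtriJ_mem_derPart h2 hd
  diag_e i j := by rw [diagJ_eJ h2]
  diag_iota i j x := by rw [diagJ_iotaJ]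
  coord_e i j := by rw [coordJ_eJ]
  coord_iota i j x := by rw [coordJ_iotaJ]
  comp_T d i := by rw [DtriLin_apply, compJ_DtriJ h2]
  comp_D hx i j := by rw [DJlin_apply, compJ_DJ h2 hx]
  coord_D hx i j := by rw [DJlin_apply, coordJ_DJ_eJ h2 hx]
  eq_sum X := H3.eq_sum h2 X
  exists_eq hd := by
    obtain ⟨t, ht, h⟩ := derPart_decomp h2 hd
    exact ⟨t, ht, _, h⟩

theorem tits_eq : tits k Q C = titsSub Q (derPart k C) := rfl

theorem PhiJ_eq (u : MagicSpace k k C) :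
    PhiJ u = DtriLin k C u.2.1 + ∑ i, DJlin k i (TensorProduct.lid k C (u.2.2 i)) := by
  rw [PhiJ, DtriLin_apply]
  simp only [DJlin_apply]

theorem gQS_graded (h2 : (2 : k) ≠ 0) (hQ : IsQuaternionAlgebra k Q) (p : ZMod 2)
    (u : MagicSpace k Q C) (hu : u ∈ gQS k Q C) : proj (k := k) p u ∈ gQS k Q C := by
  refine gQS_induction h2 hQ (P := fun u => proj (k := k) p u ∈ gQS k Q C)
    (fun r u hu => ?_) ?_ ?_ ?_ hu
  · rw [proj_eq_ite p (magicGen_subset hQ r hu)]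
    split_ifs
    · exact magicGen_subset_gQS h2 hQ r hu
    · exact zero_mem _
  · rw [map_zero]; exact zero_mem _
  · intro u v h h'; rw [map_add]; exact add_mem h h'
  · intro c u h; rw [map_smul]; exact Submodule.smul_mem _ _ h

end Final

theorem theorem3p3 {k Q C : Type*} [Field k] (h2 : (2 : k) ≠ 0)
    [NonAssocRing Q] [Module k Q] [IsScalarTower k Q Q] [SMulCommClass k Q Q]
    [HurwitzSuperalgebra k Q] (hQ : IsQuaternionAlgebra k Q)
    [NonAssocRing C] [Nontrivial C] [Module k C] [IsScalarTower k C C] [SMulCommClass k C C]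
    [FiniteDimensional k C] [HurwitzSuperalgebra k C] :
    IsLieSuperalgebra (gQSBracket k Q C) (gQS k Q C) ∧
    IsLieSuperalgebra (titsBracket k Q C) (tits k Q C) ∧
    (∀ (i : Fin 3) (d : Fin 3 → Module.End k Q),
      (d ∈ tri (HurwitzSuperalgebra.paraMulOp k Q) HurwitzSuperalgebra.b ∧ d i = 0) ↔
        ∃ a ∈ HurwitzSuperalgebra.traceZero k Q, d = kerElt k a i) ∧
    ∃ Φ₃ : gQS k Q C ≃ₗ[k] tits k Q C,
      IsLieSuperIso (gQSBracket k Q C) (gQS k Q C) (titsBracket k Q C) (tits k Q C) Φ₃ ∧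
      (∀ u ∈ gS1S k C, ∃ h : inclS1 Q u ∈ gQS k Q C,
        (Φ₃ ⟨inclS1 Q u, h⟩ : TitsSpace k Q C) = (0, PhiJ u)) ∧
      (∀ a ∈ HurwitzSuperalgebra.traceZero k Q, ∀ i : Fin 3,
        ∃ h : ((kerElt k a i, 0, 0) : MagicSpace k Q C) ∈ gQS k Q C,
          (Φ₃ ⟨(kerElt k a i, 0, 0), h⟩ : TitsSpace k Q C) = (a ⊗ₜ[k] eJ k i, 0)) ∧
      (∀ a ∈ HurwitzSuperalgebra.traceZero k Q, ∀ (i : Fin 3) (x : C),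
        ∃ h : ((0, 0, Pi.single i (a ⊗ₜ[k] x)) : MagicSpace k Q C) ∈ gQS k Q C,
          (Φ₃ ⟨(0, 0, Pi.single i (a ⊗ₜ[k] x)), h⟩ : TitsSpace k Q C) =
            (-((2 : k)⁻¹ • (a ⊗ₜ[k] iotaJ i x)), 0)) := by
  obtain ⟨l, hl⟩ := IsQuaternionAlgebra.exists_leftPart h2 hQ
  obtain ⟨Φ, hΦ, hiso⟩ := (isPeirceDatum_jmul (k := k) (C := C) h2).exists_equiv
    (isPeirceCoordinates_jmul h2) (isTitsDatum_jmul h2) h2 hQ hl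
  have htits := tits_isLieSuperalgebra (C := C) h2 hQ
  rw [tits_eq, titsBracket_eq] at htits ⊢
  refine ⟨?_, htits, IsQuaternionAlgebra.mem_tri_and_apply_eq_zero_iff h2 hQ, Φ, hiso,
    fun u hu => ?_, fun a ha i => ?_, fun a ha i x => ?_⟩
  · exact htits.of_equiv Φ (gQS_graded h2 hQ) hiso.even
      (fun u hu v hv => gQSBracket_mem h2 hQ hu hv) hiso.map_bracket
  · refine ⟨⟨zero_mem _, hu.2.1, trivial⟩, ?_⟩
    rw [hΦ, phiLin_inclS1 h2 hQ, PhiJ_eq]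
  · have h : ((kerElt k a i, 0, 0) : MagicSpace k Q C) ∈ gQS k Q C :=
      magicL_mem_gQS (hQ.kerElt_mem_tri h2 ha i)
    exact ⟨h, by rw [hΦ, phiLin_kerElt hl ha]⟩
  · have h : ((0, 0, Pi.single i (a ⊗ₜ[k] x)) : MagicSpace k Q C) ∈ gQS k Q C :=
      magicI_mem_gQS i _
    exact ⟨h, by rw [hΦ, phiLin_single h2 hQ ha]⟩
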